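/- **Setting.** Fix $d\ge 0$ (number of predictors) and $q$ (number of noise variables). For every sample size $n$ there is a data set $(X_i,Y_i,Z_i)_{i\le n}$, $Z_i=(Z_i^1,\dots,Z_i^d)$ (a triangular array; the dependence on $n$ is suppressed), with $$X_i=\sum_k\alpha_kZ_i^k+\varepsilon^X_i,\qquad Y_i=\sum_k\beta_kZ_i^k+\varepsilon^Y_i,$$ $$\varepsilon^X_i=\sum_{l\le q}a_{i,l}(Z_i)N_{i,l},\qquad \varepsilon^Y_i=\sum_{l\le q}b_{i,l}(Z_i)N_{i,l},$$ where, for each $n$, the $N_{i,l}$ are independent standard Gaussian variables, independent of $Z=(Z_1,\dots,Z_n)$, and $a_{i,l},b_{i,l}$ are measurable (they may depend on $n$; $\alpha,\beta$ do not). So, given $Z$, the error vectors are Gaussian, have mean zero and diagonal covariance matrices, with conditional variances $\sigma_{X,i}^2=\sum_l a_{i,l}(Z_i)^2$, $\sigma_{Y,i}^2=\sum_l b_{i,l}(Z_i)^2$, and the errors of sample $i$ have conditional correlation $\rho_i=\sum_l a_{i,l}(Z_i)b_{i,l}(Z_i)/(\sigma_{X,i}\sigma_{Y,i})$. Write $\rho_{X,Y|Z}$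 for the limit in probability of $\frac1n\sum_{i\le n}\rho_i$, assumed to exist; it is the common value of the $\rho_i$ if they are all equal. **Assumptions.** * For each node $V\in\{X,Y\}$ it is known that one of the following holds: $\sigma_{V,i}^2$ is a constant; $\sigma_{V,i}^2$ depends only on the sampling index $i$ (and $n$); $\sigma_{V,i}^2=s_V(Z_i^{m})$ for one known predictor $Z^{m}$ and one function $s_V$. * There are constants $0<c\le C$ with $c\le\sigma_{X,i}^2,\sigma_{Y,i}^2\le C$ almost surely for all $n$ and $i$. * The $Z_i^k$ are square-integrable and centered with variances bounded uniformly in $n,i,k$; for each $k$ the variables $Z_i^k$, $i\le n$, are uncorrelated. For all large $n$, $Z^TZ$ is almost surely positive definite, and $\frac1nZ^TZ$ converges entrywise in probability to a constant matrix. * The averages $\frac1n\sum_i\sigma_{X,i}^2$, $\frac1n\sum_i\sigma_{Y,i}^2$, $\frac1n\sum_i(Z_i^k)^2\sigma_{X,i}^2$ and $\frac1n\sum_i(Z_i^k)^2\sigma_{Y,i}^2$ (each $k$) converge in probability to constants. * The window lengths $\lambda=\lambda_n\in\mathbb N$ satisfy $\lambda\to\infty$ and $\lambda/n\to0$. For a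 node $V$ let $\mathcal S_i^V$ be the set of samples whose place differs from that of $i$ by at most $\lambda/2$, when the samples are sorted by the value of $Z^{m}$ (ties broken by index) if the variance of $V$ depends on $Z^{m}$, and kept in the order of the index otherwise. Averaging over these windows asymptotically reproduces the variances: $$\frac1n\sum_{i=1}^n\Big|\frac1\lambda\sum_{j\in\mathcal S_i^V}\sigma_{V,j}^2-\sigma_{V,i}^2\Big|\to0\quad\text{in probability, for }V=X,Y.$$ **ParCorr-WLS test at level $a\in(0,1)$.** For each node $V$ compute the OLS residuals $\tilde r$ of $V$ on $Z$ (without intercept). If $V$ is known to be homoskedastic, put $R^V=\tilde r$. Otherwise put $w_i=\big(\frac1\lambda\sum_{j\in\mathcal S_i^V}\tilde r_j^2\big)^{-1}$, let $r$ be the residuals of the weighted least squares regression of $V$ on $Z$ with weights $w$, and put $R_i^V=\sqrt{w_i}\,r_i$. Let $$\hat\rho=\frac{\frac1n\sum_iR_i^XR_i^Y}{\sqrt{\frac1n\sum_i(R_i^X)^2}\sqrt{\frac1n\sum_i(R_i^Y)^2}},\qquad T=\frac{\hat\rho\sqrt{n-2}}{\sqrt{1-\hat\rho^2}}$$ (with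 $|T|=\infty$ if $|\hat\rho|=1$), and reject the hypothesis of conditional independence if $|T|$ exceeds the $(1-\frac a2)$-quantile of Student's $t$-distribution with $n-2-d$ degrees of freedom. **Theorem.** Under these assumptions the ParCorr-WLS test with estimated weights is consistent for testing conditional independence of $X$ and $Y$ given $Z$: 1. $\hat\rho\to\rho_{X,Y|Z}$ in probability as $n\to\infty$; 2. for every $a\in(0,1)$: if $X_i$ and $Y_i$ are conditionally independent given $Z_i$ for all $n$ and $i$, then the limit superior of the rejection probability of the level-$a$ test is at most $a$; and if $\rho_{X,Y|Z}\ne0$, then its rejection probability tends to $1$. -/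

import Mathlib

open MeasureTheory ProbabilityTheory Filter Matrix
open scoped Topology

noncomputable section

namespace ParCorrWLS

/-! ### Student's t-distribution -/

/-- Student's t-distribution with `ν` degrees of freedom, given by its density. -/
def studentT (ν : ℝ) : Measure ℝ :=
  volume.withDensity fun x => ENNReal.ofReal
    (Real.Gamma ((ν + 1) / 2) / (Real.sqrt (ν * Real.pi) * Real.Gamma (ν / 2)) *
      (1 + x ^ 2 / ν) ^ (-((ν + 1) / 2)))

/-- The `p`-quantile of Student's t-distribution with `ν` degrees of freedom. -/
def tQuantile (p ν : ℝ) : ℝ :=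
  sInf {x : ℝ | ENNReal.ofReal p ≤ studentT ν (Set.Iic x)}

/-! ### The test, as a function of the data -/

/-- Expert knowledge about one node: what the variance of its noise depends on. -/
inductive Expert (d : ℕ) : Type
  /-- constant noise variance -/
  | homoskedastic : Expert d
  /-- the noise variance depends on the sampling index -/
  | samplingIndex : Expert d
  /-- the noise variance depends on the `m`-th predictor -/
  | predictor (m : Fin d) : Expert d

variable {n d : ℕ}

/-- The place of sample `i` in the ordering used for smoothing: the samples are sorted by
increasing value of the predictor `m` (ties are broken by the sampling index), respectively
kept in the order of the sampling index. -/
def position (E : Expert d) (Z : Fin n → Fin d → ℝ) (i : Fin n) : Fin n :=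
  match E with
  | .predictor m => (Tuple.sort fun j => Z j m).symm i
  | _ => i

/-- The smoothing window around sample `i`: all samples whose place differs from that of `i`
by at most `lam / 2`. -/
def window (E : Expert d) (lam : ℕ) (Z : Fin n → Fin d → ℝ) (i : Fin n) : Finset (Fin n) :=
  {j | 2 * |((position E Z i : ℕ) : ℤ) - ((position E Z j : ℕ) : ℤ)| ≤ (lam : ℤ)}

/-- The weighted least squares estimator `(Zᵀ W Z)⁻¹ Zᵀ W x` with `W = diag w`. -/
def wlsCoef (Z : Fin n → Fin d → ℝ) (w x : Fin n → ℝ) : Fin d → ℝ :=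
  ((of Z)ᵀ * diagonal w * of Z)⁻¹ *ᵥ (((of Z)ᵀ * diagonal w) *ᵥ x)

/-- The residuals of the weighted least squares regression of `x` on the columns of `Z`. -/
def wlsResid (Z : Fin n → Fin d → ℝ) (w x : Fin n → ℝ) (i : Fin n) : ℝ :=
  x i - ∑ k, Z i k * wlsCoef Z w x k

/-- The ordinary least squares residuals. -/
def olsResid (Z : Fin n → Fin d → ℝ) (x : Fin n → ℝ) : Fin n → ℝ :=
  wlsResid Z (fun _ => 1) x

/-- The estimated weights: reciprocals of the smoothed squared OLS residuals. -/
def weight (E : Expert d) (lam : ℕ) (Z : Fin n → Fin d → ℝ) (x : Fin n → ℝ) (i : Fin n) : ℝ :=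
  ((lam : ℝ)⁻¹ * ∑ j ∈ window E lam Z i, olsResid Z x j ^ 2)⁻¹

/-- The residuals that enter the correlation: plain OLS residuals if the node is known to be
homoskedastic, and otherwise the residuals of the WLS regression with the estimated weights,
rescaled by the square root of the weights, that is, divided by the estimated standard
deviations. -/
def scaledResid (E : Expert d) (lam : ℕ) (Z : Fin n → Fin d → ℝ) (x : Fin n → ℝ) :
    Fin n → ℝ :=
  match E with
  | .homoskedastic => olsResid Z x
  | E => fun i => Real.sqrt (weight E lam Z x i) * wlsResid Z (weight E lam Z x) x i

/-- The empirical correlation coefficient of centered data. -/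
def corr (r s : Fin n → ℝ) : ℝ :=
  ((n : ℝ)⁻¹ * ∑ i, r i * s i) /
    (Real.sqrt ((n : ℝ)⁻¹ * ∑ i, r i ^ 2) * Real.sqrt ((n : ℝ)⁻¹ * ∑ i, s i ^ 2))

/-- The estimated partial correlation of `x` and `y` given `Z`. -/
def parCorr (EX EY : Expert d) (lam : ℕ) (Z : Fin n → Fin d → ℝ) (x y : Fin n → ℝ) : ℝ :=
  corr (scaledResid EX lam Z x) (scaledResid EY lam Z y)

/-- The two-sided t-test at level `a` rejects. The inequality says that the studentized
correlation `T = ρ √(n - 2) / √(1 - ρ²)` satisfies `|T| > t(1 - a/2, n - 2 - d)`; it is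
multiplied by `√(1 - ρ²)`, so that `|ρ| = 1` (where `|T| = ∞`) leads to rejection. -/
def Rejects (EX EY : Expert d) (lam : ℕ) (a : ℝ) (Z : Fin n → Fin d → ℝ)
    (x y : Fin n → ℝ) : Prop :=
  tQuantile (1 - a / 2) ((n : ℝ) - 2 - d) *
      Real.sqrt (1 - parCorr EX EY lam Z x y ^ 2) <
    |parCorr EX EY lam Z x y| * Real.sqrt ((n : ℝ) - 2)

/-! ### The data-generating model -/

/-- The structural equation of a node with `d` predictors, driven by `q` noise variables.
Sample `i` (out of `n`) of the node is `∑ k, z k * coef k + ∑ l, load n i l z * N l`, where `z` is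
the row of predictor values and the `N l` are the noise variables of that sample. Two nodes with
a common noise variable are dependent given the predictors. -/
structure Node (d q : ℕ) where
  /-- linear effect of the predictors -/
  coef : Fin d → ℝ
  /-- scaling of the noise variables -/
  load : (n : ℕ) → Fin n → Fin q → (Fin d → ℝ) → ℝ
  measurable_load : ∀ n i l, Measurable (load n i l)

variable {q : ℕ}

/-- The error variable of sample `i`. -/
def Node.error (V : Node d q) (n : ℕ) (i : Fin n) (z : Fin d → ℝ) (N : Fin q → ℝ) : ℝ :=
  ∑ l, V.load n i l z * N l

/-- The values of the node in the `n` samples. -/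
def Node.value (V : Node d q) (n : ℕ) (Z : Fin n → Fin d → ℝ) (N : Fin n → Fin q → ℝ)
    (i : Fin n) : ℝ :=
  ∑ k, Z i k * V.coef k + V.error n i (Z i) (N i)

/-- The conditional variance `σ²` of the error of sample `i`, given the predictor values `z`. -/
def Node.errVar (V : Node d q) (n : ℕ) (i : Fin n) (z : Fin d → ℝ) : ℝ :=
  ∑ l, V.load n i l z ^ 2

/-- The conditional correlation of the errors of two nodes, given the predictor values `z`. -/
def condCorr (V W : Node d q) (n : ℕ) (i : Fin n) (z : Fin d → ℝ) : ℝ :=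
  (∑ l, V.load n i l z * W.load n i l z) /
    (Real.sqrt (V.errVar n i z) * Real.sqrt (W.errVar n i z))

/-- The conditional error variance of the node depends only on what the expert says. -/
def Node.Heteroskedasticity (V : Node d q) : Expert d → Prop
  | .homoskedastic => ∃ s : ℝ, ∀ n i z, V.errVar n i z = s
  | .samplingIndex => ∃ s : (n : ℕ) → Fin n → ℝ, ∀ n i z, V.errVar n i z = s n i
  | .predictor m => ∃ s : ℝ → ℝ, ∀ n i z, V.errVar n i z = s (z m)

/-- The mean, over the samples `i`, of the distance between the conditional error variance of
sample `i` and its average over the smoothing window of `i`. -/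
def Node.smoothingBias (V : Node d q) (E : Expert d) (lam n : ℕ) (Z : Fin n → Fin d → ℝ) : ℝ :=
  (n : ℝ)⁻¹ * ∑ i, |(lam : ℝ)⁻¹ * ∑ j ∈ window E lam Z i, V.errVar n j (Z j)
    - V.errVar n i (Z i)|

variable {Ω : Type*} [MeasurableSpace Ω]

/-- The predictors `Z n` and the noise variables `N n` behind the `n`-th data set. The noise is
independent standard Gaussian and independent of the predictors. -/
structure Source (μ : Measure Ω) (d q : ℕ) where
  /-- the design matrix of the data set with `n` samples -/
  Z : (n : ℕ) → Ω → Fin n → Fin d → ℝ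
  /-- the noise variables of the data set with `n` samples -/
  N : (n : ℕ) → Ω → Fin n → Fin q → ℝ
  measurable_Z : ∀ n, Measurable (Z n)
  measurable_N : ∀ n, Measurable (N n)
  gaussian : ∀ n i l, μ.map (fun ω => N n ω i l) = gaussianReal 0 1
  indep_noise : ∀ n, iIndepFun (fun (p : Fin n × Fin q) ω => N n ω p.1 p.2) μ
  indep_design : ∀ n, IndepFun (Z n) (N n) μ

variable {μ : Measure Ω}

/-- The observations of the node `V` in the `n`-th data set. -/
def Source.obs (S : Source μ d q) (V : Node d q) (n : ℕ) (ω : Ω) : Fin n → ℝ :=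
  V.value n (S.Z n ω) (S.N n ω)

/-- The assumptions on the predictors alone. -/
structure DesignAssumptions (S : Source μ d q) : Prop where
  /-- square-integrability -/
  memLp : ∀ n i k, MemLp (fun ω => S.Z n ω i k) 2 μ
  /-- the predictors are centered -/
  centered : ∀ n i k, ∫ ω, S.Z n ω i k ∂μ = 0
  /-- each predictor has a diagonal covariance matrix -/
  uncorrelated : ∀ n k i j, i ≠ j → covariance (fun ω => S.Z n ω i k) (fun ω => S.Z n ω j k) μ = 0
  /-- the variances are bounded -/
  bounded : ∃ C : ℝ, ∀ n i k, variance (fun ω => S.Z n ω i k) μ ≤ C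
  /-- `Zᵀ Z` is almost surely positive definite (as soon as `n` is large enough) -/
  posDef : ∀ᶠ n in atTop, ∀ᵐ ω ∂μ, ((of (S.Z n ω))ᵀ * of (S.Z n ω)).PosDef
  /-- `Zᵀ Z / n` converges entrywise in probability -/
  limit : ∃ Q : Matrix (Fin d) (Fin d) ℝ, ∀ k l,
    TendstoInMeasure μ (fun (n : ℕ) ω => (n : ℝ)⁻¹ * ((of (S.Z n ω))ᵀ * of (S.Z n ω)) k l)
      atTop (fun _ => Q k l)

/-- The assumptions on the node `V`, with expert knowledge `E` and window lengths `lam`. -/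
structure NodeAssumptions (S : Source μ d q) (V : Node d q) (E : Expert d) (lam : ℕ → ℕ) :
    Prop where
  /-- the error variance depends on one known predictor or on the index, or is constant -/
  heteroskedasticity : V.Heteroskedasticity E
  /-- the conditional error variances are bounded away from zero -/
  nondegenerate : ∃ c : ℝ, 0 < c ∧ ∀ n i, ∀ᵐ ω ∂μ, c ≤ V.errVar n i (S.Z n ω i)
  /-- the conditional error variances are bounded -/
  bounded : ∃ C : ℝ, ∀ n i, ∀ᵐ ω ∂μ, V.errVar n i (S.Z n ω i) ≤ C
  /-- the average error variance converges in probability -/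
  avgVar : ∃ v : ℝ, TendstoInMeasure μ
    (fun (n : ℕ) ω => (n : ℝ)⁻¹ * ∑ i, V.errVar n i (S.Z n ω i)) atTop (fun _ => v)
  /-- the averages of `Z² σ²` converge in probability -/
  avgWeightedVar : ∀ k, ∃ v : ℝ, TendstoInMeasure μ
    (fun (n : ℕ) ω => (n : ℝ)⁻¹ * ∑ i, S.Z n ω i k ^ 2 * V.errVar n i (S.Z n ω i))
    atTop (fun _ => v)
  /-- averaging the variances over the smoothing windows asymptotically reproduces them -/
  smoothing : TendstoInMeasure μ
    (fun n ω => V.smoothingBias E (lam n) n (S.Z n ω)) atTop (fun _ => 0)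

/-- `ρ` is the partial correlation of `V` and `W` given the predictors: the large-sample mean of
the conditional correlations of the samples. If all samples have the same conditional
correlation, it is that number. -/
def IsPartialCorr (S : Source μ d q) (V W : Node d q) (ρ : ℝ) : Prop :=
  TendstoInMeasure μ (fun (n : ℕ) ω => (n : ℝ)⁻¹ * ∑ i, condCorr V W n i (S.Z n ω i))
    atTop (fun _ => ρ)

/-- The null hypothesis: in every sample, `V` and `W` are conditionally independent given the
predictors. -/
def CondIndepNodes [StandardBorelSpace Ω] [IsFiniteMeasure μ] (S : Source μ d q)
    (V W : Node d q) : Prop :=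
  ∀ (n : ℕ) (i : Fin n),
    CondIndepFun (MeasurableSpace.comap (fun ω => S.Z n ω i) inferInstance)
      (((measurable_pi_apply i).comp (S.measurable_Z n)).comap_le)
      (fun ω => S.obs V n ω i) (fun ω => S.obs W n ω i) μ

/-- The rejection probability of the test at level `a` with `n` samples. -/
def rejectProb (S : Source μ d q) (V W : Node d q) (EV EW : Expert d) (lam : ℕ → ℕ) (a : ℝ)
    (n : ℕ) : ℝ :=
  μ.real {ω | Rejects EV EW (lam n) a (S.Z n ω) (S.obs V n ω) (S.obs W n ω)}

end ParCorrWLS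

end

open MeasureTheory ProbabilityTheory Filter Matrix
open scoped Topology

noncomputable section

namespace ParCorrWLS

/-! ### Convergence in probability and slow growth -/

section Probability

variable {Ω : Type*} [MeasurableSpace Ω]

/-- The sequence tends to zero in probability. -/
def Negligible (μ : Measure Ω) (f : ℕ → Ω → ℝ) : Prop :=
  ∀ ε : ℝ, 0 < ε → Tendsto (fun n => μ {ω | ε ≤ |f n ω|}) atTop (𝓝 0)

/-- The family, uniformly in its index `i`, grows in probability slower than every positive
power of `n`. -/
def Slow (μ : Measure Ω) (f : (n : ℕ) → Ω → Fin n → ℝ) : Prop :=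
  ∀ κ : ℝ, 0 < κ → Tendsto (fun n : ℕ => μ {ω | ∃ i, (n : ℝ) ^ κ < |f n ω i|}) atTop (𝓝 0)

variable {μ : Measure Ω}

lemma tendsto_measure_zero_of_ae_imp {s t : ℕ → Set Ω}
    (ht : Tendsto (fun n => μ (t n)) atTop (𝓝 0))
    (h : ∀ᶠ n in atTop, ∀ᵐ ω ∂μ, ω ∈ s n → ω ∈ t n) :
    Tendsto (fun n => μ (s n)) atTop (𝓝 0) := by
  refine tendsto_of_tendsto_of_tendsto_of_le_of_le' tendsto_const_nhds ht
    (Eventually.of_forall fun _ => zero_le) ?_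
  filter_upwards [h] with n hn
  exact measure_mono_ae hn

lemma tendsto_measure_zero_of_ae_imp_or {s t u : ℕ → Set Ω}
    (ht : Tendsto (fun n => μ (t n)) atTop (𝓝 0))
    (hu : Tendsto (fun n => μ (u n)) atTop (𝓝 0))
    (h : ∀ᶠ n in atTop, ∀ᵐ ω ∂μ, ω ∈ s n → ω ∈ t n ∨ ω ∈ u n) :
    Tendsto (fun n => μ (s n)) atTop (𝓝 0) := by
  have h' : Tendsto (fun n => μ (t n ∪ u n)) atTop (𝓝 0) := by
    refine tendsto_of_tendsto_of_tendsto_of_le_of_le tendsto_const_nhds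
      (by simpa using ht.add hu) (fun _ => zero_le) (fun n => measure_union_le _ _)
  exact tendsto_measure_zero_of_ae_imp h' h

lemma negligible_iff_tendstoInMeasure {f : ℕ → Ω → ℝ} {c : ℝ} :
    Negligible μ (fun n ω => f n ω - c) ↔ TendstoInMeasure μ f atTop (fun _ => c) := by
  rw [tendstoInMeasure_iff_norm]
  rfl

lemma Negligible.of_abs_le {f g : ℕ → Ω → ℝ} (hg : Negligible μ g)
    (h : ∀ᶠ n in atTop, ∀ᵐ ω ∂μ, |f n ω| ≤ |g n ω|) : Negligible μ f := by
  intro ε hε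
  refine tendsto_measure_zero_of_ae_imp (hg ε hε) ?_
  filter_upwards [h] with n hn
  filter_upwards [hn] with ω hω h1
  exact le_trans h1 hω

lemma Negligible.add {f g : ℕ → Ω → ℝ} (hf : Negligible μ f) (hg : Negligible μ g) :
    Negligible μ (fun n ω => f n ω + g n ω) := by
  intro ε hε
  refine tendsto_measure_zero_of_ae_imp_or (hf (ε / 2) (by positivity))
    (hg (ε / 2) (by positivity)) (Eventually.of_forall fun n => ae_of_all _ fun ω h => ?_)
  simp only [Set.mem_ofPred_eq] at h ⊢
  by_contra! hc
  linarith [abs_add_le (f n ω) (g n ω)]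

lemma Negligible.of_tendsto [IsProbabilityMeasure μ] {c : ℕ → ℝ}
    (hc : Tendsto c atTop (𝓝 0)) : Negligible μ (fun n _ => c n) := by
  intro ε hε
  refine tendsto_const_nhds.congr' ?_
  have := hc.abs
  rw [abs_zero] at this
  filter_upwards [this.eventually_lt_const hε] with n hn
  simp [hn.not_ge]

lemma Negligible.comp₂ {F : ℝ → ℝ → ℝ} {a b : ℝ} (hF : ContinuousAt (Function.uncurry F) (a, b))
    {f g : ℕ → Ω → ℝ} (hf : Negligible μ (fun n ω => f n ω - a))
    (hg : Negligible μ (fun n ω => g n ω - b)) :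
    Negligible μ (fun n ω => F (f n ω) (g n ω) - F a b) := by
  intro ε hε
  obtain ⟨δ, hδ, h⟩ := Metric.continuousAt_iff.1 hF ε hε
  refine tendsto_measure_zero_of_ae_imp_or (hf δ hδ) (hg δ hδ)
    (Eventually.of_forall fun n => ae_of_all _ fun ω h1 => ?_)
  simp only [Set.mem_ofPred_eq] at h1 ⊢
  by_contra! hc
  have := h (x := (f n ω, g n ω)) (by
    rw [Prod.dist_eq]; exact max_lt hc.1 hc.2)
  exact absurd this (not_lt.2 h1)

lemma Negligible.comp {F : ℝ → ℝ} {a : ℝ} (hF : ContinuousAt F a)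
    {f : ℕ → Ω → ℝ} (hf : Negligible μ (fun n ω => f n ω - a)) :
    Negligible μ (fun n ω => F (f n ω) - F a) :=
  Negligible.comp₂ (F := fun x _ => F x) (b := a)
    (by
      have : Function.uncurry (fun x (_ : ℝ) => F x) = F ∘ Prod.fst := rfl
      rw [this]
      exact ContinuousAt.comp (x := (a, a)) (f := Prod.fst) hF continuousAt_fst) hf hf

lemma Negligible.const_mul {f : ℕ → Ω → ℝ} (hf : Negligible μ f) (c : ℝ) :
    Negligible μ (fun n ω => c * f n ω) := by
  have := Negligible.comp (F := fun x => c * x) (a := 0) (μ := μ) (f := f)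
    (by fun_prop) (by simpa using hf)
  simpa using this

lemma Negligible.sqrt {f : ℕ → Ω → ℝ} (hf : Negligible μ f) :
    Negligible μ (fun n ω => √(f n ω)) := by
  have := Negligible.comp (F := fun x => √x) (a := 0) (μ := μ) (f := f)
    (by fun_prop) (by simpa using hf)
  simpa using this

/-! ### Slowly growing families -/

lemma Slow.of_exists_le {f g : (n : ℕ) → Ω → Fin n → ℝ} (hf : Slow μ f)
    (h : ∀ᶠ n in atTop, ∀ᵐ ω ∂μ, ∀ i, ∃ j, |g n ω i| ≤ |f n ω j|) : Slow μ g := by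
  intro κ hκ
  refine tendsto_measure_zero_of_ae_imp (hf κ hκ) ?_
  filter_upwards [h] with n hn
  filter_upwards [hn] with ω hω
  rintro ⟨i, hi⟩
  obtain ⟨j, hj⟩ := hω i
  exact ⟨j, hi.trans_le hj⟩

lemma Slow.of_abs_le {f g : (n : ℕ) → Ω → Fin n → ℝ} (hf : Slow μ f)
    (h : ∀ᶠ n in atTop, ∀ᵐ ω ∂μ, ∀ i, |g n ω i| ≤ |f n ω i|) : Slow μ g := by
  refine hf.of_exists_le ?_
  filter_upwards [h] with n hn
  filter_upwards [hn] with ω hω i using ⟨i, hω i⟩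

lemma Slow.mul {f g : (n : ℕ) → Ω → Fin n → ℝ} (hf : Slow μ f) (hg : Slow μ g) :
    Slow μ (fun n ω i => f n ω i * g n ω i) := by
  intro κ hκ
  refine tendsto_measure_zero_of_ae_imp_or (hf (κ / 2) (by positivity))
    (hg (κ / 2) (by positivity)) ?_
  filter_upwards [eventually_gt_atTop 0] with n hn
  refine ae_of_all _ ?_
  rintro ω ⟨i, hi⟩
  by_contra! hc
  have hn' : (0 : ℝ) < n := by exact_mod_cast hn
  have : (n : ℝ) ^ κ = (n : ℝ) ^ (κ / 2) * (n : ℝ) ^ (κ / 2) := by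
    rw [← Real.rpow_add hn']; ring_nf
  rw [abs_mul, this] at hi
  exact absurd hi (not_lt.2 (mul_le_mul (hc.1 i) (hc.2 i) (abs_nonneg _) (by positivity)))

lemma tendsto_natCast_rpow_atTop {κ : ℝ} (hκ : 0 < κ) :
    Tendsto (fun n : ℕ => (n : ℝ) ^ κ) atTop atTop :=
  (tendsto_rpow_atTop hκ).comp tendsto_natCast_atTop_atTop

lemma Slow.const (c : ℝ) : Slow μ (fun _ _ _ => c) := by
  intro κ hκ
  refine tendsto_const_nhds.congr' ?_
  filter_upwards [(tendsto_natCast_rpow_atTop hκ).eventually_ge_atTop |c|] with n hn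
  simp [hn.not_gt]

lemma Slow.add {f g : (n : ℕ) → Ω → Fin n → ℝ} (hf : Slow μ f) (hg : Slow μ g) :
    Slow μ (fun n ω i => f n ω i + g n ω i) := by
  intro κ hκ
  refine tendsto_measure_zero_of_ae_imp_or (hf (κ / 2) (by positivity))
    (hg (κ / 2) (by positivity)) ?_
  filter_upwards [eventually_gt_atTop 0,
    (tendsto_natCast_rpow_atTop (half_pos hκ)).eventually_ge_atTop 2] with n hn h2
  refine ae_of_all _ ?_
  rintro ω ⟨i, hi⟩
  by_contra! hc
  have hn' : (0 : ℝ) < n := by exact_mod_cast hn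
  have : (n : ℝ) ^ κ = (n : ℝ) ^ (κ / 2) * (n : ℝ) ^ (κ / 2) := by
    rw [← Real.rpow_add hn']; ring_nf
  nlinarith [abs_add_le (f n ω i) (g n ω i), hc.1 i, hc.2 i]

lemma Slow.const_mul {f : (n : ℕ) → Ω → Fin n → ℝ} (hf : Slow μ f) (c : ℝ) :
    Slow μ (fun n ω i => c * f n ω i) :=
  (Slow.const c).mul hf

lemma Slow.negligible {f : ℕ → Ω → ℝ} (hf : Slow μ fun n ω _ => f n ω) {κ : ℝ} (hκ : 0 < κ) :
    Negligible μ (fun n ω => ((n : ℝ) ^ κ)⁻¹ * f n ω) := by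
  intro ε hε
  refine tendsto_measure_zero_of_ae_imp (hf (κ / 2) (by positivity)) ?_
  filter_upwards [eventually_gt_atTop 0,
    (tendsto_natCast_rpow_atTop (half_pos hκ)).eventually_gt_atTop ε⁻¹] with n hn h2
  refine ae_of_all _ fun ω h => ⟨⟨0, hn⟩, ?_⟩
  have hn' : (0 : ℝ) < n := by exact_mod_cast hn
  have h3 : (n : ℝ) ^ κ = (n : ℝ) ^ (κ / 2) * (n : ℝ) ^ (κ / 2) := by
    rw [← Real.rpow_add hn']; ring_nf
  have hp : 0 < (n : ℝ) ^ (κ / 2) := by positivity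
  rw [abs_mul, h3, abs_of_pos (by positivity), inv_mul_eq_div, le_div_iff₀ (by positivity)] at h
  refine lt_of_lt_of_le ?_ h
  rw [inv_lt_iff_one_lt_mul₀ hε] at h2
  nlinarith

lemma Slow.of_moments {f : (n : ℕ) → Ω → Fin n → ℝ}
    (hf : ∀ᶠ n in atTop, ∀ i, AEMeasurable (fun ω => f n ω i) μ)
    (h : ∀ p : ℕ, ∃ K : ℝ, ∀ᶠ n in atTop, ∀ i,
      ∫⁻ ω, ENNReal.ofReal (|f n ω i| ^ p) ∂μ ≤ ENNReal.ofReal K) : Slow μ f := by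
  intro κ hκ
  obtain ⟨p, hp⟩ := exists_nat_gt (2 / κ)
  obtain ⟨K, hK⟩ := h p
  have hp' : 2 < κ * p := by rwa [div_lt_iff₀' hκ] at hp
  have hlim : Tendsto (fun n : ℕ => ENNReal.ofReal (K * ((n : ℝ))⁻¹)) atTop (𝓝 0) := by
    have : Tendsto (fun n : ℕ => K * ((n : ℝ))⁻¹) atTop (𝓝 (K * 0)) :=
      tendsto_const_nhds.mul tendsto_inv_atTop_nhds_zero_nat
    simpa using (ENNReal.tendsto_ofReal this)
  refine tendsto_of_tendsto_of_tendsto_of_le_of_le' tendsto_const_nhds hlim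
    (Eventually.of_forall fun _ => zero_le) ?_
  filter_upwards [hK, hf, eventually_gt_atTop 0] with n hKn hfn hn
  have hn' : (0 : ℝ) < n := by exact_mod_cast hn
  have hn1 : (1 : ℝ) ≤ n := by exact_mod_cast hn
  have hK0 : ENNReal.ofReal K = ENNReal.ofReal (max K 0) := by
    rw [ENNReal.ofReal_max]; simp
  have key : ∀ i, μ {ω | (n : ℝ) ^ κ < |f n ω i|} ≤
      ENNReal.ofReal ((max K 0) * ((n : ℝ) ^ 2)⁻¹) := by
    intro i
    have h1 : μ {ω | (n : ℝ) ^ κ < |f n ω i|} ≤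
        μ {ω | ENNReal.ofReal ((n : ℝ) ^ 2) ≤ ENNReal.ofReal (|f n ω i| ^ p)} := by
      refine measure_mono fun ω hω => ENNReal.ofReal_le_ofReal ?_
      calc (n : ℝ) ^ 2 = (n : ℝ) ^ (2 : ℝ) := by norm_cast
        _ ≤ (n : ℝ) ^ (κ * p) := Real.rpow_le_rpow_of_exponent_le hn1 hp'.le
        _ = ((n : ℝ) ^ κ) ^ p := by rw [Real.rpow_mul hn'.le, Real.rpow_natCast]
        _ ≤ _ := pow_le_pow_left₀ (by positivity) (le_of_lt hω) p
    refine h1.trans ((meas_ge_le_lintegral_div ?_ ?_ ENNReal.ofReal_ne_top).trans ?_)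
    · exact ((hfn i).abs.pow_const p).ennreal_ofReal
    · simp; positivity
    · rw [ENNReal.ofReal_mul (by positivity), ENNReal.ofReal_inv_of_pos (by positivity),
        ← div_eq_mul_inv, ← hK0]
      exact ENNReal.div_le_div_right (hKn i) _
  have hun : {ω | ∃ i, (n : ℝ) ^ κ < |f n ω i|} = ⋃ i, {ω | (n : ℝ) ^ κ < |f n ω i|} := by
    ext; simp
  rw [hun]
  refine (measure_iUnion_fintype_le _ _).trans ((Finset.sum_le_sum fun i _ => key i).trans ?_)
  rw [Finset.sum_const, Finset.card_univ, Fintype.card_fin, nsmul_eq_mul,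
    ENNReal.ofReal_mul' (by positivity), ← hK0, ENNReal.ofReal_mul' (by positivity), mul_left_comm]
  gcongr
  rw [← ENNReal.ofReal_natCast, ← ENNReal.ofReal_mul (by positivity)]
  refine ENNReal.ofReal_le_ofReal (le_of_eq ?_)
  field_simp

lemma Slow.of_lintegral_le {f : ℕ → Ω → ℝ} (hf : ∀ᶠ n in atTop, AEMeasurable (f n) μ) {K : ℝ}
    (h : ∀ᶠ n in atTop, ∫⁻ ω, ENNReal.ofReal |f n ω| ∂μ ≤ ENNReal.ofReal K) :
    Slow μ (fun n ω _ => f n ω) := by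
  intro κ hκ
  have hlim : Tendsto (fun n : ℕ => ENNReal.ofReal K / ENNReal.ofReal ((n : ℝ) ^ κ))
      atTop (𝓝 0) := by
    have h1 : Tendsto (fun n : ℕ => ENNReal.ofReal ((n : ℝ) ^ κ)) atTop (𝓝 ⊤) :=
      ENNReal.tendsto_ofReal_atTop.comp (tendsto_natCast_rpow_atTop hκ)
    have := ENNReal.Tendsto.const_div h1 (Or.inr (ENNReal.ofReal_ne_top (r := K)))
    simpa using this
  refine tendsto_of_tendsto_of_tendsto_of_le_of_le' tendsto_const_nhds hlim
    (Eventually.of_forall fun _ => zero_le) ?_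
  filter_upwards [h, hf, eventually_gt_atTop 0] with n hKn hfn hn
  have hn' : (0 : ℝ) < n := by exact_mod_cast hn
  have h1 : μ {ω | ∃ _ : Fin n, (n : ℝ) ^ κ < |f n ω|} ≤
        μ {ω | ENNReal.ofReal ((n : ℝ) ^ κ) ≤ ENNReal.ofReal |f n ω|} := by
    refine measure_mono fun ω => ?_
    rintro ⟨_, hω⟩
    exact ENNReal.ofReal_le_ofReal hω.le
  refine h1.trans ((meas_ge_le_lintegral_div ?_ ?_ ENNReal.ofReal_ne_top).trans ?_)
  · exact hfn.abs.ennreal_ofReal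
  · simp; positivity
  · exact ENNReal.div_le_div_right hKn _

/-! ### Conditioning on one of two independent random elements -/

/-- `η` is independent of `ζ` and has the law `ν`. -/
structure HasProdLaw {A B : Type*} [MeasurableSpace A] [MeasurableSpace B] (ζ : Ω → A) (η : Ω → B)
    (ν : Measure B) (μ : Measure Ω) : Prop where
  measurable_fst : Measurable ζ
  measurable_snd : Measurable η
  map_eq : μ.map (fun ω => (ζ ω, η ω)) = (μ.map ζ).prod ν

section ProdLaw

variable {A B : Type*} [MeasurableSpace A] [MeasurableSpace B] {ζ : Ω → A} {η : Ω → B}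
  {ν : Measure B} [IsProbabilityMeasure ν]

lemma HasProdLaw.lintegral_eq (h : HasProdLaw ζ η ν μ) {F : A × B → ENNReal} (hF : Measurable F) :
    ∫⁻ ω, F (ζ ω, η ω) ∂μ = ∫⁻ ω, ∫⁻ y, F (ζ ω, y) ∂ν ∂μ := by
  have := h.measurable_fst
  have := h.measurable_snd
  rw [← lintegral_map (f := F) (g := fun ω => (ζ ω, η ω)) hF (by fun_prop), h.map_eq,
    lintegral_prod _ hF.aemeasurable,
    lintegral_map hF.lintegral_prod_right' h.measurable_fst]

lemma HasProdLaw.lintegral_le [IsProbabilityMeasure μ] (h : HasProdLaw ζ η ν μ)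
    {F : A × B → ENNReal} (hF : Measurable F)
    {K : ENNReal} (hK : ∀ᵐ ω ∂μ, ∫⁻ y, F (ζ ω, y) ∂ν ≤ K) : ∫⁻ ω, F (ζ ω, η ω) ∂μ ≤ K := by
  rw [h.lintegral_eq hF]
  exact (lintegral_mono_ae hK).trans (by simp)

lemma HasProdLaw.measure_ge_le [IsProbabilityMeasure μ] (h : HasProdLaw ζ η ν μ)
    {F : A × B → ℝ} (hF : Measurable F)
    {b : A → ℝ} (hb : Measurable b)
    (hK : ∀ᵐ ω ∂μ, ∫⁻ y, ENNReal.ofReal (F (ζ ω, y)) ∂ν ≤ ENNReal.ofReal (b (ζ ω)))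
    {s t : ℝ} (ht : 0 < t) :
    μ {ω | t ≤ F (ζ ω, η ω)} ≤ μ {ω | s ≤ b (ζ ω)} + ENNReal.ofReal s / ENNReal.ofReal t := by
  set G : A × B → ENNReal := fun p =>
    {a | b a < s}.indicator (fun _ => (1 : ENNReal)) p.1 * ENNReal.ofReal (F p) with hG
  have hms : MeasurableSet {a | b a < s} := hb measurableSet_Iio
  have hGm : Measurable G :=
    (((measurable_const.indicator hms).comp _root_.measurable_fst)).mul hF.ennreal_ofReal
  have h1 : ∫⁻ ω, G (ζ ω, η ω) ∂μ ≤ ENNReal.ofReal s := by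
    refine h.lintegral_le hGm ?_
    filter_upwards [hK] with ω hω
    by_cases hs : b (ζ ω) < s
    · simp only [hG, Set.indicator, Set.mem_ofPred_eq, hs, if_true, one_mul]
      exact hω.trans (ENNReal.ofReal_le_ofReal hs.le)
    · simp [hG, hs]
  have h2 : μ {ω | ENNReal.ofReal t ≤ G (ζ ω, η ω)} ≤ ENNReal.ofReal s / ENNReal.ofReal t := by
    refine (meas_ge_le_lintegral_div ?_ ?_ ENNReal.ofReal_ne_top).trans
      (ENNReal.div_le_div_right h1 _)
    · exact (hGm.comp (h.measurable_fst.prodMk h.measurable_snd)).aemeasurable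
    · simpa using ht
  refine le_trans (measure_mono ?_) ((measure_union_le _ _).trans (add_le_add le_rfl h2))
  intro ω hω
  by_cases hs : b (ζ ω) < s
  · right
    simp only [hG, Set.mem_ofPred_eq, Set.indicator, hs, if_true, one_mul]
    exact ENNReal.ofReal_le_ofReal hω
  · left
    simpa using hs

end ProdLaw

lemma negligible_of_condLIntegral_le [IsProbabilityMeasure μ] {A B : ℕ → Type*}
    [∀ n, MeasurableSpace (A n)] [∀ n, MeasurableSpace (B n)] {ζ : ∀ n, Ω → A n}
    {η : ∀ n, Ω → B n} {ν : ∀ n, Measure (B n)} [∀ n, IsProbabilityMeasure (ν n)]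
    (h : ∀ᶠ n in atTop, HasProdLaw (ζ n) (η n) (ν n) μ)
    {F : ∀ n, A n × B n → ℝ} (hF : ∀ᶠ n in atTop, Measurable (F n)) (hF0 : ∀ n p, 0 ≤ F n p)
    {b : ∀ n, A n → ℝ} (hb : ∀ᶠ n in atTop, Measurable (b n))
    (hK : ∀ᶠ n in atTop, ∀ᵐ ω ∂μ, ∫⁻ y, ENNReal.ofReal (F n (ζ n ω, y)) ∂ν n ≤
      ENNReal.ofReal (b n (ζ n ω)))
    (hlim : Negligible μ fun n ω => b n (ζ n ω)) :
    Negligible μ fun n ω => F n (ζ n ω, η n ω) := by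
  intro t ht
  rw [ENNReal.tendsto_nhds_zero]
  intro ε hε
  rcases eq_or_ne ε ⊤ with rfl | hεt
  · simp
  set e : ℝ := ε.toReal / 2 with he
  have he0 : 0 < e := by have := ENNReal.toReal_pos hε.ne' hεt; positivity
  have h1 := (ENNReal.tendsto_nhds_zero.1 (hlim (e * t) (by positivity))) (ENNReal.ofReal e)
    (by simpa using he0)
  filter_upwards [h, hF, hb, hK, h1] with n h hF hb hK h1
  have h2 := h.measure_ge_le hF hb hK (s := e * t) ht
  have h3 : μ {ω | e * t ≤ b n (ζ n ω)} ≤ ENNReal.ofReal e :=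
    (measure_mono fun ω (hω : e * t ≤ b n (ζ n ω)) => le_trans hω (le_abs_self _)).trans h1
  have h4 : {ω | t ≤ |F n (ζ n ω, η n ω)|} = {ω | t ≤ F n (ζ n ω, η n ω)} := by
    ext ω; simp [abs_of_nonneg (hF0 n _)]
  rw [h4]
  refine h2.trans ((add_le_add h3 le_rfl).trans (le_of_eq ?_))
  rw [← ENNReal.ofReal_div_of_pos ht, mul_div_assoc, div_self ht.ne', mul_one,
    ← ENNReal.ofReal_add he0.le he0.le, he, add_halves, ENNReal.ofReal_toReal hεt]

end Probability

/-! ### Student's t-distribution approaches the normal distribution -/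

section StudentT

lemma Gamma_add_half_le {u : ℝ} (hu : 0 < u) :
    Real.Gamma (u + 1 / 2) ≤ √u * Real.Gamma u := by
  have h := Real.Gamma_mul_add_mul_le_rpow_Gamma_mul_rpow_Gamma hu (t := u + 1) (by positivity)
    (a := 1 / 2) (b := 1 / 2) (by norm_num) (by norm_num) (by norm_num)
  have hG := Real.Gamma_pos_of_pos hu
  rw [Real.Gamma_add_one hu.ne', ← Real.sqrt_eq_rpow, ← Real.sqrt_eq_rpow,
    Real.sqrt_mul hu.le] at h
  calc Real.Gamma (u + 1 / 2) = Real.Gamma (1 / 2 * u + 1 / 2 * (u + 1)) := by ring_nf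
    _ ≤ √(Real.Gamma u) * (√u * √(Real.Gamma u)) := h
    _ = √u * (√(Real.Gamma u) * √(Real.Gamma u)) := by ring
    _ = _ := by rw [Real.mul_self_sqrt hG.le]

lemma le_Gamma_add_half {u : ℝ} (hu : 0 < u) :
    u / √(u + 1 / 2) * Real.Gamma u ≤ Real.Gamma (u + 1 / 2) := by
  have h := Gamma_add_half_le (u := u + 1 / 2) (by positivity)
  rw [show u + 1 / 2 + 1 / 2 = u + 1 by ring, Real.Gamma_add_one hu.ne'] at h
  rw [div_mul_eq_mul_div, div_le_iff₀ (by positivity)]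
  linarith

lemma tendsto_Gamma_add_half_div :
    Tendsto (fun u : ℝ => Real.Gamma (u + 1 / 2) / (√u * Real.Gamma u)) atTop (𝓝 1) := by
  have hl : Tendsto (fun u : ℝ => √(u / (u + 1 / 2))) atTop (𝓝 1) := by
    have h1 : Tendsto (fun u : ℝ => 1 - (1 / 2) * (u + 1 / 2)⁻¹) atTop (𝓝 (1 - (1 / 2) * 0)) :=
      tendsto_const_nhds.sub (tendsto_const_nhds.mul
        (tendsto_inv_atTop_zero.comp (tendsto_atTop_add_const_right _ _ tendsto_id)))
    have h2 := (Real.continuous_sqrt.tendsto _).comp h1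
    simp only [mul_zero, sub_zero, Real.sqrt_one] at h2
    refine h2.congr' ?_
    filter_upwards [eventually_gt_atTop 0] with u hu
    simp only [Function.comp]
    congr 1
    field_simp
    ring
  refine tendsto_of_tendsto_of_tendsto_of_le_of_le' hl tendsto_const_nhds ?_ ?_
  · filter_upwards [eventually_gt_atTop 0] with u hu
    have hG := Real.Gamma_pos_of_pos hu
    rw [le_div_iff₀ (by positivity), Real.sqrt_div hu.le]
    refine le_trans (le_of_eq ?_) (le_Gamma_add_half hu)
    rw [← mul_assoc, div_mul_eq_mul_div, Real.mul_self_sqrt hu.le]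
  · filter_upwards [eventually_gt_atTop 0] with u hu
    have hG := Real.Gamma_pos_of_pos hu
    rw [div_le_one (by positivity)]
    exact Gamma_add_half_le hu

lemma studentT_const_eq {ν : ℝ} (hν : 0 < ν) :
    Real.Gamma ((ν + 1) / 2) / (√(ν * Real.pi) * Real.Gamma (ν / 2)) =
      (√(2 * Real.pi))⁻¹ *
        (Real.Gamma (ν / 2 + 1 / 2) / (√(ν / 2) * Real.Gamma (ν / 2))) := by
  have : √(ν * Real.pi) = √(2 * Real.pi) * √(ν / 2) := by
    rw [← Real.sqrt_mul (by positivity)]; congr 1; ring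
  rw [this, show (ν + 1) / 2 = ν / 2 + 1 / 2 by ring]
  have hG := Real.Gamma_pos_of_pos (half_pos hν)
  have := Real.pi_pos
  field_simp

lemma studentT_const_le_one {ν : ℝ} (hν : 0 < ν) :
    Real.Gamma ((ν + 1) / 2) / (√(ν * Real.pi) * Real.Gamma (ν / 2)) ≤ 1 := by
  have hG := Real.Gamma_pos_of_pos (half_pos hν)
  rw [studentT_const_eq hν]
  have h1 : (√(2 * Real.pi))⁻¹ ≤ 1 := by
    refine inv_le_one_of_one_le₀ ?_
    rw [Real.one_le_sqrt]
    linarith [Real.pi_gt_three]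
  have h2 : Real.Gamma (ν / 2 + 1 / 2) / (√(ν / 2) * Real.Gamma (ν / 2)) ≤ 1 := by
    rw [div_le_one (by positivity)]
    exact Gamma_add_half_le (half_pos hν)
  have h3 : 0 < Real.Gamma (ν / 2 + 1 / 2) := Real.Gamma_pos_of_pos (by positivity)
  exact mul_le_one₀ h1 (by positivity) h2

lemma tendsto_studentT_density (x : ℝ) :
    Tendsto (fun ν : ℝ => Real.Gamma ((ν + 1) / 2) / (√(ν * Real.pi) * Real.Gamma (ν / 2)) *
      (1 + x ^ 2 / ν) ^ (-((ν + 1) / 2))) atTop (𝓝 (gaussianPDFReal 0 1 x)) := by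
  have h1 : Tendsto (fun ν : ℝ => Real.Gamma ((ν + 1) / 2) / (√(ν * Real.pi) * Real.Gamma (ν / 2)))
      atTop (𝓝 ((√(2 * Real.pi))⁻¹ * 1)) := by
    refine (tendsto_const_nhds.mul (tendsto_Gamma_add_half_div.comp
      (tendsto_id.atTop_div_const (show (0 : ℝ) < 2 by norm_num)))).congr' ?_
    filter_upwards [eventually_gt_atTop 0] with ν hν
    exact (studentT_const_eq hν).symm
  have h2 : Tendsto (fun ν : ℝ => (1 + x ^ 2 / ν)) atTop (𝓝 (1 + 0)) :=
    tendsto_const_nhds.add (tendsto_const_nhds.div_atTop tendsto_id)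
  have h3 : Tendsto (fun ν : ℝ => ((1 + x ^ 2 / ν) ^ ν) ^ (-(1 / 2) : ℝ)) atTop
      (𝓝 ((Real.exp (x ^ 2)) ^ (-(1 / 2) : ℝ))) :=
    (Real.continuousAt_rpow_const _ _ (Or.inl (Real.exp_pos _).ne')).tendsto.comp
      (Real.tendsto_one_add_div_rpow_exp (x ^ 2))
  have h4 : Tendsto (fun ν : ℝ => (1 + x ^ 2 / ν) ^ (-(1 / 2) : ℝ)) atTop
      (𝓝 ((1 + 0) ^ (-(1 / 2) : ℝ))) :=
    (Real.continuousAt_rpow_const _ _ (Or.inl (by norm_num))).tendsto.comp h2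
  have h5 := h1.mul (h3.mul h4)
  have h6 : gaussianPDFReal 0 1 x =
      (√(2 * Real.pi))⁻¹ * 1 * (Real.exp (x ^ 2) ^ (-(1 / 2) : ℝ) * (1 + 0) ^ (-(1 / 2) : ℝ)) := by
    rw [gaussianPDFReal, ← Real.exp_mul]
    simp only [NNReal.coe_one, mul_one, sub_zero, add_zero, Real.one_rpow]
    congr 2; ring
  rw [h6]
  refine h5.congr' ?_
  filter_upwards [eventually_gt_atTop 0] with ν hν
  have hp : (0 : ℝ) < 1 + x ^ 2 / ν := by positivity
  congr 1
  rw [← Real.rpow_mul hp.le, ← Real.rpow_add hp]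
  congr 1; ring

lemma studentT_density_le {ν : ℝ} (hν : 1 ≤ ν) (x : ℝ) :
    Real.Gamma ((ν + 1) / 2) / (√(ν * Real.pi) * Real.Gamma (ν / 2)) *
      (1 + x ^ 2 / ν) ^ (-((ν + 1) / 2)) ≤ 2 * (1 + x ^ 2)⁻¹ := by
  have hν0 : 0 < ν := by linarith
  have hb : 1 + x ^ 2 / 2 ≤ (1 + x ^ 2 / ν) ^ ((ν + 1) / 2) := by
    have h := one_add_mul_self_le_rpow_one_add (s := x ^ 2 / ν) (p := (ν + 1) / 2)
      (by have : 0 ≤ x ^ 2 / ν := by positivity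
          linarith) (by linarith)
    refine le_trans ?_ h
    have : (ν + 1) / 2 * (x ^ 2 / ν) = x ^ 2 / 2 + x ^ 2 / (2 * ν) := by field_simp
    rw [this]
    have : 0 ≤ x ^ 2 / (2 * ν) := by positivity
    linarith
  have hG := Real.Gamma_pos_of_pos (half_pos hν0)
  have h1 : (1 + x ^ 2 / ν) ^ (-((ν + 1) / 2)) ≤ 2 * (1 + x ^ 2)⁻¹ := by
    rw [Real.rpow_neg (by positivity)]
    refine (inv_anti₀ (by positivity) hb).trans ?_
    rw [← div_eq_mul_inv, inv_le_comm₀ (by positivity) (by positivity), inv_div]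
    linarith
  calc _ ≤ 1 * (1 + x ^ 2 / ν) ^ (-((ν + 1) / 2)) :=
        mul_le_mul_of_nonneg_right (studentT_const_le_one hν0) (by positivity)
    _ ≤ _ := by rwa [one_mul]

lemma tendsto_studentT_Iic (x : ℝ) :
    Tendsto (fun ν : ℝ => studentT ν (Set.Iic x)) atTop (𝓝 (gaussianReal 0 1 (Set.Iic x))) := by
  rw [gaussianReal_apply _ (by norm_num)]
  have h0 : ∀ ν, studentT ν (Set.Iic x) = ∫⁻ x in Set.Iic x, ENNReal.ofReal
    (Real.Gamma ((ν + 1) / 2) / (√(ν * Real.pi) * Real.Gamma (ν / 2)) *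
      (1 + x ^ 2 / ν) ^ (-((ν + 1) / 2))) := fun ν => withDensity_apply _ measurableSet_Iic
  simp_rw [h0]
  refine tendsto_lintegral_filter_of_dominated_convergence
    (fun x => ENNReal.ofReal (2 * (1 + x ^ 2)⁻¹)) ?_ ?_ ?_ ?_
  · refine Eventually.of_forall fun ν => ?_
    fun_prop
  · filter_upwards [eventually_ge_atTop 1] with ν hν
    exact ae_of_all _ fun x => ENNReal.ofReal_le_ofReal (studentT_density_le hν x)
  · have := (integrable_inv_one_add_sq.const_mul 2).integrableOn (s := Set.Iic x)
    exact this.lintegral_lt_top.ne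
  · exact ae_of_all _ fun x => ENNReal.tendsto_ofReal (tendsto_studentT_density x)

lemma exists_lt_gaussianReal_Iic {p : ENNReal} (hp : p < 1) :
    ∃ x, p < gaussianReal 0 1 (Set.Iic x) := by
  have h := tendsto_measure_Iic_atTop (gaussianReal 0 1)
  rw [measure_univ] at h
  exact (h.eventually_const_lt hp).exists

lemma exists_gaussianReal_Iic_lt {p : ENNReal} (hp : 0 < p) :
    ∃ x, gaussianReal 0 1 (Set.Iic x) < p := by
  have h := ENNReal.tendsto_ofReal (tendsto_cdf_atBot (gaussianReal 0 1))
  simp only [ofReal_cdf, ENNReal.ofReal_zero] at h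
  exact (h.eventually_lt_const hp).exists

lemma eventually_le_tQuantile {p x : ℝ} (hp : p < 1)
    (hx : gaussianReal 0 1 (Set.Iic x) < ENNReal.ofReal p) :
    ∀ᶠ ν in atTop, x ≤ tQuantile p ν := by
  obtain ⟨M, hM⟩ := exists_lt_gaussianReal_Iic (p := ENNReal.ofReal p) (by simpa using hp)
  filter_upwards [(tendsto_studentT_Iic x).eventually_lt_const hx,
    (tendsto_studentT_Iic M).eventually_const_lt hM] with ν h1 h2
  refine le_csInf ⟨M, h2.le⟩ fun y hy => ?_
  by_contra! hlt
  exact absurd (le_trans hy (measure_mono (Set.Iic_subset_Iic.2 hlt.le))) (not_le.2 h1)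

lemma eventually_tQuantile_le {p : ℝ} (hp0 : 0 < p) (hp : p < 1) :
    ∃ M, ∀ᶠ ν in atTop, tQuantile p ν ≤ M := by
  obtain ⟨M, hM⟩ := exists_lt_gaussianReal_Iic (p := ENNReal.ofReal p) (by simpa using hp)
  obtain ⟨x, hx⟩ := exists_gaussianReal_Iic_lt (p := ENNReal.ofReal p) (by simpa using hp0)
  refine ⟨M, ?_⟩
  filter_upwards [(tendsto_studentT_Iic x).eventually_lt_const hx,
    (tendsto_studentT_Iic M).eventually_const_lt hM] with ν h1 h2
  refine csInf_le ⟨x, fun y hy => ?_⟩ h2.le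
  by_contra! hlt
  exact absurd (le_trans hy (measure_mono (Set.Iic_subset_Iic.2 hlt.le))) (not_le.2 h1)

lemma tendsto_degreesOfFreedom (d : ℕ) :
    Tendsto (fun n : ℕ => (n : ℝ) - 2 - d) atTop atTop := by
  simpa [sub_eq_add_neg] using tendsto_atTop_add_const_right _ _
    (tendsto_atTop_add_const_right _ _ (tendsto_natCast_atTop_atTop (R := ℝ)))

lemma continuous_cdf_gaussianReal : Continuous (cdf (gaussianReal 0 1)) := by
  have := nullSingletonClass_gaussianReal (μ := 0) (v := 1) one_ne_zero
  have h : ∀ x, cdf (gaussianReal 0 1) x = ∫ _ in Set.Iic x, (1 : ℝ) ∂gaussianReal 0 1 := by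
    intro x; simp [cdf_eq_real]
  rw [continuous_iff_continuousAt]
  intro x
  have h2 := (integrable_const (μ := gaussianReal 0 1) (1 : ℝ)).integrableOn
    (s := Set.Iic (x + 1)) |>.continuousOn_Iic_primitive_Iic
  simp_rw [← h] at h2
  exact h2.continuousAt (Iic_mem_nhds (by linarith))

lemma gaussianReal_Ioi_neg (x : ℝ) :
    gaussianReal 0 1 (Set.Iio (-x)) = gaussianReal 0 1 (Set.Ioi x) := by
  conv_lhs => rw [← neg_zero, ← gaussianReal_map_neg]
  rw [Measure.map_apply measurable_neg measurableSet_Iio]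
  congr 1
  ext y; simp

/-- There are thresholds `x₁ < x₂`, the second below the `(1 - a/2)`-quantile of the standard normal
distribution, that a standard normal variable exceeds in absolute value with probability `≤ a'`. -/
lemma exists_normal_thresholds {a a' : ℝ} (ha0 : 0 < a) (ha : a < a') (ha1 : a < 1) :
    ∃ x₁ x₂ : ℝ, 0 < x₁ ∧ x₁ < x₂ ∧ gaussianReal 0 1 (Set.Iic x₂) < ENNReal.ofReal (1 - a / 2) ∧
      gaussianReal 0 1 {y | x₁ < |y|} ≤ ENNReal.ofReal a' := by
  set γ := gaussianReal 0 1 with hγ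
  have := nullSingletonClass_gaussianReal (μ := 0) (v := 1) one_ne_zero
  obtain ⟨b, hab, hb'⟩ := exists_between (lt_min ha ha1)
  obtain ⟨hba, hb1⟩ := lt_min_iff.1 hb'
  have hival : ∀ p, 0 < p → p < 1 → ∃ x, cdf γ x = p := by
    intro p hp0 hp1
    obtain ⟨x, hx⟩ := ((tendsto_cdf_atBot γ).eventually_lt_const hp0).exists
    obtain ⟨y, hy⟩ := ((tendsto_cdf_atTop γ).eventually_const_lt hp1).exists
    obtain ⟨z, -, hz⟩ := intermediate_value_uIcc (a := x) (b := y)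
      continuous_cdf_gaussianReal.continuousOn (Set.Icc_subset_uIcc ⟨hx.le, hy.le⟩)
    exact ⟨z, hz⟩
  obtain ⟨x₁, hx₁⟩ := hival (1 - b / 2) (by linarith) (by linarith)
  obtain ⟨x₂, hx₂⟩ := hival (1 - (a + b) / 4) (by linarith) (by linarith)
  have hIic : ∀ x, γ (Set.Iic x) = ENNReal.ofReal (cdf γ x) := fun x => (ofReal_cdf γ x).symm
  have hIoi : ∀ x, γ (Set.Ioi x) = ENNReal.ofReal (1 - cdf γ x) := by
    intro x
    rw [← Set.compl_Iic, prob_compl_eq_one_sub measurableSet_Iic, hIic,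
      ENNReal.ofReal_sub _ (cdf_nonneg _ _), ENNReal.ofReal_one]
  refine ⟨x₁, x₂, ?_, ?_, ?_, ?_⟩
  · by_contra! hneg
    have h1 : γ (Set.Ioi (-x₁)) ≤ γ (Set.Ioi x₁) :=
      measure_mono (Set.Ioi_subset_Ioi (by linarith))
    rw [hγ, ← gaussianReal_Ioi_neg, neg_neg, ← hγ, measure_congr Iio_ae_eq_Iic, hIic, hIoi, hx₁,
      ENNReal.ofReal_le_ofReal_iff (by linarith)] at h1
    linarith
  · by_contra! hle
    have := monotone_cdf γ hle
    linarith
  · rw [hIic, hx₂, ENNReal.ofReal_lt_ofReal_iff (by linarith)]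
    linarith
  · have h1 : {y : ℝ | x₁ < |y|} = Set.Ioi x₁ ∪ Set.Iio (-x₁) := by
      ext y
      simp only [Set.mem_ofPred_eq, lt_abs, Set.mem_union, Set.mem_Ioi, Set.mem_Iio]
      rw [lt_neg]
    rw [h1]
    refine (measure_union_le _ _).trans ?_
    rw [hγ, gaussianReal_Ioi_neg, ← hγ, hIoi, hx₁, ← ENNReal.ofReal_add (by linarith) (by linarith)]
    exact ENNReal.ofReal_le_ofReal (by linarith)

end StudentT

/-! ### Standard Gaussian vectors -/

section Gaussian

/-- The law of a vector of independent standard normal variables. -/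
abbrev stdNormal (ι : Type*) [Fintype ι] : Measure (ι → ℝ) :=
  Measure.pi fun _ : ι => gaussianReal 0 1

variable {ι κ : Type*} [Fintype ι] [Fintype κ]

/-- The coordinates of a standard Gaussian vector with respect to an orthonormal family are
independent standard normal variables. -/
lemma measurePreserving_orthonormal [DecidableEq κ] (v : κ → ι → ℝ)
    (hv : ∀ a b, ∑ i, v a i * v b i = if a = b then 1 else 0) :
    MeasurePreserving (fun (g : ι → ℝ) a => ∑ i, v a i * g i) (stdNormal ι) (stdNormal κ) := by
  have hm : Measurable (fun (g : ι → ℝ) a => ∑ i, v a i * g i) := by fun_prop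
  refine ⟨hm, ?_⟩
  have hinj : Function.Injective fun m : Measure (κ → ℝ) =>
      m.map (MeasurableEquiv.toLp 2 (κ → ℝ)) :=
    fun m₁ m₂ h => (MeasurableEquiv.map_measurableEquiv_injective _) h
  apply hinj
  simp only [MeasurableEquiv.coe_toLp]
  apply Measure.ext_of_charFun (E := EuclideanSpace ℝ κ)
  ext t
  rw [Measure.map_map (by fun_prop) hm, charFun_pi]
  have h1 : charFun ((stdNormal ι).map ((WithLp.toLp 2) ∘ fun (g : ι → ℝ) a => ∑ i, v a i * g i)) t
      = charFun ((stdNormal ι).map (WithLp.toLp 2)) (WithLp.toLp 2 fun i => ∑ a, t a * v a i) := by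
    have hm2 : Measurable (WithLp.toLp 2 : (κ → ℝ) → EuclideanSpace ℝ κ) := by fun_prop
    rw [charFun_apply, charFun_apply, integral_map (hm2.comp hm).aemeasurable
      (Measurable.aestronglyMeasurable (by fun_prop)),
      integral_map (Measurable.aemeasurable (by fun_prop))
        (Measurable.aestronglyMeasurable (by fun_prop))]
    congr 1
    ext g
    congr 3
    simp only [Function.comp, PiLp.inner_apply, RCLike.inner_apply, conj_trivial]
    simp_rw [Finset.mul_sum, Finset.sum_mul]
    rw [Finset.sum_comm]
    refine Finset.sum_congr rfl fun i _ => Finset.sum_congr rfl fun a _ => ?_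
    ring
  rw [h1, charFun_pi]
  simp_rw [charFun_gaussianReal]
  rw [← Complex.exp_sum, ← Complex.exp_sum]
  congr 1
  simp only [Complex.ofReal_zero, mul_zero, zero_mul, NNReal.coe_one, Complex.ofReal_one, one_mul,
    zero_sub, Finset.sum_neg_distrib, ← Finset.sum_div]
  congr 2
  norm_cast
  calc ∑ i, (∑ a, t a * v a i) ^ 2 = ∑ a, ∑ b, t a * t b * ∑ i, v a i * v b i := by
        simp_rw [Finset.mul_sum]
        calc _ = ∑ i, ∑ a, ∑ b, t a * t b * (v a i * v b i) := by
              refine Finset.sum_congr rfl fun i _ => ?_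
              rw [sq, Finset.sum_mul_sum]
              refine Finset.sum_congr rfl fun a _ => Finset.sum_congr rfl fun b _ => ?_
              ring
          _ = ∑ a, ∑ i, ∑ b, t a * t b * (v a i * v b i) := Finset.sum_comm
          _ = _ := Finset.sum_congr rfl fun a _ => Finset.sum_comm
    _ = ∑ a, t a ^ 2 := by
        refine Finset.sum_congr rfl fun a _ => ?_
        simp [hv, sq]

lemma measurePreserving_unit (v : ι → ℝ) (hv : ∑ i, v i ^ 2 = 1) :
    MeasurePreserving (fun g : ι → ℝ => ∑ i, v i * g i) (stdNormal ι) (gaussianReal 0 1) := by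
  have h1 := measurePreserving_orthonormal (κ := Unit) (fun _ => v)
    (by intro a b; simpa [sq] using hv)
  exact (measurePreserving_eval (fun _ : Unit => gaussianReal 0 1) ()).comp h1

lemma measurePreserving_flip [DecidableEq ι] (i : ι) :
    MeasurePreserving (fun (g : ι → ℝ) j => if j = i then -g j else g j)
      (stdNormal ι) (stdNormal ι) := by
  have h := measurePreserving_orthonormal (ι := ι) (κ := ι)
    (fun a j => if a = j then (if j = i then -1 else 1) else 0) (by
      intro a b
      by_cases hab : a = b
      · subst hab
        simp
        split_ifs <;> simp
      · simp only [if_neg hab]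
        refine Finset.sum_eq_zero fun j _ => ?_
        by_cases h1 : a = j
        · subst h1
          simp [Ne.symm hab]
        · simp [h1])
  convert h using 3 with g a
  simp [ite_mul, Finset.sum_ite_eq]

lemma integral_eq_zero_of_odd [DecidableEq ι] (i : ι) {f : (ι → ℝ) → ℝ}
    (hf : Measurable f) (h : ∀ g, f (fun j => if j = i then -g j else g j) = -f g) :
    ∫ g, f g ∂stdNormal ι = 0 := by
  have h1 := measurePreserving_flip i
  have h2 : ∫ g, f g ∂stdNormal ι = ∫ g, -f g ∂stdNormal ι := by
    conv_lhs => rw [← h1.map_eq]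
    rw [integral_map h1.measurable.aemeasurable hf.aestronglyMeasurable]
    simp_rw [h]
  rw [integral_neg] at h2
  linarith

/-! ### Moments -/

lemma exists_lintegral_abs_pow_le (p : ℕ) :
    ∃ K : ℝ, 0 ≤ K ∧ ∫⁻ x, ENNReal.ofReal (|x| ^ p) ∂gaussianReal 0 1 = ENNReal.ofReal K := by
  have h : Integrable (fun x : ℝ => |x| ^ p) (gaussianReal 0 1) := by
    rcases Nat.eq_zero_or_pos p with rfl | hp
    · simp
    have := (memLp_id_gaussianReal' (μ := 0) (v := 1) (p : ENNReal)
      (ENNReal.natCast_ne_top p)).integrable_norm_pow hp.ne'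
    simpa using this
  refine ⟨∫ x, |x| ^ p ∂gaussianReal 0 1, integral_nonneg fun x => by positivity, ?_⟩
  rw [ofReal_integral_eq_lintegral_ofReal h (ae_of_all _ fun x => by positivity)]

/-- The `p`-th absolute moment of the standard normal distribution. -/
def normalMoment (p : ℕ) : ℝ := (exists_lintegral_abs_pow_le p).choose

lemma normalMoment_nonneg (p : ℕ) : 0 ≤ normalMoment p :=
  (exists_lintegral_abs_pow_le p).choose_spec.1

lemma lintegral_abs_pow_gaussianReal (p : ℕ) :
    ∫⁻ x, ENNReal.ofReal (|x| ^ p) ∂gaussianReal 0 1 = ENNReal.ofReal (normalMoment p) :=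
  (exists_lintegral_abs_pow_le p).choose_spec.2

lemma lintegral_abs_pow_stdNormal (p : ℕ) (i : ι) :
    ∫⁻ g, ENNReal.ofReal (|g i| ^ p) ∂stdNormal ι = ENNReal.ofReal (normalMoment p) := by
  rw [← lintegral_abs_pow_gaussianReal,
    ← (measurePreserving_eval (fun _ : ι => gaussianReal 0 1) i).lintegral_comp (by fun_prop)]

lemma integrable_pow_stdNormal (p : ℕ) (i : ι) :
    Integrable (fun g => g i ^ p) (stdNormal ι) := by
  refine ⟨Measurable.aestronglyMeasurable (by fun_prop), ?_⟩
  rw [hasFiniteIntegral_iff_norm]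
  simp only [Real.norm_eq_abs, abs_pow, lintegral_abs_pow_stdNormal]
  exact ENNReal.ofReal_lt_top

lemma integral_sq_gaussianReal : ∫ x, x ^ 2 ∂gaussianReal 0 1 = 1 := by
  have h := variance_fun_id_gaussianReal (μ := 0) (v := 1)
  rw [variance_of_integral_eq_zero (by fun_prop) (by simp)] at h
  simpa using h

lemma integral_sq_stdNormal (i : ι) : ∫ g, g i ^ 2 ∂stdNormal ι = 1 := by
  have h := measurePreserving_eval (fun _ : ι => gaussianReal 0 1) i
  rw [← integral_sq_gaussianReal, ← h.map_eq, integral_map h.measurable.aemeasurable (by fun_prop)]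

/-! ### Inverse moments -/

lemma lintegral_enorm_rpow_neg_half_lt_top :
    ∫⁻ x, ‖x‖ₑ ^ (-(1 / 2) : ℝ) ∂gaussianReal 0 1 < ⊤ := by
  have hIoi : ∫⁻ x in Set.Ioi (0 : ℝ), ‖x‖ₑ ^ (-(1 / 2) : ℝ) ∂gaussianReal 0 1 < ⊤ := by
    rw [gaussianReal_of_var_ne_zero _ one_ne_zero,
      setLIntegral_withDensity_eq_setLIntegral_mul _ (measurable_gaussianPDF _ _) (by fun_prop)
        measurableSet_Ioi]
    have h := (integrableOn_rpow_mul_exp_neg_mul_sq (b := 1 / 2) (s := -(1 / 2)) (by norm_num)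
      (by norm_num)).const_mul ((√(2 * Real.pi))⁻¹)
    have h2 := h.lintegral_lt_top
    refine lt_of_le_of_lt (le_of_eq ?_) h2
    refine setLIntegral_congr_fun measurableSet_Ioi fun x hx => ?_
    have hx0 : 0 < x := hx
    simp only [Pi.mul_apply, gaussianPDF, gaussianPDFReal]
    rw [Real.enorm_of_nonneg hx0.le, ENNReal.ofReal_rpow_of_pos hx0,
      ← ENNReal.ofReal_mul (by positivity)]
    congr 1
    simp only [NNReal.coe_one, mul_one, sub_zero]
    rw [show -x ^ 2 / 2 = -(1 / 2) * x ^ 2 by ring]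
    ring
  have hIio : ∫⁻ x in Set.Iio (0 : ℝ), ‖x‖ₑ ^ (-(1 / 2) : ℝ) ∂gaussianReal 0 1 < ⊤ := by
    have h : MeasurePreserving (fun x : ℝ => -x) (gaussianReal 0 1) (gaussianReal 0 1) :=
      ⟨measurable_neg, by rw [gaussianReal_map_neg, neg_zero]⟩
    have h2 := h.setLIntegral_comp_preimage (s := Set.Ioi 0) measurableSet_Ioi
      (f := fun x => ‖x‖ₑ ^ (-(1 / 2) : ℝ)) (by fun_prop)
    have h3 : (fun x : ℝ => -x) ⁻¹' Set.Ioi 0 = Set.Iio 0 := by ext; simp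
    simp only [h3, enorm_neg] at h2
    rw [h2]
    exact hIoi
  have := nullSingletonClass_gaussianReal (μ := 0) (v := 1) one_ne_zero
  rw [← lintegral_add_compl _ (measurableSet_Ioi (a := (0 : ℝ))), Set.compl_Ioi,
    ← setLIntegral_congr Iio_ae_eq_Iic]
  exact ENNReal.add_lt_top.2 ⟨hIoi, hIio⟩

/-- Lyapunov's inequality for powers at most one. -/
lemma lintegral_rpow_le_rpow_lintegral {α : Type*} [MeasurableSpace α] {ν : Measure α}
    [IsProbabilityMeasure ν] {f : α → ENNReal} (hf : Measurable f) {s : ℝ} (hs0 : 0 < s)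
    (hs1 : s ≤ 1) : ∫⁻ x, f x ^ s ∂ν ≤ (∫⁻ x, f x ∂ν) ^ s := by
  have h := eLpNorm'_le_eLpNorm'_of_exponent_le hs0 hs1 ν (f := f) hf.aestronglyMeasurable
  simp only [eLpNorm', enorm_eq_self, ENNReal.rpow_one, div_one] at h
  have h2 := ENNReal.rpow_le_rpow h hs0.le
  rwa [← ENNReal.rpow_mul, one_div, inv_mul_cancel₀ hs0.ne', ENNReal.rpow_one] at h2

lemma ae_ne_zero_stdNormal : ∀ᵐ g ∂stdNormal κ, ∀ a, g a ≠ 0 := by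
  rw [ae_all_iff]
  intro a
  have := nullSingletonClass_gaussianReal (μ := 0) (v := 1) one_ne_zero
  have h : ∀ᵐ x ∂gaussianReal 0 1, x ≠ 0 := by
    rw [ae_iff]; simp
  exact (measurePreserving_eval (fun _ : κ => gaussianReal 0 1) a).quasiMeasurePreserving.ae h

lemma inv_mean_sq_pow_le {b p : ℕ} (hb : 0 < b) {y : Fin b → ℝ} (hy : ∀ a, y a ≠ 0) :
    (((b : ℝ)⁻¹ * ∑ a, y a ^ 2)⁻¹) ^ p ≤ ∏ a, |y a| ^ (-(2 * p / b) : ℝ) := by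
  have hb' : (0 : ℝ) < b := by exact_mod_cast hb
  have h := Real.geom_mean_le_arith_mean_weighted Finset.univ (fun _ : Fin b => (b : ℝ)⁻¹)
    (fun a => y a ^ 2) (fun _ _ => by positivity) (by simp [hb'.ne']) (fun _ _ => by positivity)
  rw [← Finset.mul_sum] at h
  have hpos : 0 < ∏ a, (y a ^ 2) ^ (b : ℝ)⁻¹ :=
    Finset.prod_pos fun a _ => Real.rpow_pos_of_pos (by have := hy a; positivity) _
  refine (pow_le_pow_left₀ (inv_nonneg.2 (hpos.le.trans h)) (inv_anti₀ hpos h) p).trans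
    (le_of_eq ?_)
  rw [← Finset.prod_inv_distrib, ← Finset.prod_pow]
  refine Finset.prod_congr rfl fun a _ => ?_
  have ha : 0 < |y a| := abs_pos.2 (hy a)
  rw [← sq_abs, ← Real.rpow_natCast (|y a|) 2, ← Real.rpow_mul ha.le, ← Real.rpow_neg ha.le,
    ← Real.rpow_natCast, ← Real.rpow_mul ha.le]
  congr 1
  push_cast
  ring

/-- Inverse moments of the mean square of many independent standard normal variables. -/
lemma exists_lintegral_inv_mean_sq_le (p : ℕ) : ∃ K : ℝ, 0 ≤ K ∧ ∀ b : ℕ, 0 < b → 4 * p ≤ b →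
    ∫⁻ y, ENNReal.ofReal ((((b : ℝ)⁻¹ * ∑ a, y a ^ 2)⁻¹) ^ p) ∂stdNormal (Fin b) ≤
      ENNReal.ofReal K := by
  set I := ∫⁻ x, ‖x‖ₑ ^ (-(1 / 2) : ℝ) ∂gaussianReal 0 1 with hI
  have hIt : I < ⊤ := lintegral_enorm_rpow_neg_half_lt_top
  have hKt : I ^ (4 * p : ℝ) ≠ ⊤ := ENNReal.rpow_ne_top_of_nonneg (by positivity) hIt.ne
  refine ⟨max 1 (I ^ (4 * p : ℝ)).toReal, by positivity, fun b hb hpb => ?_⟩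
  have hb' : (0 : ℝ) < b := by exact_mod_cast hb
  rcases Nat.eq_zero_or_pos p with rfl | hp
  · simp
  have hp' : (0 : ℝ) < p := by exact_mod_cast hp
  have hle : ∫⁻ y, ENNReal.ofReal ((((b : ℝ)⁻¹ * ∑ a, y a ^ 2)⁻¹) ^ p) ∂stdNormal (Fin b) ≤
      ∫⁻ y, ∏ a, ‖y a‖ₑ ^ (-(2 * p / b) : ℝ) ∂stdNormal (Fin b) := by
    refine lintegral_mono_ae ?_
    filter_upwards [ae_ne_zero_stdNormal] with y hy
    refine (ENNReal.ofReal_le_ofReal (inv_mean_sq_pow_le hb hy)).trans (le_of_eq ?_)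
    rw [ENNReal.ofReal_prod_of_nonneg fun a _ => by positivity]
    refine Finset.prod_congr rfl fun a _ => ?_
    rw [← ENNReal.ofReal_rpow_of_pos (abs_pos.2 (hy a)), Real.enorm_eq_ofReal_abs]
  refine hle.trans ?_
  have hind := iIndepFun_pi (μ := fun _ : Fin b => gaussianReal 0 1)
    (X := fun _ x => ‖x‖ₑ ^ (-(2 * p / b) : ℝ)) (fun _ => by fun_prop)
  rw [lintegral_prod_eq_prod_lintegral_of_indepFun Finset.univ _ hind (fun _ => by fun_prop)]
  have hone : ∀ a : Fin b, ∫⁻ y, ‖y a‖ₑ ^ (-(2 * p / b) : ℝ) ∂stdNormal (Fin b) ≤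
      I ^ (4 * p / b : ℝ) := by
    intro a
    have h1 := (measurePreserving_eval (fun _ : Fin b => gaussianReal 0 1) a).lintegral_comp
      (f := fun x : ℝ => ‖x‖ₑ ^ (-(2 * p / b) : ℝ)) (by fun_prop)
    refine (le_of_eq h1).trans ?_
    have h2 := lintegral_rpow_le_rpow_lintegral (ν := gaussianReal 0 1)
      (f := fun x : ℝ => ‖x‖ₑ ^ (-(1 / 2) : ℝ)) (by fun_prop) (s := 4 * p / b) (by positivity)
      (by rw [div_le_one hb']; exact_mod_cast hpb)
    refine le_trans (le_of_eq ?_) h2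
    refine lintegral_congr fun x => ?_
    rw [← ENNReal.rpow_mul]
    congr 1
    ring
  refine (Finset.prod_le_prod' fun a _ => hone a).trans ?_
  rw [Finset.prod_const, Finset.card_univ, Fintype.card_fin, ← ENNReal.rpow_natCast,
    ← ENNReal.rpow_mul, div_mul_cancel₀ _ hb'.ne',
    ENNReal.le_ofReal_iff_toReal_le hKt (by positivity)]
  exact le_max_right _ _

end Gaussian

/-! ### Sums of squared residuals over windows -/

section Blocks

/-- More vectors than coordinates are linearly dependent. -/
lemma exists_unit_orthogonal (d : ℕ) (z : Fin (d + 1) → Fin d → ℝ) :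
    ∃ u : Fin (d + 1) → ℝ, 0 < ∑ t, u t ^ 2 ∧ ∀ k, ∑ t, u t * z t k = 0 := by
  have h : LinearMap.ker (Matrix.vecMulLinear (of z)) ≠ ⊥ := by
    apply LinearMap.ker_ne_bot_of_finrank_lt
    simp
  obtain ⟨u, hu, hu0⟩ := (Submodule.ne_bot_iff _).1 h
  refine ⟨u, ?_, fun k => ?_⟩
  · obtain ⟨t, ht⟩ := Function.ne_iff.1 hu0
    exact Finset.sum_pos' (fun _ _ => sq_nonneg _) ⟨t, Finset.mem_univ _, by
      have : u t ≠ 0 := ht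
      positivity⟩
  · have := congrFun (LinearMap.mem_ker.1 hu) k
    simpa [Matrix.vecMul, dotProduct] using this

/-- Whatever multiple of the `d` columns of `z` is subtracted, the sum of squares over a set `S`
dominates a sum of squares of independent standard normal variables. -/
lemma exists_orthonormal_le_sum_sq {n d b : ℕ} {S : Finset (Fin n)} (hS : b * (d + 1) ≤ S.card)
    (z : Fin n → Fin d → ℝ) {c : ℝ} (hc : 0 < c) {τ : Fin n → ℝ} (hτ : ∀ j, c ≤ τ j ^ 2) :
    ∃ v : Fin b → Fin n → ℝ, (∀ B B', ∑ j, v B j * v B' j = if B = B' then 1 else 0) ∧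
      ∀ (g : Fin n → ℝ) (θ : Fin d → ℝ), c * ∑ B, (∑ j, v B j * g j) ^ 2 ≤
        ∑ j ∈ S, (τ j * g j - ∑ k, z j k * θ k) ^ 2 := by
  classical
  obtain ⟨φ⟩ : Nonempty (Fin b × Fin (d + 1) ↪ S) := by
    apply Function.Embedding.nonempty_of_card_le
    simpa using hS
  set ψ : Fin b × Fin (d + 1) → Fin n := fun x => (φ x : Fin n) with hψ
  have hinj : Function.Injective ψ := Subtype.val_injective.comp φ.injective
  have hex := fun B : Fin b => exists_unit_orthogonal d (fun t => z (ψ (B, t)))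
  choose u hu0 hu using hex
  set r : Fin b → ℝ := fun B => ∑ t, (u B t * τ (ψ (B, t))) ^ 2 with hr
  have hrc : ∀ B, c * ∑ t, u B t ^ 2 ≤ r B := by
    intro B
    rw [hr, Finset.mul_sum]
    refine Finset.sum_le_sum fun t _ => ?_
    rw [mul_pow, mul_comm]
    exact mul_le_mul_of_nonneg_left (hτ _) (sq_nonneg _)
  have hr0 : ∀ B, 0 < r B := fun B => lt_of_lt_of_le (mul_pos hc (hu0 B)) (hrc B)
  set α : Fin b → Fin (d + 1) → ℝ := fun B t => u B t * τ (ψ (B, t)) / √(r B) with hα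
  set v : Fin b → Fin n → ℝ := fun B j => ∑ t, if ψ (B, t) = j then α B t else 0 with hv
  have hvg : ∀ B (g : Fin n → ℝ), ∑ j, v B j * g j = ∑ t, α B t * g (ψ (B, t)) := by
    intro B g
    simp only [hv, Finset.sum_mul]
    rw [Finset.sum_comm]
    refine Finset.sum_congr rfl fun t _ => ?_
    simp [ite_mul]
  refine ⟨v, fun B B' => ?_, fun g θ => ?_⟩
  · rw [hvg]
    split_ifs with hBB
    · subst hBB
      have : ∀ t, v B (ψ (B, t)) = α B t := by
        intro t
        simp only [hv]
        rw [Finset.sum_eq_single t]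
        · simp
        · intro t' _ ht'
          rw [if_neg]
          intro h
          exact ht' (Prod.ext_iff.1 (hinj h)).2
        · simp
      simp only [this, hα]
      have : ∀ t, u B t * τ (ψ (B, t)) / √(r B) * (u B t * τ (ψ (B, t)) / √(r B)) =
          (u B t * τ (ψ (B, t))) ^ 2 / r B := by
        intro t
        rw [div_mul_div_comm, Real.mul_self_sqrt (hr0 B).le, sq]
      simp only [this, ← Finset.sum_div]
      exact div_self (hr0 B).ne'
    · refine Finset.sum_eq_zero fun t _ => ?_
      have : v B' (ψ (B, t)) = 0 := by
        refine Finset.sum_eq_zero fun t' _ => ?_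
        rw [if_neg]
        intro h
        exact hBB (Prod.ext_iff.1 (hinj h)).1.symm
      rw [this, mul_zero]
  · have hB : ∀ B, c * (∑ j, v B j * g j) ^ 2 ≤
        ∑ t, (τ (ψ (B, t)) * g (ψ (B, t)) - ∑ k, z (ψ (B, t)) k * θ k) ^ 2 := by
      intro B
      have h1 : ∑ j, v B j * g j = (∑ t, u B t *
          (τ (ψ (B, t)) * g (ψ (B, t)) - ∑ k, z (ψ (B, t)) k * θ k)) / √(r B) := by
        rw [hvg]
        have h0 : ∑ t, u B t * ∑ k, z (ψ (B, t)) k * θ k = 0 := by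
          simp_rw [Finset.mul_sum]
          rw [Finset.sum_comm]
          refine Finset.sum_eq_zero fun k _ => ?_
          simp_rw [← mul_assoc, ← Finset.sum_mul]
          rw [hu B k, zero_mul]
        simp_rw [mul_sub, Finset.sum_sub_distrib]
        rw [h0, sub_zero, Finset.sum_div]
        refine Finset.sum_congr rfl fun t _ => ?_
        simp only [hα]; ring
      rw [h1, div_pow, Real.sq_sqrt (hr0 B).le, mul_div_assoc', div_le_iff₀ (hr0 B)]
      calc c * (∑ t, u B t *
            (τ (ψ (B, t)) * g (ψ (B, t)) - ∑ k, z (ψ (B, t)) k * θ k)) ^ 2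
          ≤ c * ((∑ t, u B t ^ 2) *
            ∑ t, (τ (ψ (B, t)) * g (ψ (B, t)) - ∑ k, z (ψ (B, t)) k * θ k) ^ 2) :=
            mul_le_mul_of_nonneg_left (Finset.sum_mul_sq_le_sq_mul_sq _ _ _) hc.le
        _ = (c * ∑ t, u B t ^ 2) *
            ∑ t, (τ (ψ (B, t)) * g (ψ (B, t)) - ∑ k, z (ψ (B, t)) k * θ k) ^ 2 := by ring
        _ ≤ r B * ∑ t, (τ (ψ (B, t)) * g (ψ (B, t)) - ∑ k, z (ψ (B, t)) k * θ k) ^ 2 :=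
            mul_le_mul_of_nonneg_right (hrc B) (Finset.sum_nonneg fun _ _ => sq_nonneg _)
        _ = _ := mul_comm _ _
    calc c * ∑ B, (∑ j, v B j * g j) ^ 2
        = ∑ B, c * (∑ j, v B j * g j) ^ 2 := Finset.mul_sum _ _ _
      _ ≤ ∑ B, ∑ t, (τ (ψ (B, t)) * g (ψ (B, t)) - ∑ k, z (ψ (B, t)) k * θ k) ^ 2 :=
          Finset.sum_le_sum fun B _ => hB B
      _ = ∑ x : Fin b × Fin (d + 1), (τ (ψ x) * g (ψ x) - ∑ k, z (ψ x) k * θ k) ^ 2 :=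
          (Fintype.sum_prod_type
            (fun x : Fin b × Fin (d + 1) => (τ (ψ x) * g (ψ x) - ∑ k, z (ψ x) k * θ k) ^ 2)).symm
      _ = ∑ j ∈ Finset.univ.image ψ, (τ j * g j - ∑ k, z j k * θ k) ^ 2 := by
          rw [Finset.sum_image fun x _ y _ h => hinj h]
      _ ≤ _ := by
          refine Finset.sum_le_sum_of_subset_of_nonneg ?_ fun _ _ _ => sq_nonneg _
          intro j hj
          obtain ⟨x, -, rfl⟩ := Finset.mem_image.1 hj
          exact (φ x).2

lemma ae_sum_sq_pos {n d : ℕ} {S : Finset (Fin n)} (hS : d + 1 ≤ S.card)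
    (z : Fin n → Fin d → ℝ) {c : ℝ} (hc : 0 < c) {τ : Fin n → ℝ} (hτ : ∀ j, c ≤ τ j ^ 2) :
    ∀ᵐ g ∂stdNormal (Fin n), ∀ θ : Fin d → ℝ,
      0 < ∑ j ∈ S, (τ j * g j - ∑ k, z j k * θ k) ^ 2 := by
  obtain ⟨v, hv, h⟩ := exists_orthonormal_le_sum_sq (b := 1) (by simpa using hS) z hc hτ
  filter_upwards [(measurePreserving_orthonormal v hv).quasiMeasurePreserving.ae
    ae_ne_zero_stdNormal] with g hg θ
  refine lt_of_lt_of_le (mul_pos hc ?_) (h g θ)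
  have := hg 0
  simp only [Finset.univ_unique, Fin.default_eq_zero, Finset.sum_singleton]
  positivity

/-- Inverse moments of the mean square of residuals over a window of about `lam` samples. -/
lemma exists_lintegral_inv_window_le (d p : ℕ) {c : ℝ} (hc : 0 < c) :
    ∃ K : ℝ, 0 ≤ K ∧ ∃ L : ℕ, ∀ lam : ℕ, L ≤ lam → ∀ (n : ℕ) (z : Fin n → Fin d → ℝ)
      (S : Finset (Fin n)), lam ≤ 2 * S.card → ∀ τ : Fin n → ℝ, (∀ j, c ≤ τ j ^ 2) →
      ∀ θ : (Fin n → ℝ) → Fin d → ℝ,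
      ∫⁻ g, ENNReal.ofReal ((((lam : ℝ)⁻¹ *
        ∑ j ∈ S, (τ j * g j - ∑ k, z j k * θ g k) ^ 2)⁻¹) ^ p) ∂stdNormal (Fin n) ≤
        ENNReal.ofReal K := by
  obtain ⟨K, hK0, hK⟩ := exists_lintegral_inv_mean_sq_le p
  refine ⟨(4 * (d + 1) / c) ^ p * K, by positivity, (16 * p + 4) * (d + 1), ?_⟩
  intro lam hlam n z S hS τ hτ θ
  set b := S.card / (d + 1) with hb
  have hbS : b * (d + 1) ≤ S.card := Nat.div_mul_le_self _ _
  have hSb : S.card < (b + 1) * (d + 1) := by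
    rw [mul_comm]; exact Nat.lt_mul_div_succ _ (Nat.succ_pos d)
  have hb1 : 8 * p + 2 < b + 1 := by
    by_contra! hle
    have : (b + 1) * (d + 1) ≤ (8 * p + 2) * (d + 1) := Nat.mul_le_mul_right _ hle
    nlinarith
  have hb0 : 0 < b := by omega
  have hlb : (lam : ℝ) ≤ 4 * (d + 1) * b := by
    have : lam ≤ 4 * (d + 1) * b := by nlinarith
    exact_mod_cast this
  have hlam0 : (0 : ℝ) < lam := by
    have : 0 < lam := lt_of_lt_of_le (by positivity) hlam
    exact_mod_cast this
  have hb0' : (0 : ℝ) < b := by exact_mod_cast hb0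
  obtain ⟨v, hv, h⟩ := exists_orthonormal_le_sum_sq hbS z hc hτ
  have hmp := measurePreserving_orthonormal v hv
  have hpt : ∀ᵐ g ∂stdNormal (Fin n), ENNReal.ofReal ((((lam : ℝ)⁻¹ *
        ∑ j ∈ S, (τ j * g j - ∑ k, z j k * θ g k) ^ 2)⁻¹) ^ p) ≤
      ENNReal.ofReal ((4 * (d + 1) / c) ^ p) *
        ENNReal.ofReal ((((b : ℝ)⁻¹ * ∑ a, (∑ j, v a j * g j) ^ 2)⁻¹) ^ p) := by
    filter_upwards [hmp.quasiMeasurePreserving.ae ae_ne_zero_stdNormal] with g hg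
    rw [← ENNReal.ofReal_mul (by positivity), ← mul_pow]
    refine ENNReal.ofReal_le_ofReal (pow_le_pow_left₀ (by positivity) ?_ p)
    have hpos : 0 < ∑ a, (∑ j, v a j * g j) ^ 2 := by
      refine Finset.sum_pos (fun a _ => ?_) ⟨⟨0, hb0⟩, Finset.mem_univ _⟩
      have := hg a
      positivity
    have h1 := h g (θ g)
    set Q := ∑ a, (∑ j, v a j * g j) ^ 2
    calc ((lam : ℝ)⁻¹ * ∑ j ∈ S, (τ j * g j - ∑ k, z j k * θ g k) ^ 2)⁻¹
        ≤ ((lam : ℝ)⁻¹ * (c * Q))⁻¹ := by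
          refine inv_anti₀ (by positivity) (by gcongr)
      _ = lam / (c * Q) := by rw [mul_inv, inv_inv, div_eq_mul_inv]
      _ ≤ (4 * (d + 1) * b) / (c * Q) := by gcongr
      _ = _ := by field_simp
  refine (lintegral_mono_ae hpt).trans ?_
  rw [lintegral_const_mul _ (Measurable.ennreal_ofReal (by fun_prop)),
    ENNReal.ofReal_mul (by positivity)]
  gcongr
  refine le_trans (le_of_eq ?_) (hK b hb0 (by omega))
  exact hmp.lintegral_comp (f := fun y => ENNReal.ofReal ((((b : ℝ)⁻¹ * ∑ a, y a ^ 2)⁻¹) ^ p))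
    (Measurable.ennreal_ofReal (by fun_prop))

end Blocks

/-! ### Uncorrelated random vectors -/

section Uncorrelated

/-- The coordinates of `B` are orthogonal in `L²(ν)`, with second moments at most `K`. -/
structure OrthogonalCoords {α ι : Type*} [MeasurableSpace α] (ν : Measure α) (K : ℝ)
    (B : α → ι → ℝ) : Prop where
  memLp : ∀ i, MemLp (fun x => B x i) 2 ν
  orthogonal : ∀ i j, i ≠ j → ∫ x, B x i * B x j ∂ν = 0
  sq_le : ∀ i, ∫ x, B x i ^ 2 ∂ν ≤ K

variable {α ι : Type*} [MeasurableSpace α] [Fintype ι] {ν : Measure α}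

lemma OrthogonalCoords.lintegral_sq_le {K : ℝ} {B : α → ι → ℝ} (h : OrthogonalCoords ν K B)
    (a : ι → ℝ) : ∫⁻ x, ENNReal.ofReal ((∑ i, a i * B x i) ^ 2) ∂ν ≤
      ENNReal.ofReal (K * ∑ i, a i ^ 2) := by
  classical
  have hL : MemLp (fun x => ∑ i, a i * B x i) 2 ν :=
    memLp_finsetSum _ fun i _ => (h.memLp i).const_mul (a i)
  rw [← ofReal_integral_eq_lintegral_ofReal hL.integrable_sq (ae_of_all _ fun _ => sq_nonneg _)]
  refine ENNReal.ofReal_le_ofReal ?_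
  have h1 : ∀ x, (∑ i, a i * B x i) ^ 2 = ∑ i, ∑ j, a i * a j * (B x i * B x j) := by
    intro x
    rw [sq, Finset.sum_mul_sum]
    refine Finset.sum_congr rfl fun i _ => Finset.sum_congr rfl fun j _ => ?_
    ring
  have hint : ∀ i j, Integrable (fun x => a i * a j * (B x i * B x j)) ν := fun i j =>
    ((h.memLp i).integrable_mul (h.memLp j)).const_mul _
  simp_rw [h1]
  rw [integral_finsetSum _ fun i _ => integrable_finsetSum _ fun j _ => hint i j, Finset.mul_sum]
  refine Finset.sum_le_sum fun i _ => ?_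
  rw [integral_finsetSum _ fun j _ => hint i j, Finset.sum_eq_single i]
  · rw [integral_const_mul]
    have := h.sq_le i
    have h2 : ∫ x, B x i * B x i ∂ν = ∫ x, B x i ^ 2 ∂ν := by simp_rw [sq]
    rw [h2, ← sq, mul_comm]
    exact mul_le_mul_of_nonneg_right this (sq_nonneg _)
  · intro j _ hj
    rw [integral_const_mul, h.orthogonal i j hj.symm, mul_zero]
  · simp

end Uncorrelated

/-! ### Smoothing windows -/

section Windows

variable {n d : ℕ} (E : Expert d) (lam : ℕ) (z : Fin n → Fin d → ℝ)

lemma position_injective : Function.Injective (position E z) := by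
  cases E with
  | homoskedastic => exact Function.injective_id
  | samplingIndex => exact Function.injective_id
  | predictor m => exact (Tuple.sort fun j => z j m).symm.injective

lemma position_surjective : Function.Surjective (position E z) :=
  Finite.surjective_of_injective (position_injective E z)

lemma mem_window {i j : Fin n} : j ∈ window E lam z i ↔
    2 * |((position E z i : ℕ) : ℤ) - ((position E z j : ℕ) : ℤ)| ≤ (lam : ℤ) := by
  simp [window]

lemma mem_window_comm {i j : Fin n} : j ∈ window E lam z i ↔ i ∈ window E lam z j := by
  rw [mem_window, mem_window, abs_sub_comm]

lemma card_window_le (i : Fin n) : (window E lam z i).card ≤ lam + 1 := by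
  set a : ℤ := ((position E z i : ℕ) : ℤ)
  have h : (window E lam z i).card ≤ (Finset.Icc (a - (lam / 2 : ℕ)) (a + (lam / 2 : ℕ))).card := by
    refine Finset.card_le_card_of_injOn (fun j => ((position E z j : ℕ) : ℤ)) ?_ ?_
    · intro j hj
      have h1 := (mem_window E lam z).1 hj
      simp only [Finset.coe_Icc, Set.mem_Icc]
      change 2 * |a - ((position E z j : ℕ) : ℤ)| ≤ (lam : ℤ) at h1
      have h2 := abs_le.1 (show |a - ((position E z j : ℕ) : ℤ)| ≤ ((lam / 2 : ℕ) : ℤ) by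
        push_cast; omega)
      constructor <;> linarith [h2.1, h2.2]
    · intro j _ k _ hjk
      refine position_injective E z (Fin.ext ?_)
      exact Int.ofNat_inj.1 hjk
  refine h.trans ?_
  simp only [Int.card_Icc]
  omega

lemma le_two_mul_card_window (hlam : lam < n) (i : Fin n) :
    lam ≤ 2 * (window E lam z i).card := by
  set m := lam / 2 with hm
  choose inv hinv using position_surjective E z
  suffices h : m + 1 ≤ (window E lam z i).card by omega
  have key : ∀ f : Fin (m + 1) → Fin n, Function.Injective f →
      (∀ t, 2 * |((position E z i : ℕ) : ℤ) - ((f t : ℕ) : ℤ)| ≤ (lam : ℤ)) →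
      m + 1 ≤ (window E lam z i).card := by
    intro f hf hft
    have := Finset.card_le_card_of_injOn (s := (Finset.univ : Finset (Fin (m + 1))))
      (t := window E lam z i) (fun t => inv (f t))
      (fun t _ => by
        rw [SetLike.mem_coe, mem_window, hinv]; exact hft t)
      (fun t _ t' _ h => hf (by
        have := congrArg (position E z) h
        simpa [hinv] using this))
    simpa using this
  set a := position E z i with ha
  by_cases hcase : (a : ℕ) + m < n
  · refine key (fun t => ⟨a + t, by omega⟩) (fun t t' h => ?_) fun t => ?_
    · simp only [Fin.mk.injEq] at h
      exact Fin.ext (by omega)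
    · push_cast
      rw [show ((a : ℕ) : ℤ) - ((a : ℕ) + (t : ℕ) : ℤ) = -((t : ℕ) : ℤ) by ring, abs_neg,
        abs_of_nonneg (by positivity)]
      omega
  · refine key (fun t => ⟨a - t, by omega⟩) (fun t t' h => ?_) fun t => ?_
    · simp only [Fin.mk.injEq] at h
      exact Fin.ext (by omega)
    · have : ((⟨a - t, by omega⟩ : Fin n) : ℕ) = a - t := rfl
      rw [this, Nat.cast_sub (by omega), sub_sub_cancel, abs_of_nonneg (by positivity)]
      omega

/-- Every sample lies in at most `lam + 1` windows. -/
lemma sum_sum_window_le {f : Fin n → ℝ} (hf : ∀ j, 0 ≤ f j) :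
    ∑ i, ∑ j ∈ window E lam z i, f j ≤ (lam + 1) * ∑ j, f j := by
  have h : ∑ i, ∑ j ∈ window E lam z i, f j = ∑ j, ∑ _i ∈ window E lam z j, f j :=
    Finset.sum_comm' fun i j => by simp [mem_window_comm E lam z (i := i) (j := j)]
  rw [h, Finset.mul_sum]
  refine Finset.sum_le_sum fun j _ => ?_
  rw [Finset.sum_const, nsmul_eq_mul]
  refine mul_le_mul_of_nonneg_right ?_ (hf j)
  exact_mod_cast card_window_le E lam z j

lemma measurable_position_eq (i a : Fin n) :
    Measurable fun z : Fin n → Fin d → ℝ => position E z i = a := by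
  cases E with
  | homoskedastic => exact measurable_const (a := i = a)
  | samplingIndex => exact measurable_const (a := i = a)
  | predictor m =>
    have h : (fun z : Fin n → Fin d → ℝ => position (.predictor m) z i = a) = fun z =>
        ∃ σ : Equiv.Perm (Fin n), σ = Tuple.sort (fun j => z j m) ∧ σ.symm i = a := by
      ext z; simp [position]
    rw [h]
    refine Measurable.exists fun σ => Measurable.and ?_ measurable_const
    simp_rw [Tuple.eq_sort_iff]
    refine Measurable.and (Measurable.forall fun k => Measurable.forall fun l =>
      Measurable.imp measurable_const ?_) (Measurable.forall fun k => Measurable.forall fun l =>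
      Measurable.imp measurable_const (Measurable.imp ?_ measurable_const))
    · exact measurableSet_setOfPred.1 (measurableSet_le (by fun_prop) (by fun_prop))
    · exact measurableSet_setOfPred.1 (measurableSet_eq_fun (by fun_prop) (by fun_prop))

lemma measurable_mem_window (i j : Fin n) :
    Measurable fun z : Fin n → Fin d → ℝ => j ∈ window E lam z i := by
  have h : (fun z : Fin n → Fin d → ℝ => j ∈ window E lam z i) = fun z =>
      ∃ a b : Fin n, (position E z i = a ∧ position E z j = b) ∧
        2 * |((a : ℕ) : ℤ) - ((b : ℕ) : ℤ)| ≤ (lam : ℤ) := by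
    ext z; simp [mem_window]
  rw [h]
  exact Measurable.exists fun a => Measurable.exists fun b => Measurable.and
    (Measurable.and (measurable_position_eq E i a) (measurable_position_eq E j b)) measurable_const

lemma measurable_sum_window {α : Type*} [MeasurableSpace α] {z : α → Fin n → Fin d → ℝ}
    (hz : Measurable z) {f : α → Fin n → ℝ} (hf : ∀ j, Measurable fun x => f x j) (i : Fin n) :
    Measurable fun x => ∑ j ∈ window E lam (z x) i, f x j := by
  classical
  have h : (fun x => ∑ j ∈ window E lam (z x) i, f x j) =
      fun x => ∑ j, if j ∈ window E lam (z x) i then f x j else 0 := by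
    ext x
    rw [← Finset.sum_filter]
    congr 1
    ext j; simp
  rw [h]
  refine Finset.measurable_sum _ fun j _ => Measurable.ite ?_ (hf j) measurable_const
  exact measurableSet_setOfPred.2 ((measurable_mem_window E lam i j).comp hz)

end Windows

/-! ### Weighted least squares -/

section WLS

variable {n d : ℕ}

/-- The fitted values of the weighted least squares regression of `x` on the columns of `z`. -/
def wlsFit (z : Fin n → Fin d → ℝ) (w x : Fin n → ℝ) (i : Fin n) : ℝ :=
  ∑ k, z i k * wlsCoef z w x k

lemma isUnit_det_weighted {z : Fin n → Fin d → ℝ} (hz : ((of z)ᵀ * of z).PosDef)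
    {w : Fin n → ℝ} (hw : ∀ i, 0 < w i) : IsUnit ((of z)ᵀ * diagonal w * of z).det := by
  rw [← Matrix.isUnit_iff_isUnit_det]
  refine Matrix.PosDef.isUnit ?_
  have hinj : Function.Injective (of z).mulVec := by
    intro a b hab
    have h1 : ((of z)ᵀ * of z) *ᵥ a = ((of z)ᵀ * of z) *ᵥ b := by
      rw [← Matrix.mulVec_mulVec, ← Matrix.mulVec_mulVec]
      congr 1
    exact Matrix.mulVec_injective_of_isUnit hz.isUnit h1
  have h := Matrix.PosDef.conjTranspose_mul_mul_same
    (Matrix.posDef_diagonal_iff.2 hw) (B := of z) hinj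
  simpa using h

lemma wlsFit_normal_eq {z : Fin n → Fin d → ℝ} {w : Fin n → ℝ}
    (h : IsUnit ((of z)ᵀ * diagonal w * of z).det) (x : Fin n → ℝ) (θ : Fin d → ℝ) :
    ∑ i, w i * (x i - wlsFit z w x i) * ∑ k, z i k * θ k = 0 := by
  have h1 : ((of z)ᵀ * diagonal w * of z) *ᵥ wlsCoef z w x = ((of z)ᵀ * diagonal w) *ᵥ x := by
    rw [wlsCoef, Matrix.mulVec_mulVec, Matrix.mul_nonsing_inv _ h, Matrix.one_mulVec]
  have h2 : ∀ k, ∑ i, z i k * (w i * (x i - wlsFit z w x i)) = 0 := by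
    intro k
    have h3 := congrFun h1 k
    rw [← Matrix.mulVec_mulVec, ← Matrix.mulVec_mulVec, ← Matrix.mulVec_mulVec] at h3
    simp only [Matrix.mulVec, dotProduct, Matrix.transpose_apply, of_apply, diagonal_apply,
      ite_mul, zero_mul, Finset.sum_ite_eq, Finset.mem_univ, if_true] at h3
    simp only [wlsFit, mul_sub, Finset.sum_sub_distrib]
    rw [← h3, sub_self]
  simp_rw [Finset.mul_sum]
  rw [Finset.sum_comm]
  refine Finset.sum_eq_zero fun k _ => ?_
  have : ∀ i, w i * (x i - wlsFit z w x i) * (z i k * θ k) =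
      z i k * (w i * (x i - wlsFit z w x i)) * θ k := fun i => by ring
  simp_rw [this, ← Finset.sum_mul]
  rw [h2, zero_mul]

lemma wlsResid_add {z : Fin n → Fin d → ℝ} {w : Fin n → ℝ}
    (h : IsUnit ((of z)ᵀ * diagonal w * of z).det) (α : Fin d → ℝ) (e : Fin n → ℝ) :
    wlsResid z w (fun i => ∑ k, z i k * α k + e i) = wlsResid z w e := by
  have h1 : wlsCoef z w (fun i => ∑ k, z i k * α k + e i) = α + wlsCoef z w e := by
    have : (fun i => ∑ k, z i k * α k + e i) = of z *ᵥ α + e := rfl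
    rw [wlsCoef, this, Matrix.mulVec_add, Matrix.mulVec_add, Matrix.mulVec_mulVec,
      Matrix.mulVec_mulVec, Matrix.mul_assoc _ _ (of z), Matrix.nonsing_inv_mul _ h,
      Matrix.one_mulVec]
    rfl
  ext i
  rw [wlsResid, wlsResid, h1]
  simp only [Pi.add_apply, mul_add, Finset.sum_add_distrib]
  ring

lemma wlsResid_eq_sub (z : Fin n → Fin d → ℝ) (w x : Fin n → ℝ) (i : Fin n) :
    wlsResid z w x i = x i - wlsFit z w x i := rfl

/-- The ordinary least squares fit is given by a matrix with squared Frobenius norm `d`. -/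
lemma exists_hat_matrix {z : Fin n → Fin d → ℝ} (hz : ((of z)ᵀ * of z).PosDef) :
    ∃ P : Fin n → Fin n → ℝ, ∑ i, ∑ j, P i j ^ 2 = d ∧
      ∀ x i, wlsFit z (fun _ => 1) x i = ∑ j, P i j * x j := by
  set A : Matrix (Fin n) (Fin d) ℝ := of z
  set P : Matrix (Fin n) (Fin n) ℝ := A * (Aᵀ * A)⁻¹ * Aᵀ with hP
  have hu : IsUnit (Aᵀ * A).det := (Matrix.isUnit_iff_isUnit_det _).1 hz.isUnit
  have hsymm : Pᵀ = P := by
    rw [hP, Matrix.transpose_mul, Matrix.transpose_mul, Matrix.transpose_transpose,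
      Matrix.transpose_nonsing_inv, Matrix.transpose_mul, Matrix.transpose_transpose,
      Matrix.mul_assoc]
  have hidem : P * P = P := by
    calc P * P = A * ((Aᵀ * A)⁻¹ * (Aᵀ * A)) * (Aᵀ * A)⁻¹ * Aᵀ := by
          simp only [hP, Matrix.mul_assoc]
      _ = P := by rw [Matrix.nonsing_inv_mul _ hu, Matrix.mul_one]
  refine ⟨P, ?_, fun x i => ?_⟩
  · have htr : (P * Pᵀ).trace = d := by
      rw [hsymm, hidem, hP, Matrix.mul_assoc, Matrix.trace_mul_comm, Matrix.mul_assoc,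
        Matrix.nonsing_inv_mul _ hu]
      simp
    rw [← htr]
    simp [Matrix.trace, Matrix.mul_apply, sq]
  · have h1 : wlsFit z (fun _ => 1) x i = (A *ᵥ wlsCoef z (fun _ => 1) x) i := rfl
    have h2 : diagonal (fun _ : Fin n => (1 : ℝ)) = 1 := Matrix.diagonal_one
    rw [h1, wlsCoef, h2, Matrix.mul_one, Matrix.mulVec_mulVec, Matrix.mulVec_mulVec]
    rfl

/-- Comparison of the rescaled weighted residuals of `e` with `√w₀ e`, for a second system `w₀` of
weights. -/
lemma sum_sq_scaled_resid_sub_le {z : Fin n → Fin d → ℝ} (hz : ((of z)ᵀ * of z).PosDef)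
    {w w₀ : Fin n → ℝ} (hw : ∀ i, 0 < w i) (hw₀ : ∀ i, 0 < w₀ i) {M : ℝ} (hM : 0 < M)
    (hwM : ∀ i, 1 ≤ w i * M) (e : Fin n → ℝ) :
    ∑ i, (√(w i) * wlsResid z w e i - √(w₀ i) * e i) ^ 2 ≤
      6 * ∑ i, (w i - w₀ i) ^ 2 / w i * e i ^ 2 +
        4 * (M * ∑ i, wlsFit z (fun _ => 1) (fun j => w₀ j * e j) i ^ 2) := by
  set f := wlsFit z w e with hf
  set p := wlsFit z (fun _ => 1) (fun j => w₀ j * e j) with hp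
  set D := ∑ i, (w i - w₀ i) ^ 2 / w i * e i ^ 2 with hD
  have h1 : ∑ i, w i * (e i - f i) * f i = 0 :=
    wlsFit_normal_eq (isUnit_det_weighted hz hw) e (wlsCoef z w e)
  have h2 : ∑ i, 1 * (w₀ i * e i - p i) * f i = 0 :=
    wlsFit_normal_eq (isUnit_det_weighted hz fun _ => one_pos) (fun j => w₀ j * e j)
      (wlsCoef z w e)
  have hT : ∑ i, w i * f i ^ 2 ≤ 2 * D + 2 * (M * ∑ i, p i ^ 2) := by
    have h3 : ∑ i, w i * f i ^ 2 = ∑ i, ((w i - w₀ i) * e i * f i + p i * f i) := by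
      rw [← sub_eq_zero, ← Finset.sum_sub_distrib, ← neg_eq_zero, ← Finset.sum_neg_distrib]
      have : ∀ i, -(w i * f i ^ 2 - ((w i - w₀ i) * e i * f i + p i * f i)) =
          w i * (e i - f i) * f i - 1 * (w₀ i * e i - p i) * f i := fun i => by ring
      simp_rw [this, Finset.sum_sub_distrib, h1, h2, sub_zero]
    have h4 : ∀ i, (w i - w₀ i) * e i * f i + p i * f i ≤
        (w i - w₀ i) ^ 2 / w i * e i ^ 2 + M * p i ^ 2 + 1 / 2 * (w i * f i ^ 2) := by
      intro i
      have hwi := hw i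
      have h5 : (w i - w₀ i) * e i * f i ≤
          (w i - w₀ i) ^ 2 / w i * e i ^ 2 + 1 / 4 * (w i * f i ^ 2) := by
        have := sq_nonneg ((w i - w₀ i) / w i * e i - f i / 2)
        have h6 : w i * ((w i - w₀ i) / w i * e i - f i / 2) ^ 2 =
            (w i - w₀ i) ^ 2 / w i * e i ^ 2 + 1 / 4 * (w i * f i ^ 2) -
              (w i - w₀ i) * e i * f i := by
          field_simp; ring
        have := mul_nonneg hwi.le this
        linarith
      have h7 : p i * f i ≤ M * p i ^ 2 + 1 / 4 * (w i * f i ^ 2) := by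
        have h8 : p i * f i ≤ M * p i ^ 2 + 1 / 4 * (f i ^ 2 / M) := by
          have := sq_nonneg (p i - f i / (2 * M))
          have h9 : M * (p i - f i / (2 * M)) ^ 2 =
              M * p i ^ 2 + 1 / 4 * (f i ^ 2 / M) - p i * f i := by
            field_simp; ring
          have := mul_nonneg hM.le this
          linarith
        have h10 : f i ^ 2 / M ≤ w i * f i ^ 2 := by
          rw [div_le_iff₀ hM]
          nlinarith [hwM i, sq_nonneg (f i)]
        linarith
      linarith
    have h5 := Finset.sum_le_sum fun i (_ : i ∈ Finset.univ) => h4 i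
    rw [← h3, Finset.sum_add_distrib, Finset.sum_add_distrib, ← Finset.mul_sum,
      ← Finset.mul_sum] at h5
    linarith
  have h6 : ∀ i, (√(w i) * wlsResid z w e i - √(w₀ i) * e i) ^ 2 ≤
      2 * ((w i - w₀ i) ^ 2 / w i * e i ^ 2) + 2 * (w i * f i ^ 2) := by
    intro i
    rw [wlsResid_eq_sub, ← hf]
    have hs : √(w i) ^ 2 = w i := Real.sq_sqrt (hw i).le
    have hs₀ : √(w₀ i) ^ 2 = w₀ i := Real.sq_sqrt (hw₀ i).le
    have h7 : (√(w i) - √(w₀ i)) ^ 2 ≤ (w i - w₀ i) ^ 2 / w i := by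
      rw [le_div_iff₀ (hw i)]
      calc (√(w i) - √(w₀ i)) ^ 2 * w i = (√(w i) - √(w₀ i)) ^ 2 * √(w i) ^ 2 := by rw [hs]
        _ ≤ (√(w i) - √(w₀ i)) ^ 2 * (√(w i) + √(w₀ i)) ^ 2 := by
            gcongr
            linarith [Real.sqrt_nonneg (w₀ i)]
        _ = (√(w i) ^ 2 - √(w₀ i) ^ 2) ^ 2 := by ring
        _ = _ := by rw [hs, hs₀]
    have h8 : (√(w i) * (e i - f i) - √(w₀ i) * e i) ^ 2 ≤
        2 * ((√(w i) - √(w₀ i)) ^ 2 * e i ^ 2) + 2 * (√(w i) ^ 2 * f i ^ 2) := by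
      nlinarith [sq_nonneg ((√(w i) - √(w₀ i)) * e i + √(w i) * f i)]
    rw [hs] at h8
    nlinarith [mul_le_mul_of_nonneg_right h7 (sq_nonneg (e i))]
  have h9 := Finset.sum_le_sum fun i (_ : i ∈ Finset.univ) => h6 i
  rw [Finset.sum_add_distrib, ← Finset.mul_sum, ← Finset.mul_sum, ← hD] at h9
  linarith

/-! ### Measurability -/

lemma measurable_inv_matrix_apply {α : Type*} [MeasurableSpace α] {A : α → Matrix (Fin d) (Fin d) ℝ}
    (hA : ∀ k l, Measurable fun x => A x k l) (k l : Fin d) :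
    Measurable fun x => (A x)⁻¹ k l := by
  have hdet : ∀ B : α → Matrix (Fin d) (Fin d) ℝ, (∀ k l, Measurable fun x => B x k l) →
      Measurable fun x => (B x).det := by
    intro B hB
    simp only [Matrix.det_apply']
    fun_prop
  simp only [Matrix.inv_def, Matrix.smul_apply, Ring.inverse_eq_inv', Matrix.adjugate_apply,
    smul_eq_mul]
  refine (hdet A hA).inv.mul (hdet _ fun i j => ?_)
  simp only [Matrix.updateRow_apply]
  split_ifs
  · exact measurable_const
  · exact hA i j

lemma measurable_wlsCoef {α : Type*} [MeasurableSpace α] {z : α → Fin n → Fin d → ℝ}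
    (hz : Measurable z) {w x : α → Fin n → ℝ} (hw : ∀ i, Measurable fun a => w a i)
    (hx : ∀ i, Measurable fun a => x a i) (k : Fin d) :
    Measurable fun a => wlsCoef (z a) (w a) (x a) k := by
  have hz' : ∀ i k, Measurable fun a => z a i k := fun i k => by fun_prop
  simp only [wlsCoef, Matrix.mulVec, dotProduct, Matrix.mul_diagonal]
  refine Finset.measurable_sum _ fun l _ => Measurable.mul ?_ ?_
  · refine measurable_inv_matrix_apply (fun k l => ?_) k l
    simp only [Matrix.mul_apply, Matrix.transpose_apply, of_apply]
    fun_prop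
  · simp only [Matrix.transpose_apply, of_apply]
    fun_prop

lemma measurable_wlsFit {α : Type*} [MeasurableSpace α] {z : α → Fin n → Fin d → ℝ}
    (hz : Measurable z) {w x : α → Fin n → ℝ} (hw : ∀ i, Measurable fun a => w a i)
    (hx : ∀ i, Measurable fun a => x a i) (i : Fin n) :
    Measurable fun a => wlsFit (z a) (w a) (x a) i := by
  have hz' : ∀ i k, Measurable fun a => z a i k := fun i k => by fun_prop
  exact Finset.measurable_sum _ fun k _ => (hz' i k).mul (measurable_wlsCoef hz hw hx k)

lemma measurable_wlsResid {α : Type*} [MeasurableSpace α] {z : α → Fin n → Fin d → ℝ}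
    (hz : Measurable z) {w x : α → Fin n → ℝ} (hw : ∀ i, Measurable fun a => w a i)
    (hx : ∀ i, Measurable fun a => x a i) (i : Fin n) :
    Measurable fun a => wlsResid (z a) (w a) (x a) i :=
  (hx i).sub (measurable_wlsFit hz hw hx i)

lemma measurable_scaledResid {α : Type*} [MeasurableSpace α] {z : α → Fin n → Fin d → ℝ}
    (hz : Measurable z) {x : α → Fin n → ℝ} (hx : ∀ i, Measurable fun a => x a i)
    (E : Expert d) (lam : ℕ) (i : Fin n) :
    Measurable fun a => scaledResid E lam (z a) (x a) i := by
  have hols : ∀ j, Measurable fun a => olsResid (z a) (x a) j :=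
    measurable_wlsResid hz (fun _ => measurable_const) hx
  have hw : ∀ j, Measurable fun a => weight E lam (z a) (x a) j := fun j =>
    ((measurable_sum_window E lam hz (fun l => (hols l).pow_const 2) j).const_mul _).inv
  have hR : Measurable fun a => √(weight E lam (z a) (x a) i) *
      wlsResid (z a) (weight E lam (z a) (x a)) (x a) i :=
    (hw i).sqrt.mul (measurable_wlsResid hz hw hx i)
  cases E with
  | homoskedastic => exact hols i
  | samplingIndex => exact hR
  | predictor m => exact hR

end WLS

/-! ### Smoothing the squared errors -/

section Oracle

lemma orthogonalCoords_mul_even {n : ℕ} {φ : (Fin n → ℝ) → Fin n → ℝ}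
    (hφ : ∀ i, Measurable fun g => φ g i)
    (heven : ∀ g i j, φ (fun k => if k = i then -g k else g k) j = φ g j) {K : ℝ} (hK0 : 0 ≤ K)
    (hK : ∀ i, ∫⁻ g, ENNReal.ofReal ((g i * φ g i) ^ 2) ∂stdNormal (Fin n) ≤ ENNReal.ofReal K) :
    OrthogonalCoords (stdNormal (Fin n)) K fun g i => g i * φ g i := by
  have hm : ∀ i, Measurable fun g : Fin n → ℝ => g i * φ g i := fun i => by fun_prop
  refine ⟨fun i => ?_, fun i j hij => ?_, fun i => ?_⟩
  · rw [memLp_two_iff_integrable_sq (hm i).aestronglyMeasurable]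
    refine ⟨((hm i).pow_const 2).aestronglyMeasurable, ?_⟩
    rw [hasFiniteIntegral_iff_ofReal (ae_of_all _ fun _ => sq_nonneg _)]
    exact (hK i).trans_lt ENNReal.ofReal_lt_top
  · refine integral_eq_zero_of_odd i ((hm i).mul (hm j)) fun g => ?_
    simp only [heven, if_true, if_neg hij.symm]
    ring
  · rw [integral_eq_lintegral_of_nonneg_ae (ae_of_all _ fun _ => sq_nonneg _)
      ((hm i).pow_const 2).aestronglyMeasurable]
    exact ENNReal.toReal_le_of_le_ofReal hK0 (hK i)

lemma orthogonalCoords_id (n : ℕ) :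
    OrthogonalCoords (stdNormal (Fin n)) (normalMoment 2) fun g i => g i := by
  have h := orthogonalCoords_mul_even (n := n) (φ := fun _ _ => 1) (fun _ => measurable_const)
    (fun _ _ _ => rfl) (normalMoment_nonneg 2) (fun i => by
      have := lintegral_abs_pow_stdNormal 2 i
      simp only [sq_abs] at this
      simp only [mul_one, this, le_refl])
  simpa using h

lemma integrable_sq_stdNormal {ι : Type*} [Fintype ι] (i : ι) :
    Integrable (fun g => g i ^ 2) (stdNormal ι) := integrable_pow_stdNormal 2 i

lemma orthogonalCoords_sq_sub_one (n : ℕ) :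
    OrthogonalCoords (stdNormal (Fin n)) (2 * normalMoment 4 + 2) fun g i => g i ^ 2 - 1 := by
  have hint : ∀ i, Integrable (fun g : Fin n → ℝ => (g i ^ 2 - 1) ^ 2) (stdNormal (Fin n)) := by
    intro i
    have h := ((integrable_pow_stdNormal 4 i).sub ((integrable_sq_stdNormal i).const_mul 2)).add
      (integrable_const (1 : ℝ))
    refine h.congr (ae_of_all _ fun g => ?_)
    simp only [Pi.add_apply, Pi.sub_apply]
    ring
  refine ⟨fun i => ?_, fun i j hij => ?_, fun i => ?_⟩
  · rw [memLp_two_iff_integrable_sq (Measurable.aestronglyMeasurable (by fun_prop))]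
    exact hint i
  · have hind := (iIndepFun_pi (μ := fun _ : Fin n => gaussianReal 0 1)
      (X := fun _ x => x ^ 2 - 1) (fun _ => by fun_prop)).indepFun hij
    rw [hind.integral_fun_mul_eq_mul_integral (Measurable.aestronglyMeasurable (by fun_prop))
      (Measurable.aestronglyMeasurable (by fun_prop)),
      integral_sub (integrable_sq_stdNormal i) (integrable_const _), integral_sq_stdNormal]
    simp
  · calc ∫ g, (g i ^ 2 - 1) ^ 2 ∂stdNormal (Fin n)
        ≤ ∫ g, (2 * |g i| ^ 4 + 2) ∂stdNormal (Fin n) := by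
          have h4 : Integrable (fun g : Fin n → ℝ => |g i| ^ 4) (stdNormal (Fin n)) := by
            simpa using (integrable_pow_stdNormal 4 i).abs
          refine integral_mono (hint i) ((h4.const_mul 2).add (integrable_const _)) fun g => ?_
          have : |g i| ^ 4 = (g i ^ 2) ^ 2 := by
            rw [show 4 = 2 * 2 from rfl, pow_mul, sq_abs]
          simp only [this]
          nlinarith [sq_nonneg (g i ^ 2 + 1)]
      _ = 2 * normalMoment 4 + 2 := by
          have h4 : Integrable (fun g : Fin n → ℝ => |g i| ^ 4) (stdNormal (Fin n)) := by
            simpa using (integrable_pow_stdNormal 4 i).abs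
          rw [integral_add (h4.const_mul 2) (integrable_const _), integral_const_mul,
            integral_eq_lintegral_of_nonneg_ae (ae_of_all _ fun _ => by positivity)
              h4.aestronglyMeasurable, lintegral_abs_pow_stdNormal,
            ENNReal.toReal_ofReal (normalMoment_nonneg 4)]
          simp

variable {n d : ℕ}

/-- The smoothed squared errors `τ g`. -/
def smoothVar (E : Expert d) (lam : ℕ) (z : Fin n → Fin d → ℝ) (τ g : Fin n → ℝ) (i : Fin n) : ℝ :=
  (lam : ℝ)⁻¹ * ∑ j ∈ window E lam z i, (τ j * g j) ^ 2

lemma smoothVar_nonneg (E : Expert d) (lam : ℕ) (z : Fin n → Fin d → ℝ) (τ g : Fin n → ℝ)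
    (i : Fin n) : 0 ≤ smoothVar E lam z τ g i :=
  mul_nonneg (by positivity) (Finset.sum_nonneg fun _ _ => sq_nonneg _)

lemma smoothVar_flip (E : Expert d) (lam : ℕ) (z : Fin n → Fin d → ℝ) (τ g : Fin n → ℝ)
    (i j : Fin n) : smoothVar E lam z τ (fun k => if k = i then -g k else g k) j =
      smoothVar E lam z τ g j := by
  simp only [smoothVar]
  congr 1
  refine Finset.sum_congr rfl fun k _ => ?_
  split_ifs <;> ring

lemma measurable_smoothVar (E : Expert d) (lam : ℕ) (z : Fin n → Fin d → ℝ) (τ : Fin n → ℝ)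
    (i : Fin n) : Measurable fun g => smoothVar E lam z τ g i := by
  unfold smoothVar
  fun_prop

lemma exists_lintegral_inv_smoothVar_le (d p : ℕ) {c : ℝ} (hc : 0 < c) :
    ∃ K : ℝ, 0 ≤ K ∧ ∃ L : ℕ, ∀ lam : ℕ, L ≤ lam → ∀ n : ℕ, lam < n → ∀ (E : Expert d)
      (z : Fin n → Fin d → ℝ) (τ : Fin n → ℝ), (∀ j, c ≤ τ j ^ 2) → ∀ i,
      ∫⁻ g, ENNReal.ofReal ((smoothVar E lam z τ g i)⁻¹ ^ p) ∂stdNormal (Fin n) ≤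
        ENNReal.ofReal K := by
  obtain ⟨K, hK0, L, h⟩ := exists_lintegral_inv_window_le d p hc
  refine ⟨K, hK0, L, fun lam hlam n hn E z τ hτ i => ?_⟩
  have := h lam hlam n z (window E lam z i) (le_two_mul_card_window E lam z hn i) τ hτ
    (fun _ _ => 0)
  simpa [smoothVar] using this

/-- The mean distance between the variances and their moving averages. -/
def meanBias (E : Expert d) (lam : ℕ) (z : Fin n → Fin d → ℝ) (τ : Fin n → ℝ) : ℝ :=
  (n : ℝ)⁻¹ * ∑ i, |(lam : ℝ)⁻¹ * ∑ j ∈ window E lam z i, τ j ^ 2 - τ i ^ 2|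

lemma lintegral_smoothVar_sub_sq_le {lam : ℕ} (hlam : 0 < lam) (E : Expert d)
    (z : Fin n → Fin d → ℝ) {τ : Fin n → ℝ} {C : ℝ} (hC : 0 < C) (hτ : ∀ j, τ j ^ 2 ≤ C) :
    ∫⁻ g, ENNReal.ofReal ((n : ℝ)⁻¹ * ∑ i, (smoothVar E lam z τ g i - τ i ^ 2) ^ 2)
        ∂stdNormal (Fin n) ≤
      ENNReal.ofReal ((8 * C ^ 2 * (normalMoment 4 + 1) + 6 * C) *
        ((lam : ℝ)⁻¹ + meanBias E lam z τ)) := by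
  have hlam' : (0 : ℝ) < lam := by exact_mod_cast hlam
  have hlam1 : (1 : ℝ) ≤ lam := by exact_mod_cast hlam
  set M := normalMoment 4 with hM
  have hM0 : 0 ≤ M := normalMoment_nonneg 4
  set a : Fin n → Fin n → ℝ := fun i j =>
    if j ∈ window E lam z i then (lam : ℝ)⁻¹ * τ j ^ 2 else 0 with ha
  set b : Fin n → ℝ := fun i => (lam : ℝ)⁻¹ * ∑ j ∈ window E lam z i, τ j ^ 2 - τ i ^ 2 with hb
  have hcard : ∀ i, ((window E lam z i).card : ℝ) ≤ 2 * lam := by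
    intro i
    have : ((window E lam z i).card : ℝ) ≤ lam + 1 := by exact_mod_cast card_window_le E lam z i
    linarith
  have hdec : ∀ g i, smoothVar E lam z τ g i - τ i ^ 2 = ∑ j, a i j * (g j ^ 2 - 1) + b i := by
    intro g i
    have : ∑ j, a i j * (g j ^ 2 - 1) =
        ∑ j ∈ window E lam z i, (lam : ℝ)⁻¹ * τ j ^ 2 * (g j ^ 2 - 1) := by
      simp [ha, ite_mul, Finset.sum_ite_mem]
    simp only [hb]
    rw [this, smoothVar, Finset.mul_sum, Finset.mul_sum, ← add_sub_assoc,
      ← Finset.sum_add_distrib]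
    congr 1
    refine Finset.sum_congr rfl fun j _ => ?_
    ring
  have hasq : ∀ i, ∑ j, a i j ^ 2 ≤ 2 * C ^ 2 * (lam : ℝ)⁻¹ := by
    intro i
    have h1 : ∑ j, a i j ^ 2 = ∑ j ∈ window E lam z i, ((lam : ℝ)⁻¹ * τ j ^ 2) ^ 2 := by
      simp [ha, ite_pow, Finset.sum_ite_mem]
    rw [h1]
    calc ∑ j ∈ window E lam z i, ((lam : ℝ)⁻¹ * τ j ^ 2) ^ 2
        ≤ ∑ _j ∈ window E lam z i, ((lam : ℝ)⁻¹ * C) ^ 2 :=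
          Finset.sum_le_sum fun j _ => by
            have := hτ j
            gcongr
      _ = (window E lam z i).card * ((lam : ℝ)⁻¹ * C) ^ 2 := by
          rw [Finset.sum_const, nsmul_eq_mul]
      _ ≤ (2 * lam) * ((lam : ℝ)⁻¹ * C) ^ 2 :=
          mul_le_mul_of_nonneg_right (hcard i) (sq_nonneg _)
      _ = _ := by field_simp
  have hbabs : ∀ i, |b i| ≤ 3 * C := by
    intro i
    have h1 : (lam : ℝ)⁻¹ * ∑ j ∈ window E lam z i, τ j ^ 2 ≤ 2 * C := by
      rw [inv_mul_le_iff₀ hlam']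
      calc ∑ j ∈ window E lam z i, τ j ^ 2 ≤ ∑ _j ∈ window E lam z i, C :=
            Finset.sum_le_sum fun j _ => hτ j
        _ = (window E lam z i).card * C := by rw [Finset.sum_const, nsmul_eq_mul]
        _ ≤ (2 * lam) * C := mul_le_mul_of_nonneg_right (hcard i) hC.le
        _ = _ := by ring
    have h0 : 0 ≤ (lam : ℝ)⁻¹ * ∑ j ∈ window E lam z i, τ j ^ 2 :=
      mul_nonneg (by positivity) (Finset.sum_nonneg fun _ _ => sq_nonneg _)
    rw [abs_le]
    constructor <;> simp only [hb] <;> linarith [hτ i, sq_nonneg (τ i)]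
  have hpt : ∀ g, ENNReal.ofReal ((n : ℝ)⁻¹ * ∑ i, (smoothVar E lam z τ g i - τ i ^ 2) ^ 2) ≤
      ENNReal.ofReal (2 * (n : ℝ)⁻¹) * ∑ i, ENNReal.ofReal ((∑ j, a i j * (g j ^ 2 - 1)) ^ 2) +
        ENNReal.ofReal (6 * C * meanBias E lam z τ) := by
    intro g
    have hmb : 0 ≤ meanBias E lam z τ :=
      mul_nonneg (by positivity) (Finset.sum_nonneg fun _ _ => abs_nonneg _)
    rw [← ENNReal.ofReal_sum_of_nonneg fun _ _ => sq_nonneg _,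
      ← ENNReal.ofReal_mul (by positivity), ← ENNReal.ofReal_add ?_ (by positivity)]
    · refine ENNReal.ofReal_le_ofReal ?_
      have h1 : ∀ i, (smoothVar E lam z τ g i - τ i ^ 2) ^ 2 ≤
          2 * (∑ j, a i j * (g j ^ 2 - 1)) ^ 2 + 6 * C * |b i| := by
        intro i
        rw [hdec]
        have h2 : b i ^ 2 ≤ 3 * C * |b i| := by
          rw [← sq_abs, sq]
          exact mul_le_mul_of_nonneg_right (hbabs i) (abs_nonneg _)
        nlinarith [sq_nonneg (∑ j, a i j * (g j ^ 2 - 1) - b i)]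
      have h2 := Finset.sum_le_sum fun i (_ : i ∈ Finset.univ) => h1 i
      rw [Finset.sum_add_distrib, ← Finset.mul_sum, ← Finset.mul_sum] at h2
      have h3 := mul_le_mul_of_nonneg_left h2 (show (0 : ℝ) ≤ (n : ℝ)⁻¹ by positivity)
      refine h3.trans (le_of_eq ?_)
      simp only [meanBias, hb]
      ring
    · exact mul_nonneg (by positivity) (Finset.sum_nonneg fun _ _ => sq_nonneg _)
  refine (lintegral_mono hpt).trans ?_
  rw [lintegral_add_right _ measurable_const, lintegral_const, measure_univ, mul_one,
    lintegral_const_mul _ (by fun_prop), lintegral_finsetSum _ (fun i _ => by fun_prop)]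
  have hone : ∀ i, ∫⁻ g, ENNReal.ofReal ((∑ j, a i j * (g j ^ 2 - 1)) ^ 2) ∂stdNormal (Fin n) ≤
      ENNReal.ofReal ((2 * M + 2) * (2 * C ^ 2 * (lam : ℝ)⁻¹)) := fun i =>
    ((orthogonalCoords_sq_sub_one n).lintegral_sq_le (a i)).trans
      (ENNReal.ofReal_le_ofReal (mul_le_mul_of_nonneg_left (hasq i) (by positivity)))
  have hmb : 0 ≤ meanBias E lam z τ :=
    mul_nonneg (by positivity) (Finset.sum_nonneg fun _ _ => abs_nonneg _)
  have hsum : ENNReal.ofReal (2 * (n : ℝ)⁻¹) * ∑ i,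
      ∫⁻ g, ENNReal.ofReal ((∑ j, a i j * (g j ^ 2 - 1)) ^ 2) ∂stdNormal (Fin n) ≤
      ENNReal.ofReal (8 * C ^ 2 * (M + 1) * (lam : ℝ)⁻¹) := by
    refine (mul_le_mul_right (Finset.sum_le_sum fun i _ => hone i) _).trans ?_
    rw [Finset.sum_const, Finset.card_univ, Fintype.card_fin, nsmul_eq_mul,
      ← ENNReal.ofReal_natCast, ← ENNReal.ofReal_mul (by positivity),
      ← ENNReal.ofReal_mul (by positivity)]
    refine ENNReal.ofReal_le_ofReal ?_
    rcases Nat.eq_zero_or_pos n with rfl | hn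
    · simp; positivity
    · have : (0 : ℝ) < n := by exact_mod_cast hn
      refine le_of_eq ?_
      field_simp
      ring
  refine (add_le_add hsum le_rfl).trans ?_
  rw [← ENNReal.ofReal_add (by positivity) (by positivity)]
  refine ENNReal.ofReal_le_ofReal ?_
  have h1 : 0 ≤ C ^ 2 * (M + 1) * meanBias E lam z τ := by positivity
  have h2 : 0 ≤ C * (lam : ℝ)⁻¹ := by positivity
  nlinarith

lemma exists_orthogonalCoords_standardized (d : ℕ) {c C : ℝ} (hc : 0 < c) (hcC : c ≤ C) :
    ∃ K : ℝ, 0 ≤ K ∧ ∃ L : ℕ, ∀ lam : ℕ, L ≤ lam → ∀ n : ℕ, lam < n → ∀ (E : Expert d)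
      (z : Fin n → Fin d → ℝ) (τ : Fin n → ℝ), (∀ j, c ≤ τ j ^ 2) → (∀ j, τ j ^ 2 ≤ C) →
      OrthogonalCoords (stdNormal (Fin n)) K
        (fun g i => √((smoothVar E lam z τ g i)⁻¹) * (τ i * g i)) ∧
      OrthogonalCoords (stdNormal (Fin n)) K
        (fun g i => (smoothVar E lam z τ g i)⁻¹ * (τ i * g i)) := by
  obtain ⟨K₂, hK₂, L₂, h₂⟩ := exists_lintegral_inv_smoothVar_le d 2 hc
  obtain ⟨K₄, hK₄, L₄, h₄⟩ := exists_lintegral_inv_smoothVar_le d 4 hc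
  set M := normalMoment 4 with hM
  have hM0 : 0 ≤ M := normalMoment_nonneg 4
  have hC : 0 < C := hc.trans_le hcC
  refine ⟨C * (M + K₂ + K₄), by positivity, max L₂ L₄, fun lam hlam n hn E z τ hτ hτC => ?_⟩
  have hg4 : ∀ i, ∫⁻ g, ENNReal.ofReal (|g i| ^ 4) ∂stdNormal (Fin n) = ENNReal.ofReal M :=
    fun i => lintegral_abs_pow_stdNormal 4 i
  have hp4 : ∀ x : ℝ, |x| ^ 4 = (x ^ 2) ^ 2 := fun x => by
    rw [show 4 = 2 * 2 from rfl, pow_mul, sq_abs]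
  have key : ∀ (i : Fin n) (p : ℕ) (F : (Fin n → ℝ) → ℝ) (K' : ℝ), 0 ≤ K' → K' ≤ K₂ + K₄ →
      (∀ g, F g ^ 2 ≤ C * g i ^ 2 * ((smoothVar E lam z τ g i)⁻¹ ^ p)) →
      ∫⁻ g, ENNReal.ofReal ((smoothVar E lam z τ g i)⁻¹ ^ (2 * p)) ∂stdNormal (Fin n) ≤
        ENNReal.ofReal K' →
      ∫⁻ g, ENNReal.ofReal (F g ^ 2) ∂stdNormal (Fin n) ≤
        ENNReal.ofReal (C * (M + K₂ + K₄)) := by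
    intro i p F K' hK' hKK hF hp
    have hpt : ∀ g, ENNReal.ofReal (F g ^ 2) ≤ ENNReal.ofReal C * ENNReal.ofReal (|g i| ^ 4) +
        ENNReal.ofReal C * ENNReal.ofReal ((smoothVar E lam z τ g i)⁻¹ ^ (2 * p)) := by
      intro g
      have hs : 0 ≤ (smoothVar E lam z τ g i)⁻¹ := inv_nonneg.2 (smoothVar_nonneg _ _ _ _ _ _)
      rw [← ENNReal.ofReal_mul hC.le, ← ENNReal.ofReal_mul hC.le,
        ← ENNReal.ofReal_add (by positivity) (by positivity)]
      refine ENNReal.ofReal_le_ofReal ((hF g).trans ?_)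
      rw [hp4, mul_comm 2 p, pow_mul, mul_assoc, ← mul_add]
      refine mul_le_mul_of_nonneg_left ?_ hC.le
      nlinarith [sq_nonneg (g i ^ 2 - (smoothVar E lam z τ g i)⁻¹ ^ p), sq_nonneg (g i ^ 2),
        sq_nonneg ((smoothVar E lam z τ g i)⁻¹ ^ p)]
    have hms := measurable_smoothVar E lam z τ i
    refine (lintegral_mono hpt).trans ?_
    rw [lintegral_add_left (by fun_prop), lintegral_const_mul _ (by fun_prop),
      lintegral_const_mul _ (by fun_prop), hg4]
    refine (add_le_add le_rfl (mul_le_mul_right hp _)).trans ?_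
    rw [← ENNReal.ofReal_mul hC.le, ← ENNReal.ofReal_mul hC.le,
      ← ENNReal.ofReal_add (by positivity) (by positivity), ← mul_add]
    exact ENNReal.ofReal_le_ofReal (mul_le_mul_of_nonneg_left (by linarith) hC.le)
  have hL₂ := le_of_max_le_left hlam
  have hL₄ := le_of_max_le_right hlam
  have hms := measurable_smoothVar E lam z τ
  constructor
  · have h := orthogonalCoords_mul_even (n := n)
      (φ := fun g i => √((smoothVar E lam z τ g i)⁻¹) * τ i) (by fun_prop)
      (fun g i j => by simp only [smoothVar_flip]) (K := C * (M + K₂ + K₄)) (by positivity)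
      (fun i => key i 1 _ K₂ hK₂ (by linarith) (fun g => by
        have hs : 0 ≤ (smoothVar E lam z τ g i)⁻¹ := inv_nonneg.2 (smoothVar_nonneg _ _ _ _ _ _)
        rw [mul_pow, mul_pow, Real.sq_sqrt hs, pow_one]
        have := mul_le_mul_of_nonneg_right (hτC i) (show 0 ≤ g i ^ 2 *
          (smoothVar E lam z τ g i)⁻¹ by positivity)
        linarith) (h₂ lam hL₂ n hn E z τ hτ i))
    convert h using 3
    ring
  · have h := orthogonalCoords_mul_even (n := n)
      (φ := fun g i => (smoothVar E lam z τ g i)⁻¹ * τ i) (by fun_prop)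
      (fun g i j => by simp only [smoothVar_flip]) (K := C * (M + K₂ + K₄)) (by positivity)
      (fun i => key i 2 _ K₄ hK₄ (by linarith) (fun g => by
        have hs : 0 ≤ (smoothVar E lam z τ g i)⁻¹ := inv_nonneg.2 (smoothVar_nonneg _ _ _ _ _ _)
        rw [mul_pow, mul_pow]
        have := mul_le_mul_of_nonneg_right (hτC i) (show 0 ≤ g i ^ 2 *
          (smoothVar E lam z τ g i)⁻¹ ^ 2 by positivity)
        linarith) (h₄ lam hL₄ n hn E z τ hτ i))
    convert h using 3
    ring

lemma sq_standardized_sub_le {t s x : ℝ} (ht : 0 ≤ t) (hs : 0 < s) :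
    (√(s⁻¹) * (t * x) - x) ^ 2 ≤ x ^ 2 * s⁻¹ * |s - t ^ 2| := by
  have h1 : √(s⁻¹) * (t * x) - x = x * √(s⁻¹) * (t - √s) := by
    have : √(s⁻¹) * √s = 1 := by
      rw [← Real.sqrt_mul (by positivity), inv_mul_cancel₀ hs.ne', Real.sqrt_one]
    linear_combination x * this
  rw [h1, mul_pow, mul_pow, Real.sq_sqrt (by positivity)]
  refine mul_le_mul_of_nonneg_left ?_ (by positivity)
  have h2 : s - t ^ 2 = (√s - t) * (√s + t) := by
    nth_rewrite 1 [← Real.sq_sqrt hs.le]; ring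
  have hsq := Real.sqrt_nonneg s
  rw [h2, abs_mul, abs_of_nonneg (by positivity : 0 ≤ √s + t), ← sq_abs, abs_sub_comm, sq]
  refine mul_le_mul_of_nonneg_left ?_ (abs_nonneg _)
  rw [abs_le]; constructor <;> linarith

lemma exists_lintegral_standardized_sub_sq_le (d : ℕ) {c C : ℝ} (hc : 0 < c) (hcC : c ≤ C) :
    ∃ K : ℝ, 0 ≤ K ∧ ∃ L : ℕ, ∀ lam : ℕ, L ≤ lam → ∀ n : ℕ, lam < n → ∀ (E : Expert d)
      (z : Fin n → Fin d → ℝ) (τ : Fin n → ℝ), (∀ j, 0 ≤ τ j) → (∀ j, c ≤ τ j ^ 2) →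
      (∀ j, τ j ^ 2 ≤ C) →
      ∫⁻ g, ENNReal.ofReal ((n : ℝ)⁻¹ *
          ∑ i, (√((smoothVar E lam z τ g i)⁻¹) * (τ i * g i) - g i) ^ 2) ∂stdNormal (Fin n) ≤
        ENNReal.ofReal (K * √((lam : ℝ)⁻¹ + meanBias E lam z τ)) := by
  obtain ⟨K₄, hK₄, L₄, h₄⟩ := exists_lintegral_inv_smoothVar_le d 4 hc
  set M := normalMoment 8 with hM
  have hM0 : 0 ≤ M := normalMoment_nonneg 8
  have hC : 0 < C := hc.trans_le hcC
  have hM4 := normalMoment_nonneg 4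
  set A := 8 * C ^ 2 * (normalMoment 4 + 1) + 6 * C with hA
  have hA0 : 0 ≤ A := by positivity
  refine ⟨M + K₄ + A, by positivity, max L₄ (2 * (d + 1)),
    fun lam hlam n hn E z τ hτ0 hτ hτC => ?_⟩
  have hL₄ := le_of_max_le_left hlam
  have hlamd := le_of_max_le_right hlam
  have hlam0 : 0 < lam := by omega
  have hn0 : (0 : ℝ) < n := by
    have : 0 < n := by omega
    exact_mod_cast this
  have hmb : 0 ≤ meanBias E lam z τ :=
    mul_nonneg (by positivity) (Finset.sum_nonneg fun _ _ => abs_nonneg _)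
  set η := (lam : ℝ)⁻¹ + meanBias E lam z τ with hη
  have hη0 : 0 < η := by
    have : (0 : ℝ) < (lam : ℝ)⁻¹ := by
      have : (0 : ℝ) < lam := by exact_mod_cast hlam0
      positivity
    linarith
  set t := √η with ht
  have ht0 : 0 < t := Real.sqrt_pos.2 hη0
  have hpos : ∀ᵐ g ∂stdNormal (Fin n), ∀ i, 0 < smoothVar E lam z τ g i := by
    rw [ae_all_iff]
    intro i
    have hcard := le_two_mul_card_window E lam z hn i
    filter_upwards [ae_sum_sq_pos (S := window E lam z i) (by omega) z hc hτ] with g hg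
    have := hg 0
    simp only [Pi.zero_apply, mul_zero, Finset.sum_const_zero, sub_zero] at this
    exact mul_pos (by have : (0 : ℝ) < lam := by exact_mod_cast hlam0
                      positivity) this
  have hpt : ∀ᵐ g ∂stdNormal (Fin n), ENNReal.ofReal ((n : ℝ)⁻¹ *
        ∑ i, (√((smoothVar E lam z τ g i)⁻¹) * (τ i * g i) - g i) ^ 2) ≤
      ENNReal.ofReal (t * (n : ℝ)⁻¹) * ∑ i, (ENNReal.ofReal (|g i| ^ 8) +
        ENNReal.ofReal ((smoothVar E lam z τ g i)⁻¹ ^ 4)) +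
      ENNReal.ofReal t⁻¹ * ENNReal.ofReal ((n : ℝ)⁻¹ *
        ∑ i, (smoothVar E lam z τ g i - τ i ^ 2) ^ 2) := by
    filter_upwards [hpos] with g hg
    have h1 : ∀ i, (√((smoothVar E lam z τ g i)⁻¹) * (τ i * g i) - g i) ^ 2 ≤
        t * (|g i| ^ 8 + (smoothVar E lam z τ g i)⁻¹ ^ 4) +
          t⁻¹ * (smoothVar E lam z τ g i - τ i ^ 2) ^ 2 := by
      intro i
      refine (sq_standardized_sub_le (hτ0 i) (hg i)).trans ?_
      set s := smoothVar E lam z τ g i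
      have h8 : |g i| ^ 8 = (g i ^ 2) ^ 4 := by
        rw [show 8 = 2 * 4 from rfl, pow_mul, sq_abs]
      have h2 : (g i ^ 2 * s⁻¹) ^ 2 ≤ |g i| ^ 8 + s⁻¹ ^ 4 := by
        rw [h8]
        nlinarith [sq_nonneg ((g i ^ 2) ^ 2 - s⁻¹ ^ 2), sq_nonneg ((g i ^ 2) ^ 2),
          sq_nonneg (s⁻¹ ^ 2)]
      have h3 : g i ^ 2 * s⁻¹ * |s - τ i ^ 2| ≤
          t * (g i ^ 2 * s⁻¹) ^ 2 + t⁻¹ * (s - τ i ^ 2) ^ 2 := by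
        rw [← sq_abs (s - τ i ^ 2)]
        set x := g i ^ 2 * s⁻¹
        set y := |s - τ i ^ 2|
        have h4 : t * (x - t⁻¹ * y / 2) ^ 2 = t * x ^ 2 + t⁻¹ * y ^ 2 / 4 - x * y := by
          field_simp
          ring
        have h5 : 0 ≤ t * (x - t⁻¹ * y / 2) ^ 2 := by positivity
        have h6 : 0 ≤ t⁻¹ * y ^ 2 := by positivity
        linarith
      have := mul_le_mul_of_nonneg_left h2 ht0.le
      linarith
    have hs : ∀ i, 0 ≤ (smoothVar E lam z τ g i)⁻¹ := fun i => (inv_pos.2 (hg i)).le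
    have h2 := Finset.sum_le_sum fun i (_ : i ∈ Finset.univ) => h1 i
    rw [Finset.sum_add_distrib, ← Finset.mul_sum, ← Finset.mul_sum] at h2
    have h3 := mul_le_mul_of_nonneg_left h2 (show (0 : ℝ) ≤ (n : ℝ)⁻¹ by positivity)
    have h5 : 0 ≤ ∑ i, (smoothVar E lam z τ g i - τ i ^ 2) ^ 2 :=
      Finset.sum_nonneg fun _ _ => sq_nonneg _
    have h6 : 0 ≤ ∑ i, (|g i| ^ 8 + (smoothVar E lam z τ g i)⁻¹ ^ 4) :=
      Finset.sum_nonneg fun i _ => by have := hs i; positivity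
    have h7 : ∑ i, (ENNReal.ofReal (|g i| ^ 8) +
        ENNReal.ofReal ((smoothVar E lam z τ g i)⁻¹ ^ 4)) =
        ENNReal.ofReal (∑ i, (|g i| ^ 8 + (smoothVar E lam z τ g i)⁻¹ ^ 4)) := by
      rw [ENNReal.ofReal_sum_of_nonneg fun i _ => by have := hs i; positivity]
      exact Finset.sum_congr rfl fun i _ =>
        (ENNReal.ofReal_add (by positivity) (by have := hs i; positivity)).symm
    rw [h7, ← ENNReal.ofReal_mul (by positivity), ← ENNReal.ofReal_mul (by positivity),
      ← ENNReal.ofReal_add (by positivity) (by positivity)]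
    refine ENNReal.ofReal_le_ofReal (h3.trans (le_of_eq ?_))
    ring
  have hms := measurable_smoothVar E lam z τ
  refine (lintegral_mono_ae hpt).trans ?_
  rw [lintegral_add_left (by fun_prop), lintegral_const_mul _ (by fun_prop),
    lintegral_const_mul _ (by fun_prop), lintegral_finsetSum _ (fun i _ => by fun_prop)]
  have hone : ∀ i, ∫⁻ g, (ENNReal.ofReal (|g i| ^ 8) +
      ENNReal.ofReal ((smoothVar E lam z τ g i)⁻¹ ^ 4)) ∂stdNormal (Fin n) ≤
      ENNReal.ofReal (M + K₄) := by
    intro i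
    rw [lintegral_add_left (by fun_prop), lintegral_abs_pow_stdNormal, ENNReal.ofReal_add hM0 hK₄]
    exact add_le_add le_rfl (h₄ lam hL₄ n hn E z τ hτ i)
  have h1 : ENNReal.ofReal (t * (n : ℝ)⁻¹) * ∑ i, ∫⁻ g, (ENNReal.ofReal (|g i| ^ 8) +
      ENNReal.ofReal ((smoothVar E lam z τ g i)⁻¹ ^ 4)) ∂stdNormal (Fin n) ≤
      ENNReal.ofReal (t * (M + K₄)) := by
    refine (mul_le_mul_right (Finset.sum_le_sum fun i _ => hone i) _).trans ?_
    rw [Finset.sum_const, Finset.card_univ, Fintype.card_fin, nsmul_eq_mul,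
      ← ENNReal.ofReal_natCast, ← ENNReal.ofReal_mul (by positivity),
      ← ENNReal.ofReal_mul (by positivity)]
    refine ENNReal.ofReal_le_ofReal (le_of_eq ?_)
    field_simp
  have h2 : ENNReal.ofReal t⁻¹ * ∫⁻ g, ENNReal.ofReal ((n : ℝ)⁻¹ *
        ∑ i, (smoothVar E lam z τ g i - τ i ^ 2) ^ 2) ∂stdNormal (Fin n) ≤
      ENNReal.ofReal (t * A) := by
    refine (mul_le_mul_right (lintegral_smoothVar_sub_sq_le hlam0 E z hC hτC) _).trans ?_
    rw [← ENNReal.ofReal_mul (by positivity)]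
    refine ENNReal.ofReal_le_ofReal (le_of_eq ?_)
    rw [← hη, ← hA, ← Real.sq_sqrt hη0.le, ← ht]
    field_simp
  refine (add_le_add h1 h2).trans ?_
  rw [← ENNReal.ofReal_add (by positivity) (by positivity)]
  exact ENNReal.ofReal_le_ofReal (le_of_eq (by ring))

end Oracle

/-! ### The noise as a standard Gaussian vector -/

section Laws

variable {Ω A B B' : Type*} [MeasurableSpace Ω] [MeasurableSpace A] [MeasurableSpace B]
  [MeasurableSpace B'] {μ : Measure Ω} {ζ : Ω → A} {η : Ω → B}

/-- A transformation that depends on `ζ` but always produces the same law preserves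
independence. -/
lemma HasProdLaw.transform {ν : Measure B} [IsProbabilityMeasure ν] {ν' : Measure B'}
    [IsProbabilityMeasure ν'] (h : HasProdLaw ζ η ν μ) {T : A → B → B'}
    (hT : Measurable fun p : A × B => T p.1 p.2) (hmap : ∀ᵐ ω ∂μ, ν.map (T (ζ ω)) = ν') :
    HasProdLaw ζ (fun ω => T (ζ ω) (η ω)) ν' μ := by
  have hη' : Measurable fun ω => T (ζ ω) (η ω) :=
    hT.comp (h.measurable_fst.prodMk h.measurable_snd)
  refine ⟨h.measurable_fst, hη', ?_⟩
  ext s hs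
  have h1 : Measurable fun p : A × B => (p.1, T p.1 p.2) :=
    _root_.measurable_fst.prodMk hT
  have h2 : μ.map (fun ω => (ζ ω, T (ζ ω) (η ω))) s =
      ∫⁻ ω, s.indicator 1 (ζ ω, T (ζ ω) (η ω)) ∂μ := by
    rw [← lintegral_indicator_one hs, lintegral_map (measurable_one.indicator hs)
      (h.measurable_fst.prodMk hη')]
  rw [h2, h.lintegral_eq (F := fun p => s.indicator 1 (p.1, T p.1 p.2))
    ((measurable_one.indicator hs).comp h1), Measure.prod_apply hs,
    lintegral_map (measurable_measure_prodMk_left hs) h.measurable_fst]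
  refine lintegral_congr_ae ?_
  filter_upwards [hmap] with ω hω
  have hTω : Measurable (T (ζ ω)) := hT.comp measurable_prodMk_left
  have hsω : MeasurableSet (Prod.mk (ζ ω) ⁻¹' s) := measurable_prodMk_left hs
  rw [← hω, Measure.map_apply hTω hsω, ← lintegral_indicator_one (hTω hsω)]
  rfl

/-- If a pair is independent of `ζ` and its entries are independent, then the second entry is
independent of `ζ` and the first. -/
lemma HasProdLaw.of_prod [IsProbabilityMeasure μ] {ν : Measure B} [IsProbabilityMeasure ν]
    {ν' : Measure B'} [IsProbabilityMeasure ν'] {η' : Ω → B'}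
    (h : HasProdLaw ζ (fun ω => (η ω, η' ω)) (ν.prod ν') μ) :
    HasProdLaw (fun ω => (ζ ω, η ω)) η' ν' μ := by
  have hζ := h.measurable_fst
  have hη : Measurable η := h.measurable_snd.fst
  have hη' : Measurable η' := h.measurable_snd.snd
  have := Measure.isProbabilityMeasure_map (μ := μ) hζ.aemeasurable
  have h1 : μ.map (fun ω => (ζ ω, η ω)) = (μ.map ζ).prod ν := by
    have h2 := congrArg (Measure.map (fun p : A × B × B' => (p.1, p.2.1))) h.map_eq
    rw [Measure.map_map (by fun_prop) (by fun_prop)] at h2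
    have h3 : (fun p : A × B × B' => (p.1, p.2.1)) = Prod.map id Prod.fst := rfl
    rw [h3, ← Measure.map_prod_map _ _ measurable_id _root_.measurable_fst, Measure.map_id,
      Measure.map_fst_prod, measure_univ, one_smul] at h2
    exact h2
  refine ⟨by fun_prop, hη', ?_⟩
  rw [h1]
  have h2 := congrArg (Measure.map MeasurableEquiv.prodAssoc.symm) h.map_eq
  rw [Measure.map_map (MeasurableEquiv.measurable _) (by fun_prop)] at h2
  rw [← Measure.prodAssoc_prod, MeasurableEquiv.map_symm_map] at h2
  exact h2

lemma HasProdLaw.swap {ν : Measure B} [IsProbabilityMeasure ν] {ν' : Measure B'}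
    [IsProbabilityMeasure ν'] {η' : Ω → B'}
    (h : HasProdLaw ζ (fun ω => (η ω, η' ω)) (ν.prod ν') μ) :
    HasProdLaw ζ (fun ω => (η' ω, η ω)) (ν'.prod ν) μ :=
  h.transform (T := fun _ p => (p.2, p.1)) (by fun_prop) (ae_of_all _ fun _ => Measure.prod_swap)

end Laws

section Source

variable {Ω : Type*} [MeasurableSpace Ω] {μ : Measure Ω} {d q : ℕ}

/-- The conditional standard deviation of the error of sample `i`. -/
def Node.sd (V : Node d q) (n : ℕ) (z : Fin n → Fin d → ℝ) (i : Fin n) : ℝ :=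
  √(V.errVar n i (z i))

/-- The standardized error of sample `i`. -/
def Node.stdErr (V : Node d q) (n : ℕ) (z : Fin n → Fin d → ℝ) (N : Fin n × Fin q → ℝ)
    (i : Fin n) : ℝ :=
  V.error n i (z i) (fun l => N (i, l)) / V.sd n z i

/-- The standardized errors of the node `V` in the `n`-th data set. -/
def Source.stdErr (S : Source μ d q) (V : Node d q) (n : ℕ) (ω : Ω) : Fin n → ℝ :=
  V.stdErr n (S.Z n ω) (fun p => S.N n ω p.1 p.2)

/-- The values of the node, as a function of the standardized errors. -/
def Node.ofStdErr (V : Node d q) (n : ℕ) (z : Fin n → Fin d → ℝ) (g : Fin n → ℝ) (i : Fin n) : ℝ :=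
  ∑ k, z i k * V.coef k + V.sd n z i * g i

lemma Node.errVar_nonneg (V : Node d q) (n : ℕ) (i : Fin n) (z : Fin d → ℝ) :
    0 ≤ V.errVar n i z := Finset.sum_nonneg fun _ _ => sq_nonneg _

lemma Node.sd_sq (V : Node d q) (n : ℕ) (z : Fin n → Fin d → ℝ) (i : Fin n) :
    V.sd n z i ^ 2 = V.errVar n i (z i) := Real.sq_sqrt (V.errVar_nonneg n i (z i))

lemma Node.sd_nonneg (V : Node d q) (n : ℕ) (z : Fin n → Fin d → ℝ) (i : Fin n) :
    0 ≤ V.sd n z i := Real.sqrt_nonneg _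

@[fun_prop]
lemma Node.measurable_load' (V : Node d q) {α : Type*} [MeasurableSpace α] (n : ℕ) (i : Fin n)
    (l : Fin q) {f : α → Fin d → ℝ} (hf : Measurable f) : Measurable fun x => V.load n i l (f x) :=
  (V.measurable_load n i l).comp hf

lemma Node.measurable_sd (V : Node d q) {α : Type*} [MeasurableSpace α] {n : ℕ} (i : Fin n)
    {z : α → Fin n → Fin d → ℝ} (hz : Measurable z) : Measurable fun x => V.sd n (z x) i := by
  unfold Node.sd Node.errVar
  fun_prop

lemma Node.measurable_stdErr (V : Node d q) (n : ℕ) :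
    Measurable fun p : (Fin n → Fin d → ℝ) × (Fin n × Fin q → ℝ) => V.stdErr n p.1 p.2 := by
  refine measurable_pi_lambda _ fun i => ?_
  refine Measurable.div ?_ (V.measurable_sd i measurable_fst)
  unfold Node.error
  fun_prop

lemma Node.measurable_ofStdErr (V : Node d q) {α : Type*} [MeasurableSpace α] {n : ℕ} (i : Fin n)
    {z : α → Fin n → Fin d → ℝ} (hz : Measurable z) {g : α → Fin n → ℝ} (hg : Measurable g) :
    Measurable fun x => V.ofStdErr n (z x) (g x) i := by
  have := V.measurable_sd i hz
  unfold Node.ofStdErr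
  fun_prop

lemma Source.obs_eq_ofStdErr (S : Source μ d q) (V : Node d q) {n : ℕ} {ω : Ω}
    (h : ∀ i, 0 < V.errVar n i (S.Z n ω i)) :
    S.obs V n ω = V.ofStdErr n (S.Z n ω) (S.stdErr V n ω) := by
  ext i
  have : V.sd n (S.Z n ω) i ≠ 0 := (Real.sqrt_pos.2 (h i)).ne'
  simp only [Source.obs, Node.value, Node.ofStdErr, Source.stdErr, Node.stdErr]
  rw [mul_div_cancel₀ _ this]

lemma Source.hasProdLaw_noise [IsProbabilityMeasure μ] (S : Source μ d q) (n : ℕ) :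
    HasProdLaw (S.Z n) (fun ω (p : Fin n × Fin q) => S.N n ω p.1 p.2)
      (stdNormal (Fin n × Fin q)) μ := by
  have hN := S.measurable_N n
  have hm : Measurable fun ω (p : Fin n × Fin q) => S.N n ω p.1 p.2 := by fun_prop
  refine ⟨S.measurable_Z n, hm, ?_⟩
  have hlaw : μ.map (fun ω (p : Fin n × Fin q) => S.N n ω p.1 p.2) = stdNormal (Fin n × Fin q) := by
    have h1 := (iIndepFun_iff_map_fun_eq_pi_map (fun p => by fun_prop)).1 (S.indep_noise n)
    rw [h1]
    congr 1
    ext1 p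
    exact S.gaussian n p.1 p.2
  have hind : IndepFun (S.Z n) (fun ω (p : Fin n × Fin q) => S.N n ω p.1 p.2) μ :=
    (S.indep_design n).comp (φ := id) measurable_id
      (show Measurable fun (N : Fin n → Fin q → ℝ) (p : Fin n × Fin q) => N p.1 p.2 by fun_prop)
  rw [(indepFun_iff_map_prod_eq_prod_map_map (S.measurable_Z n).aemeasurable
    hm.aemeasurable).1 hind, hlaw]

/-- The coefficients of the standardized errors with respect to all noise variables. -/
def Node.unitLoad (V : Node d q) (n : ℕ) (z : Fin n → Fin d → ℝ) (i : Fin n) (p : Fin n × Fin q) :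
    ℝ :=
  if i = p.1 then V.load n i p.2 (z i) / V.sd n z i else 0

lemma Node.sum_unitLoad_mul (V : Node d q) (n : ℕ) (z : Fin n → Fin d → ℝ) (i : Fin n)
    (f : Fin n × Fin q → ℝ) :
    ∑ p, V.unitLoad n z i p * f p = ∑ l, V.load n i l (z i) / V.sd n z i * f (i, l) := by
  rw [Fintype.sum_prod_type, Finset.sum_eq_single i]
  · simp [Node.unitLoad]
  · intro j _ hj
    simp [Node.unitLoad, hj.symm]
  · simp

lemma Node.stdErr_eq (V : Node d q) (n : ℕ) (z : Fin n → Fin d → ℝ) (N : Fin n × Fin q → ℝ)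
    (i : Fin n) : V.stdErr n z N i = ∑ p, V.unitLoad n z i p * N p := by
  rw [V.sum_unitLoad_mul, Node.stdErr, Node.error, Finset.sum_div]
  refine Finset.sum_congr rfl fun l _ => ?_
  ring

lemma Node.sum_unitLoad_mul_unitLoad (V W : Node d q) (n : ℕ) (z : Fin n → Fin d → ℝ)
    (i j : Fin n) : ∑ p, V.unitLoad n z i p * W.unitLoad n z j p =
      if i = j then condCorr V W n i (z i) else 0 := by
  rw [V.sum_unitLoad_mul]
  split_ifs with h
  · subst h
    simp only [Node.unitLoad, if_true, condCorr, Finset.sum_div]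
    refine Finset.sum_congr rfl fun l _ => ?_
    rw [div_mul_div_comm]
    rfl
  · simp [Node.unitLoad, Ne.symm h]

lemma Node.condCorr_self (V : Node d q) (n : ℕ) (i : Fin n) {z : Fin d → ℝ}
    (h : 0 < V.errVar n i z) : condCorr V V n i z = 1 := by
  rw [condCorr, Real.mul_self_sqrt h.le]
  simp only [← sq]
  exact div_self h.ne'

lemma Node.measurePreserving_stdErr (V : Node d q) {n : ℕ} {z : Fin n → Fin d → ℝ}
    (h : ∀ i, 0 < V.errVar n i (z i)) :
    MeasurePreserving (V.stdErr n z) (stdNormal (Fin n × Fin q)) (stdNormal (Fin n)) := by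
  have h1 := measurePreserving_orthonormal (V.unitLoad n z) fun a b => by
    rw [V.sum_unitLoad_mul_unitLoad, V.condCorr_self n a (h a)]
  convert h1 using 1
  ext N i
  exact V.stdErr_eq n z N i

lemma Node.measurePreserving_stdErr_pair (V W : Node d q) {n : ℕ} {z : Fin n → Fin d → ℝ}
    (hV : ∀ i, 0 < V.errVar n i (z i)) (hW : ∀ i, 0 < W.errVar n i (z i))
    (h : ∀ i, condCorr V W n i (z i) = 0) :
    MeasurePreserving (fun N => (V.stdErr n z N, W.stdErr n z N)) (stdNormal (Fin n × Fin q))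
      ((stdNormal (Fin n)).prod (stdNormal (Fin n))) := by
  have h' : ∀ i, condCorr W V n i (z i) = 0 := by
    intro i
    rw [← h i, condCorr, condCorr, mul_comm (√(W.errVar n i (z i)))]
    simp_rw [mul_comm (W.load n i _ (z i))]
  have h1 := measurePreserving_orthonormal
    (Sum.elim (V.unitLoad n z) (W.unitLoad n z)) fun a b => by
      rcases a with a | a <;> rcases b with b | b <;>
        simp only [Sum.elim_inl, Sum.elim_inr, Node.sum_unitLoad_mul_unitLoad]
      · simp [V.condCorr_self n a (hV a)]
      · simp [h]
      · simp [h']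
      · simp [W.condCorr_self n a (hW a)]
  have h2 := measurePreserving_sumPiEquivProdPi (X := fun _ : Fin n ⊕ Fin n => ℝ)
    (fun _ => gaussianReal 0 1)
  convert h2.comp h1 using 1
  ext N i
  · exact V.stdErr_eq n z N i
  · exact W.stdErr_eq n z N i

lemma Source.hasProdLaw_stdErr [IsProbabilityMeasure μ] (S : Source μ d q) (V : Node d q) (n : ℕ)
    (h : ∀ᵐ ω ∂μ, ∀ i, 0 < V.errVar n i (S.Z n ω i)) :
    HasProdLaw (S.Z n) (S.stdErr V n) (stdNormal (Fin n)) μ := by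
  refine (S.hasProdLaw_noise n).transform (V.measurable_stdErr n) ?_
  filter_upwards [h] with ω hω
  exact (V.measurePreserving_stdErr hω).map_eq

lemma Source.hasProdLaw_stdErr_pair [IsProbabilityMeasure μ] (S : Source μ d q)
    (V W : Node d q) (n : ℕ)
    (hV : ∀ᵐ ω ∂μ, ∀ i, 0 < V.errVar n i (S.Z n ω i))
    (hW : ∀ᵐ ω ∂μ, ∀ i, 0 < W.errVar n i (S.Z n ω i))
    (h : ∀ᵐ ω ∂μ, ∀ i, condCorr V W n i (S.Z n ω i) = 0) :
    HasProdLaw (S.Z n) (fun ω => (S.stdErr V n ω, S.stdErr W n ω))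
      ((stdNormal (Fin n)).prod (stdNormal (Fin n))) μ := by
  refine (S.hasProdLaw_noise n).transform (T := fun z N => (V.stdErr n z N, W.stdErr n z N))
    ((V.measurable_stdErr n).prodMk (W.measurable_stdErr n)) ?_
  filter_upwards [hV, hW, h] with ω h1 h2 h3
  exact (V.measurePreserving_stdErr_pair W h1 h2 h3).map_eq

end Source

/-! ### Approximation of the scaled residuals -/

section OracleApproximation

lemma sum_sq_window_sub_le {n d : ℕ} (E : Expert d) {lam : ℕ} (hlam : 0 < lam)
    (z : Fin n → Fin d → ℝ) (e p : Fin n → ℝ) :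
    ∑ i, ((lam : ℝ)⁻¹ * ∑ j ∈ window E lam z i, (e j - p j) ^ 2 -
      (lam : ℝ)⁻¹ * ∑ j ∈ window E lam z i, e j ^ 2) ^ 2 ≤
      4 * ∑ j, (p j * (p j - 2 * e j)) ^ 2 := by
  have hlam' : (0 : ℝ) < lam := by exact_mod_cast hlam
  have hlam1 : (1 : ℝ) ≤ lam := by exact_mod_cast hlam
  have h1 : ∀ i, ((lam : ℝ)⁻¹ * ∑ j ∈ window E lam z i, (e j - p j) ^ 2 -
      (lam : ℝ)⁻¹ * ∑ j ∈ window E lam z i, e j ^ 2) ^ 2 ≤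
      2 * (lam : ℝ)⁻¹ * ∑ j ∈ window E lam z i, (p j * (p j - 2 * e j)) ^ 2 := by
    intro i
    have h2 : (lam : ℝ)⁻¹ * ∑ j ∈ window E lam z i, (e j - p j) ^ 2 -
      (lam : ℝ)⁻¹ * ∑ j ∈ window E lam z i, e j ^ 2 =
        (lam : ℝ)⁻¹ * ∑ j ∈ window E lam z i, p j * (p j - 2 * e j) := by
      rw [← mul_sub, ← Finset.sum_sub_distrib]
      congr 1
      refine Finset.sum_congr rfl fun j _ => ?_
      ring
    have h3 : (∑ j ∈ window E lam z i, p j * (p j - 2 * e j)) ^ 2 ≤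
        (2 * lam) * ∑ j ∈ window E lam z i, (p j * (p j - 2 * e j)) ^ 2 := by
      refine sq_sum_le_card_mul_sum_sq.trans ?_
      refine mul_le_mul_of_nonneg_right ?_ (Finset.sum_nonneg fun _ _ => sq_nonneg _)
      have : ((window E lam z i).card : ℝ) ≤ lam + 1 := by
        exact_mod_cast card_window_le E lam z i
      linarith
    rw [h2, mul_pow]
    refine (mul_le_mul_of_nonneg_left h3 (by positivity)).trans (le_of_eq ?_)
    field_simp
  refine (Finset.sum_le_sum fun i _ => h1 i).trans ?_
  rw [← Finset.mul_sum]
  refine (mul_le_mul_of_nonneg_left (sum_sum_window_le E lam z fun j => sq_nonneg _)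
    (by positivity)).trans ?_
  rw [← mul_assoc]
  refine mul_le_mul_of_nonneg_right ?_ (Finset.sum_nonneg fun _ _ => sq_nonneg _)
  rw [mul_assoc, inv_mul_eq_div, ← le_div_iff₀' (by norm_num), div_le_iff₀ hlam']
  linarith

lemma lintegral_sum_sq_wlsFit_le {n d : ℕ} {z : Fin n → Fin d → ℝ}
    (hz : ((of z)ᵀ * of z).PosDef) {K : ℝ} {B : (Fin n → ℝ) → Fin n → ℝ}
    (hB : ∀ i, Measurable fun g => B g i) (h : OrthogonalCoords (stdNormal (Fin n)) K B) :
    ∫⁻ g, ENNReal.ofReal (∑ i, wlsFit z (fun _ => 1) (B g) i ^ 2) ∂stdNormal (Fin n) ≤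
      ENNReal.ofReal (K * d) := by
  obtain ⟨P, hPd, hP⟩ := exists_hat_matrix hz
  have h0 : ∀ g, ENNReal.ofReal (∑ i, wlsFit z (fun _ => 1) (B g) i ^ 2) =
      ∑ i, ENNReal.ofReal ((∑ j, P i j * B g j) ^ 2) := by
    intro g
    rw [ENNReal.ofReal_sum_of_nonneg fun _ _ => sq_nonneg _]
    simp_rw [hP]
  simp_rw [h0]
  rw [lintegral_finsetSum _ (fun i _ => by fun_prop)]
  refine (Finset.sum_le_sum fun i _ => h.lintegral_sq_le (P i)).trans ?_
  rcases Nat.eq_zero_or_pos n with rfl | hn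
  · simp
  have hK : 0 ≤ K := (integral_nonneg fun _ => sq_nonneg _).trans (h.sq_le ⟨0, hn⟩)
  rw [← ENNReal.ofReal_sum_of_nonneg fun _ _ =>
    mul_nonneg hK (Finset.sum_nonneg fun _ _ => sq_nonneg _), ← Finset.mul_sum, hPd]

variable {Ω : Type*} [MeasurableSpace Ω] {μ : Measure Ω} {d q : ℕ}

/-- Bounds on the error variances that hold for all samples of all data sets. -/
def Source.VarBounds (S : Source μ d q) (V : Node d q) (c C : ℝ) : Prop :=
  ∀ n, ∀ᵐ ω ∂μ, ∀ i, c ≤ V.errVar n i (S.Z n ω i) ∧ V.errVar n i (S.Z n ω i) ≤ C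

lemma NodeAssumptions.exists_varBounds {S : Source μ d q} {V : Node d q} {E : Expert d}
    {lam : ℕ → ℕ} (h : NodeAssumptions S V E lam) :
    ∃ c C : ℝ, 0 < c ∧ c ≤ C ∧ S.VarBounds V c C := by
  obtain ⟨c, hc, h1⟩ := h.nondegenerate
  obtain ⟨C, h2⟩ := h.bounded
  refine ⟨c, max c C, hc, le_max_left _ _, fun n => ?_⟩
  rw [ae_all_iff]
  intro i
  filter_upwards [h1 n i, h2 n i] with ω h3 h4 using ⟨h3, h4.trans (le_max_right _ _)⟩

lemma Source.VarBounds.orthogonalCoords_err {S : Source μ d q} {V : Node d q} {c C : ℝ}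
    (h : S.VarBounds V c C) (n : ℕ) :
    ∀ᵐ ω ∂μ, OrthogonalCoords (stdNormal (Fin n)) (C * normalMoment 2)
      fun g i => V.sd n (S.Z n ω) i * g i := by
  filter_upwards [h n] with ω hω
  rcases Nat.eq_zero_or_pos n with rfl | hn
  · exact ⟨fun i => i.elim0, fun i => i.elim0, fun i => i.elim0⟩
  have hC : 0 ≤ C := (V.errVar_nonneg _ _ _).trans (hω ⟨0, hn⟩).2
  have h1 := orthogonalCoords_mul_even (n := n) (φ := fun _ i => V.sd n (S.Z n ω) i)
    (fun _ => measurable_const) (fun _ _ _ => rfl)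
    (mul_nonneg hC (normalMoment_nonneg 2)) (fun i => by
      have h2 := lintegral_abs_pow_stdNormal 2 i
      simp only [sq_abs] at h2
      simp only [mul_pow, V.sd_sq]
      calc ∫⁻ g, ENNReal.ofReal (g i ^ 2 * V.errVar n i (S.Z n ω i)) ∂stdNormal (Fin n)
          ≤ ∫⁻ g, ENNReal.ofReal C * ENNReal.ofReal (g i ^ 2) ∂stdNormal (Fin n) := by
            refine lintegral_mono fun g => ?_
            rw [← ENNReal.ofReal_mul hC, mul_comm C]
            exact ENNReal.ofReal_le_ofReal
              (mul_le_mul_of_nonneg_left (hω i).2 (sq_nonneg _))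
        _ = _ := by
            rw [lintegral_const_mul _ (by fun_prop), h2, ENNReal.ofReal_mul hC])
  convert h1 using 3
  ring

section Slow

variable [IsProbabilityMeasure μ] {S : Source μ d q} {V : Node d q} {c C : ℝ}

lemma Source.VarBounds.hasProdLaw (h : S.VarBounds V c C) (hc : 0 < c) (n : ℕ) :
    HasProdLaw (S.Z n) (S.stdErr V n) (stdNormal (Fin n)) μ :=
  S.hasProdLaw_stdErr V n <| by
    filter_upwards [h n] with ω hω i using hc.trans_le (hω i).1

lemma Source.VarBounds.slow_of_lintegral_le (h : S.VarBounds V c C) (hc : 0 < c)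
    {F : ∀ n, (Fin n → Fin d → ℝ) × (Fin n → ℝ) → ℝ} (hF : ∀ n, Measurable (F n)) {K : ℝ}
    (hK : ∀ᶠ n in atTop, ∀ᵐ ω ∂μ, ∫⁻ g, ENNReal.ofReal |F n (S.Z n ω, g)| ∂stdNormal (Fin n) ≤
      ENNReal.ofReal K) :
    Slow μ fun n ω _ => F n (S.Z n ω, S.stdErr V n ω) := by
  refine Slow.of_lintegral_le (K := K) (Eventually.of_forall fun n => ?_) ?_
  · have hl := h.hasProdLaw hc n
    exact ((hF n).comp (hl.measurable_fst.prodMk hl.measurable_snd)).aemeasurable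
  · filter_upwards [hK] with n hn
    exact (h.hasProdLaw hc n).lintegral_le (F := fun p => ENNReal.ofReal |F n p|)
      (hF n).abs.ennreal_ofReal hn

lemma Source.VarBounds.slow_of_moments (h : S.VarBounds V c C) (hc : 0 < c)
    {F : ∀ n, (Fin n → Fin d → ℝ) × (Fin n → ℝ) → Fin n → ℝ}
    (hF : ∀ n i, Measurable fun p => F n p i)
    (hK : ∀ p : ℕ, ∃ K : ℝ, ∀ᶠ n in atTop, ∀ᵐ ω ∂μ, ∀ i,
      ∫⁻ g, ENNReal.ofReal (|F n (S.Z n ω, g) i| ^ p) ∂stdNormal (Fin n) ≤ ENNReal.ofReal K) :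
    Slow μ fun n ω i => F n (S.Z n ω, S.stdErr V n ω) i := by
  refine Slow.of_moments (Eventually.of_forall fun n i => ?_) fun p => ?_
  · have hl := h.hasProdLaw hc n
    exact ((hF n i).comp (hl.measurable_fst.prodMk hl.measurable_snd)).aemeasurable
  · obtain ⟨K, hK⟩ := hK p
    refine ⟨K, ?_⟩
    filter_upwards [hK] with n hn i
    refine (h.hasProdLaw hc n).lintegral_le (F := fun x => ENNReal.ofReal (|F n x i| ^ p))
      ((hF n i).abs.pow_const p).ennreal_ofReal ?_
    filter_upwards [hn] with ω hω using hω i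

lemma Source.VarBounds.slow_stdErr (h : S.VarBounds V c C) (hc : 0 < c) :
    Slow μ fun n ω i => S.stdErr V n ω i := by
  refine h.slow_of_moments hc (F := fun n p i => p.2 i) (fun n i => by fun_prop) fun p =>
    ⟨normalMoment p, Eventually.of_forall fun n => ae_of_all _ fun ω i => ?_⟩
  exact (lintegral_abs_pow_stdNormal p i).le

lemma Source.VarBounds.slow_err (h : S.VarBounds V c C) (hc : 0 < c) :
    Slow μ fun n ω i => V.sd n (S.Z n ω) i * S.stdErr V n ω i := by
  refine Slow.of_abs_le ((h.slow_stdErr hc).const_mul √C) ?_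
  refine Eventually.of_forall fun n => ?_
  filter_upwards [h n] with ω hω i
  rw [abs_mul, abs_mul, abs_of_nonneg (V.sd_nonneg n _ i), abs_of_nonneg (Real.sqrt_nonneg C)]
  exact mul_le_mul_of_nonneg_right (Real.sqrt_le_sqrt (hω i).2) (abs_nonneg _)

lemma Source.VarBounds.slow_sum_sq_wlsFit (h : S.VarBounds V c C) (hc : 0 < c)
    (hZ : DesignAssumptions S) {B : ∀ n, (Fin n → Fin d → ℝ) × (Fin n → ℝ) → Fin n → ℝ}
    (hB : ∀ n i, Measurable fun p => B n p i) {K : ℝ}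
    (hK : ∀ᶠ n in atTop, ∀ᵐ ω ∂μ,
      OrthogonalCoords (stdNormal (Fin n)) K fun g => B n (S.Z n ω, g)) :
    Slow μ fun n ω _ =>
      ∑ i, wlsFit (S.Z n ω) (fun _ => 1) (B n (S.Z n ω, S.stdErr V n ω)) i ^ 2 := by
  refine h.slow_of_lintegral_le hc
    (F := fun n p => ∑ i, wlsFit p.1 (fun _ => 1) (B n p) i ^ 2) (fun n => ?_) (K := K * d) ?_
  · exact Finset.measurable_sum _ fun i _ =>
      (measurable_wlsFit measurable_fst (fun _ => measurable_const) (hB n) i).pow_const 2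
  · filter_upwards [hK, hZ.posDef] with n h1 h2
    filter_upwards [h1, h2] with ω h3 h4
    refine le_trans (le_of_eq ?_) (lintegral_sum_sq_wlsFit_le h4
      (fun i => (hB n i).comp measurable_prodMk_left) h3)
    refine lintegral_congr fun g => ?_
    rw [abs_of_nonneg (Finset.sum_nonneg fun _ _ => sq_nonneg _)]
    rfl

lemma Source.VarBounds.slow_sum_sq_olsFit (h : S.VarBounds V c C) (hc : 0 < c)
    (hZ : DesignAssumptions S) :
    Slow μ fun n ω _ => ∑ i, wlsFit (S.Z n ω) (fun _ => 1)
      (fun j => V.sd n (S.Z n ω) j * S.stdErr V n ω j) i ^ 2 :=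
  h.slow_sum_sq_wlsFit hc hZ (B := fun n p j => V.sd n p.1 j * p.2 j)
    (fun n i => (V.measurable_sd i measurable_fst).mul (by fun_prop))
    (Eventually.of_forall fun n => h.orthogonalCoords_err n)

end Slow

/-- `s` times the scaled residuals of the node `V` is close to the random vector `H`, which has
orthogonal coordinates given the predictors and is close to the vector of standardized errors. -/
structure IsOracle (S : Source μ d q) (V : Node d q) (E : Expert d) (lam : ℕ → ℕ) (s K : ℝ)
    (H : ∀ n, (Fin n → Fin d → ℝ) × (Fin n → ℝ) → Fin n → ℝ) : Prop where
  pos : 0 < s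
  measurable : ∀ n i, Measurable fun p => H n p i
  orthogonal : ∀ᶠ n in atTop, ∀ᵐ ω ∂μ,
    OrthogonalCoords (stdNormal (Fin n)) K fun g => H n (S.Z n ω, g)
  slow : Slow μ fun n ω _ => ∑ i, (s * scaledResid E (lam n) (S.Z n ω)
    (V.ofStdErr n (S.Z n ω) (S.stdErr V n ω)) i - H n (S.Z n ω, S.stdErr V n ω) i) ^ 2
  negligible : Negligible μ fun n ω =>
    (n : ℝ)⁻¹ * ∑ i, (H n (S.Z n ω, S.stdErr V n ω) i - S.stdErr V n ω i) ^ 2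

lemma isOracle_homoskedastic [IsProbabilityMeasure μ] {S : Source μ d q} {V : Node d q}
    {lam : ℕ → ℕ} (hZ : DesignAssumptions S) (hV : NodeAssumptions S V .homoskedastic lam) :
    ∃ s K H, IsOracle S V .homoskedastic lam s K H := by
  obtain ⟨c, C, hc, hcC, h⟩ := hV.exists_varBounds
  obtain ⟨v, hv⟩ := hV.heteroskedasticity
  have hv0 : 0 < v := by
    obtain ⟨ω, hω⟩ := (h 1).exists
    have := (hω 0).1
    rw [hv] at this
    exact hc.trans_le this
  refine ⟨(√v)⁻¹, normalMoment 2, fun n p => p.2, by positivity, fun n i => by fun_prop,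
    Eventually.of_forall fun n => ae_of_all _ fun ω => orthogonalCoords_id n, ?_, ?_⟩
  · refine Slow.of_abs_le ((h.slow_sum_sq_olsFit hc hZ).const_mul v⁻¹) ?_
    filter_upwards [hZ.posDef] with n hn
    filter_upwards [hn] with ω hω i
    have hsd : ∀ j, V.sd n (S.Z n ω) j = √v := fun j => by rw [Node.sd, hv]
    refine le_of_eq ?_
    congr 1
    rw [Finset.mul_sum]
    refine Finset.sum_congr rfl fun j _ => ?_
    have h1 : V.ofStdErr n (S.Z n ω) (S.stdErr V n ω) =
      fun i => ∑ k, S.Z n ω i k * V.coef k + V.sd n (S.Z n ω) i * S.stdErr V n ω i := rfl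
    simp only [scaledResid, olsResid]
    rw [h1, wlsResid_add (isUnit_det_weighted hω fun _ => one_pos), wlsResid_eq_sub, hsd]
    have h2 : (√v)⁻¹ * √v = 1 := inv_mul_cancel₀ (Real.sqrt_pos.2 hv0).ne'
    rw [mul_sub, ← mul_assoc, h2, one_mul, sub_sub_cancel_left, neg_sq, mul_pow, inv_pow,
      Real.sq_sqrt hv0.le]
  · simpa using Negligible.of_tendsto (μ := μ) tendsto_const_nhds

lemma eventually_window_length {lam : ℕ → ℕ} (hlam : Tendsto lam atTop atTop)
    (hlam' : Tendsto (fun n : ℕ => (lam n : ℝ) / n) atTop (𝓝 0)) (L : ℕ) :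
    ∀ᶠ n in atTop, L ≤ lam n ∧ lam n < n := by
  filter_upwards [hlam.eventually_ge_atTop L, hlam'.eventually_lt_const one_pos,
    eventually_gt_atTop 0] with n h1 h2 hn
  refine ⟨h1, ?_⟩
  have hn' : (0 : ℝ) < n := by exact_mod_cast hn
  rw [div_lt_one hn'] at h2
  exact_mod_cast h2

variable [IsProbabilityMeasure μ]

/-- The moving averages of squared residuals, as a function of the standardized errors. -/
def Node.residVar (V : Node d q) (E : Expert d) (lam n : ℕ)
    (p : (Fin n → Fin d → ℝ) × (Fin n → ℝ)) (i : Fin n) : ℝ :=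
  (lam : ℝ)⁻¹ * ∑ j ∈ window E lam p.1 i, (V.sd n p.1 j * p.2 j -
    wlsFit p.1 (fun _ => 1) (fun l => V.sd n p.1 l * p.2 l) j) ^ 2

/-- The moving averages of squared errors, as a function of the standardized errors. -/
def Node.errSmooth (V : Node d q) (E : Expert d) (lam n : ℕ)
    (p : (Fin n → Fin d → ℝ) × (Fin n → ℝ)) (i : Fin n) : ℝ :=
  smoothVar E lam p.1 (V.sd n p.1) p.2 i

lemma Node.measurable_errSmooth (V : Node d q) (E : Expert d) (lam n : ℕ) (i : Fin n) :
    Measurable fun p => V.errSmooth E lam n p i := by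
  have h : ∀ j, Measurable fun p : (Fin n → Fin d → ℝ) × (Fin n → ℝ) => V.sd n p.1 j := fun j =>
    V.measurable_sd j measurable_fst
  exact (measurable_sum_window E lam measurable_fst (fun j => by fun_prop) i).const_mul _

lemma Node.measurable_residVar (V : Node d q) (E : Expert d) (lam n : ℕ) (i : Fin n) :
    Measurable fun p => V.residVar E lam n p i := by
  have h : ∀ j, Measurable fun p : (Fin n → Fin d → ℝ) × (Fin n → ℝ) => V.sd n p.1 j * p.2 j :=
    fun j => (V.measurable_sd j measurable_fst).mul (by fun_prop)
  refine (measurable_sum_window E lam measurable_fst (fun j => ?_) i).const_mul _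
  exact ((h j).sub (measurable_wlsFit measurable_fst (fun _ => measurable_const) h j)).pow_const 2

lemma Node.residVar_nonneg (V : Node d q) (E : Expert d) (lam n : ℕ)
    (p : (Fin n → Fin d → ℝ) × (Fin n → ℝ)) (i : Fin n) : 0 ≤ V.residVar E lam n p i :=
  mul_nonneg (by positivity) (Finset.sum_nonneg fun _ _ => sq_nonneg _)

lemma Node.errSmooth_nonneg (V : Node d q) (E : Expert d) (lam n : ℕ)
    (p : (Fin n → Fin d → ℝ) × (Fin n → ℝ)) (i : Fin n) : 0 ≤ V.errSmooth E lam n p i :=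
  smoothVar_nonneg _ _ _ _ _ _

lemma Node.weight_ofStdErr (V : Node d q) (E : Expert d) (lam n : ℕ) {z : Fin n → Fin d → ℝ}
    (hz : ((of z)ᵀ * of z).PosDef) (g : Fin n → ℝ) :
    weight E lam z (V.ofStdErr n z g) = fun i => (V.residVar E lam n (z, g) i)⁻¹ := by
  ext i
  have h1 : V.ofStdErr n z g = fun i => ∑ k, z i k * V.coef k + V.sd n z i * g i := rfl
  simp only [weight, olsResid, Node.residVar]
  rw [h1, wlsResid_add (isUnit_det_weighted hz fun _ => one_pos)]
  rfl

section Weighted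

variable {S : Source μ d q} {V : Node d q} {c C : ℝ} {lam : ℕ → ℕ}

lemma Source.VarBounds.ae_pos (h : S.VarBounds V c C) (hc : 0 < c)
    (hlam : Tendsto lam atTop atTop)
    (hlam' : Tendsto (fun n : ℕ => (lam n : ℝ) / n) atTop (𝓝 0)) (E : Expert d) :
    ∀ᶠ n in atTop, ∀ᵐ ω ∂μ, ∀ i,
    0 < V.residVar E (lam n) n (S.Z n ω, S.stdErr V n ω) i ∧
      0 < V.errSmooth E (lam n) n (S.Z n ω, S.stdErr V n ω) i := by
  filter_upwards [eventually_window_length hlam hlam' (2 * (d + 1))] with n hn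
  have hlam0 : (0 : ℝ) < (lam n : ℝ)⁻¹ := by
    have : 0 < lam n := by omega
    positivity
  have hl := h.hasProdLaw hc n
  set A : Set ((Fin n → Fin d → ℝ) × (Fin n → ℝ)) :=
    {p | ¬ ∀ i, 0 < V.residVar E (lam n) n p i ∧ 0 < V.errSmooth E (lam n) n p i} with hA
  have hAm : MeasurableSet A := by
    refine MeasurableSet.compl ?_
    refine measurableSet_setOfPred.2 (Measurable.forall fun i => Measurable.and ?_ ?_)
    · exact measurableSet_setOfPred.1
        (measurableSet_lt measurable_const (V.measurable_residVar E (lam n) n i))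
    · exact measurableSet_setOfPred.1
        (measurableSet_lt measurable_const (V.measurable_errSmooth E (lam n) n i))
  have h0 : ∫⁻ ω, A.indicator 1 (S.Z n ω, S.stdErr V n ω) ∂μ ≤ 0 := by
    refine hl.lintegral_le (measurable_one.indicator hAm) ?_
    filter_upwards [h n] with ω hω
    refine le_of_eq (lintegral_eq_zero_of_ae_eq_zero ?_)
    have hpos : ∀ i, ∀ᵐ g ∂stdNormal (Fin n), ∀ θ : Fin d → ℝ,
        0 < ∑ j ∈ window E (lam n) (S.Z n ω) i,
          (V.sd n (S.Z n ω) j * g j - ∑ k, S.Z n ω j k * θ k) ^ 2 := fun i =>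
      ae_sum_sq_pos (by have := le_two_mul_card_window E (lam n) (S.Z n ω) hn.2 i; omega) _ hc
        (fun j => by rw [V.sd_sq]; exact (hω j).1)
    filter_upwards [ae_all_iff.2 hpos] with g hg
    refine Set.indicator_of_notMem ?_ _
    simp only [hA, Set.mem_ofPred_eq, not_not]
    intro i
    refine ⟨mul_pos hlam0 (hg i _), ?_⟩
    have := hg i 0
    simp only [Pi.zero_apply, mul_zero, Finset.sum_const_zero, sub_zero] at this
    exact mul_pos hlam0 this
  have h1 := (lintegral_eq_zero_iff ((measurable_one.indicator hAm).comp
    (hl.measurable_fst.prodMk hl.measurable_snd))).1 (le_antisymm h0 zero_le)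
  filter_upwards [h1] with ω hω
  by_contra hcon
  have : (S.Z n ω, S.stdErr V n ω) ∈ A := hcon
  simp [this] at hω

lemma Source.VarBounds.slow_inv_residVar (h : S.VarBounds V c C) (hc : 0 < c)
    (hlam : Tendsto lam atTop atTop)
    (hlam' : Tendsto (fun n : ℕ => (lam n : ℝ) / n) atTop (𝓝 0)) (E : Expert d) :
    Slow μ fun n ω i => (V.residVar E (lam n) n (S.Z n ω, S.stdErr V n ω) i)⁻¹ := by
  refine h.slow_of_moments hc (F := fun n p i => (V.residVar E (lam n) n p i)⁻¹)
    (fun n i => (V.measurable_residVar E (lam n) n i).inv) fun p => ?_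
  obtain ⟨K, -, L, hK⟩ := exists_lintegral_inv_window_le d p hc
  refine ⟨K, ?_⟩
  filter_upwards [eventually_window_length hlam hlam' L] with n hn
  filter_upwards [h n] with ω hω i
  refine le_trans (le_of_eq ?_) (hK (lam n) hn.1 n (S.Z n ω) (window E (lam n) (S.Z n ω) i)
    (le_two_mul_card_window E (lam n) (S.Z n ω) hn.2 i) (V.sd n (S.Z n ω))
    (fun j => by rw [V.sd_sq]; exact (hω j).1)
    (fun g => wlsCoef (S.Z n ω) (fun _ => 1) (fun l => V.sd n (S.Z n ω) l * g l)))
  refine lintegral_congr fun g => ?_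
  rw [abs_of_nonneg (inv_nonneg.2 (V.residVar_nonneg _ _ _ _ _))]
  rfl

lemma Source.VarBounds.slow_inv_errSmooth (h : S.VarBounds V c C) (hc : 0 < c)
    (hlam : Tendsto lam atTop atTop)
    (hlam' : Tendsto (fun n : ℕ => (lam n : ℝ) / n) atTop (𝓝 0)) (E : Expert d) :
    Slow μ fun n ω i => (V.errSmooth E (lam n) n (S.Z n ω, S.stdErr V n ω) i)⁻¹ := by
  refine h.slow_of_moments hc (F := fun n p i => (V.errSmooth E (lam n) n p i)⁻¹)
    (fun n i => (V.measurable_errSmooth E (lam n) n i).inv) fun p => ?_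
  obtain ⟨K, -, L, hK⟩ := exists_lintegral_inv_smoothVar_le d p hc
  refine ⟨K, ?_⟩
  filter_upwards [eventually_window_length hlam hlam' L] with n hn
  filter_upwards [h n] with ω hω i
  refine le_trans (le_of_eq ?_) (hK (lam n) hn.1 n hn.2 E (S.Z n ω) (V.sd n (S.Z n ω))
    (fun j => by rw [V.sd_sq]; exact (hω j).1) i)
  refine lintegral_congr fun g => ?_
  rw [abs_of_nonneg (inv_nonneg.2 (V.errSmooth_nonneg _ _ _ _ _))]
  rfl

end Weighted

end OracleApproximation

section WeightedOracle

lemma exists_sum_mul_le {n : ℕ} (hn : 0 < n) {a f : Fin n → ℝ} (ha : ∀ i, 0 ≤ a i) :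
    ∃ j, ∑ i, a i * f i ≤ f j * ∑ i, a i := by
  obtain ⟨j, -, hj⟩ := Finset.exists_max_image Finset.univ f ⟨⟨0, hn⟩, Finset.mem_univ _⟩
  refine ⟨j, ?_⟩
  rw [Finset.mul_sum]
  refine Finset.sum_le_sum fun i _ => ?_
  rw [mul_comm]
  exact mul_le_mul_of_nonneg_right (hj i (Finset.mem_univ i)) (ha i)

variable {Ω : Type*} [MeasurableSpace Ω] {μ : Measure Ω} {d q : ℕ}

/-- The errors, as a function of the standardized errors. -/
def Node.err (V : Node d q) (n : ℕ) (p : (Fin n → Fin d → ℝ) × (Fin n → ℝ)) (i : Fin n) : ℝ :=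
  V.sd n p.1 i * p.2 i

/-- The fitted values of the ordinary regression of the errors. -/
def Node.errFit (V : Node d q) (n : ℕ) (p : (Fin n → Fin d → ℝ) × (Fin n → ℝ)) : Fin n → ℝ :=
  wlsFit p.1 (fun _ => 1) (V.err n p)

/-- The predictors and the standardized errors. -/
abbrev Source.zg (S : Source μ d q) (V : Node d q) (n : ℕ) (ω : Ω) :
    (Fin n → Fin d → ℝ) × (Fin n → ℝ) := (S.Z n ω, S.stdErr V n ω)

section Bounds

variable [IsProbabilityMeasure μ] {S : Source μ d q} {V : Node d q} {c C : ℝ} {lam : ℕ → ℕ}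

lemma Source.VarBounds.slow_residVar (h : S.VarBounds V c C) (hc : 0 < c)
    (hZ : DesignAssumptions S) (hlam : Tendsto lam atTop atTop)
    (hlam' : Tendsto (fun n : ℕ => (lam n : ℝ) / n) atTop (𝓝 0)) (E : Expert d) :
    Slow μ fun n ω i => V.residVar E (lam n) n (S.zg V n ω) i := by
  have hQ := h.slow_sum_sq_olsFit hc hZ
  have he := h.slow_err hc
  refine Slow.of_exists_le (((he.mul he).const_mul 4).add (hQ.const_mul 4)) ?_
  filter_upwards [eventually_window_length hlam hlam' 1] with n hn
  refine ae_of_all _ fun ω i => ?_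
  have hlam0 : (1 : ℝ) ≤ lam n := by exact_mod_cast hn.1
  obtain ⟨j, hj⟩ := exists_sum_mul_le (n := n) (by omega)
    (a := fun j => if j ∈ window E (lam n) (S.Z n ω) i then 1 else 0)
    (f := fun j => V.err n (S.zg V n ω) j ^ 2) (fun j => by split_ifs <;> norm_num)
  refine ⟨j, ?_⟩
  set e := V.err n (S.zg V n ω) with he'
  set p := V.errFit n (S.zg V n ω) with hp'
  simp only [ite_mul, one_mul, zero_mul, Finset.sum_ite_mem, Finset.univ_inter,
    Finset.sum_const, nsmul_eq_mul, mul_one] at hj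
  have hcard : ((window E (lam n) (S.Z n ω) i).card : ℝ) ≤ lam n + 1 := by
    exact_mod_cast card_window_le E (lam n) (S.Z n ω) i
  have hQ0 : 0 ≤ ∑ j, p j ^ 2 := Finset.sum_nonneg fun _ _ => sq_nonneg _
  change |V.residVar E (lam n) n (S.zg V n ω) i| ≤ |4 * (e j * e j) + 4 * ∑ i, p i ^ 2|
  rw [abs_of_nonneg (V.residVar_nonneg _ _ _ _ _),
    abs_of_nonneg (by nlinarith [mul_self_nonneg (e j)])]
  change (lam n : ℝ)⁻¹ * ∑ j ∈ window E (lam n) (S.Z n ω) i, (e j - p j) ^ 2 ≤ _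
  rw [inv_mul_le_iff₀ (by linarith)]
  have h1 : ∑ j ∈ window E (lam n) (S.Z n ω) i, p j ^ 2 ≤ ∑ j, p j ^ 2 :=
    Finset.sum_le_univ_sum_of_nonneg fun _ => sq_nonneg _
  have h2 : ∑ j ∈ window E (lam n) (S.Z n ω) i, (e j - p j) ^ 2 ≤
      2 * ∑ j ∈ window E (lam n) (S.Z n ω) i, e j ^ 2 +
        2 * ∑ j ∈ window E (lam n) (S.Z n ω) i, p j ^ 2 := by
    rw [Finset.mul_sum, Finset.mul_sum, ← Finset.sum_add_distrib]
    exact Finset.sum_le_sum fun j _ => by nlinarith [sq_nonneg (e j + p j)]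
  have h3 : e j ^ 2 * (window E (lam n) (S.Z n ω) i).card ≤ e j ^ 2 * (2 * lam n) :=
    mul_le_mul_of_nonneg_left (by linarith) (sq_nonneg _)
  nlinarith

lemma Source.VarBounds.slow_sum_sq_residVar_sub (h : S.VarBounds V c C) (hc : 0 < c)
    (hZ : DesignAssumptions S) (hlam : Tendsto lam atTop atTop)
    (hlam' : Tendsto (fun n : ℕ => (lam n : ℝ) / n) atTop (𝓝 0)) (E : Expert d) :
    Slow μ fun n ω _ =>
    ∑ i, (V.residVar E (lam n) n (S.zg V n ω) i - V.errSmooth E (lam n) n (S.zg V n ω) i) ^ 2 := by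
  have hQ := h.slow_sum_sq_olsFit hc hZ
  have he := h.slow_err hc
  refine Slow.of_exists_le ((((he.mul he).const_mul 8).add (hQ.const_mul 2)).mul
    (hQ.const_mul 4)) ?_
  filter_upwards [eventually_window_length hlam hlam' 1] with n hn
  refine ae_of_all _ fun ω _ => ?_
  set e := V.err n (S.zg V n ω) with he'
  set p := V.errFit n (S.zg V n ω) with hp'
  obtain ⟨j, hj⟩ := exists_sum_mul_le (n := n) (by omega) (a := fun j => p j ^ 2)
    (f := fun j => (p j - 2 * e j) ^ 2) (fun j => sq_nonneg _)
  refine ⟨j, ?_⟩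
  have hQ0 : 0 ≤ ∑ j, p j ^ 2 := Finset.sum_nonneg fun _ _ => sq_nonneg _
  have hpj : p j ^ 2 ≤ ∑ j, p j ^ 2 :=
    Finset.single_le_sum (f := fun j => p j ^ 2) (fun _ _ => sq_nonneg _) (Finset.mem_univ j)
  change _ ≤ |(8 * (e j * e j) + 2 * ∑ i, p i ^ 2) * (4 * ∑ i, p i ^ 2)|
  rw [abs_of_nonneg (Finset.sum_nonneg fun _ _ => sq_nonneg _), 
    abs_of_nonneg (mul_nonneg (by nlinarith [mul_self_nonneg (e j)]) (by positivity))]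
  refine (sum_sq_window_sub_le E (by omega : 0 < lam n) (S.Z n ω) e p).trans ?_
  have h1 : ∑ j, (p j * (p j - 2 * e j)) ^ 2 = ∑ j, p j ^ 2 * (p j - 2 * e j) ^ 2 :=
    Finset.sum_congr rfl fun j _ => mul_pow _ _ _
  have h2 : (p j - 2 * e j) ^ 2 ≤ 8 * (e j * e j) + 2 * ∑ i, p i ^ 2 := by
    nlinarith [sq_nonneg (p j + 2 * e j)]
  rw [h1]
  nlinarith [mul_le_mul_of_nonneg_right h2 hQ0]

lemma Source.VarBounds.slow_sum_sq_scaledResid_sub (h : S.VarBounds V c C) (hc : 0 < c)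
    (hZ : DesignAssumptions S) (hlam : Tendsto lam atTop atTop)
    (hlam' : Tendsto (fun n : ℕ => (lam n : ℝ) / n) atTop (𝓝 0)) (E : Expert d) {K : ℝ}
    (hK : ∀ᶠ n in atTop, ∀ᵐ ω ∂μ,
    OrthogonalCoords (stdNormal (Fin n)) K
      fun g i => (V.errSmooth E (lam n) n (S.Z n ω, g) i)⁻¹ * (V.sd n (S.Z n ω) i * g i)) :
    Slow μ fun n ω _ => ∑ i,
      (√(weight E (lam n) (S.Z n ω) (V.ofStdErr n (S.Z n ω) (S.stdErr V n ω)) i) *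
        wlsResid (S.Z n ω) (weight E (lam n) (S.Z n ω) (V.ofStdErr n (S.Z n ω) (S.stdErr V n ω)))
          (V.ofStdErr n (S.Z n ω) (S.stdErr V n ω)) i -
        √((V.errSmooth E (lam n) n (S.zg V n ω) i)⁻¹) *
          (V.sd n (S.Z n ω) i * S.stdErr V n ω i)) ^ 2 := by
  have he := h.slow_err hc
  have hs := h.slow_inv_errSmooth hc hlam hlam' E
  have hD : Slow μ fun n ω _ => ∑ i,
      (V.residVar E (lam n) n (S.zg V n ω) i - V.errSmooth E (lam n) n (S.zg V n ω) i) ^ 2 *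
        ((V.sd n (S.Z n ω) i * S.stdErr V n ω i) *
          (V.sd n (S.Z n ω) i * S.stdErr V n ω i) * ((V.residVar E (lam n) n (S.zg V n ω) i)⁻¹ *
            ((V.errSmooth E (lam n) n (S.zg V n ω) i)⁻¹ *
              (V.errSmooth E (lam n) n (S.zg V n ω) i)⁻¹))) := by
    refine Slow.of_exists_le (((he.mul he).mul
      ((h.slow_inv_residVar hc hlam hlam' E).mul (hs.mul hs))).mul
      (h.slow_sum_sq_residVar_sub hc hZ hlam hlam' E)) ?_
    filter_upwards [eventually_gt_atTop 0] with n hn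
    refine ae_of_all _ fun ω _ => ?_
    have hpos : ∀ i, 0 ≤ (V.sd n (S.Z n ω) i * S.stdErr V n ω i) *
          (V.sd n (S.Z n ω) i * S.stdErr V n ω i) * ((V.residVar E (lam n) n (S.zg V n ω) i)⁻¹ *
            ((V.errSmooth E (lam n) n (S.zg V n ω) i)⁻¹ *
              (V.errSmooth E (lam n) n (S.zg V n ω) i)⁻¹)) := fun i =>
      mul_nonneg (mul_self_nonneg _) (mul_nonneg (inv_nonneg.2 (V.residVar_nonneg _ _ _ _ _))
        (mul_self_nonneg _))
    obtain ⟨j, hj⟩ := exists_sum_mul_le hn (fun i => sq_nonneg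
      (V.residVar E (lam n) n (S.zg V n ω) i - V.errSmooth E (lam n) n (S.zg V n ω) i))
      (f := fun i => (V.sd n (S.Z n ω) i * S.stdErr V n ω i) *
          (V.sd n (S.Z n ω) i * S.stdErr V n ω i) * ((V.residVar E (lam n) n (S.zg V n ω) i)⁻¹ *
            ((V.errSmooth E (lam n) n (S.zg V n ω) i)⁻¹ *
              (V.errSmooth E (lam n) n (S.zg V n ω) i)⁻¹)))
    refine ⟨j, ?_⟩
    rw [abs_of_nonneg (Finset.sum_nonneg fun i _ => mul_nonneg (sq_nonneg _) (hpos i)),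
      abs_of_nonneg (mul_nonneg (hpos j) (Finset.sum_nonneg fun _ _ => sq_nonneg _))]
    exact hj
  have hF := h.slow_sum_sq_wlsFit hc hZ (B := fun n p i =>
    (V.errSmooth E (lam n) n p i)⁻¹ * (V.sd n p.1 i * p.2 i)) (fun n i =>
      (V.measurable_errSmooth E (lam n) n i).inv.mul
        ((V.measurable_sd i measurable_fst).mul (by fun_prop))) hK
  refine Slow.of_exists_le ((hD.const_mul 6).add
    (((h.slow_residVar hc hZ hlam hlam' E).mul hF).const_mul 4)) ?_
  filter_upwards [eventually_gt_atTop 0, h.ae_pos hc hlam hlam' E, hZ.posDef] with n hn h1 h2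
  filter_upwards [h1, h2] with ω hpos hz i
  obtain ⟨j, -, hj⟩ := Finset.exists_max_image Finset.univ
    (V.residVar E (lam n) n (S.zg V n ω)) ⟨⟨0, hn⟩, Finset.mem_univ _⟩
  refine ⟨j, ?_⟩
  rw [abs_of_nonneg (Finset.sum_nonneg fun _ _ => sq_nonneg _)]
  refine le_trans ?_ (le_abs_self _)
  rw [V.weight_ofStdErr E (lam n) n hz]
  have hw : ∀ i, 0 < (V.residVar E (lam n) n (S.zg V n ω) i)⁻¹ := fun i => inv_pos.2 (hpos i).1
  have hres : wlsResid (S.Z n ω) (fun i => (V.residVar E (lam n) n (S.zg V n ω) i)⁻¹)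
      (V.ofStdErr n (S.Z n ω) (S.stdErr V n ω)) =
      wlsResid (S.Z n ω) (fun i => (V.residVar E (lam n) n (S.zg V n ω) i)⁻¹)
        (fun i => V.sd n (S.Z n ω) i * S.stdErr V n ω i) :=
    wlsResid_add (isUnit_det_weighted hz hw) V.coef _
  rw [hres]
  refine (sum_sq_scaled_resid_sub_le hz hw (fun i => inv_pos.2 (hpos i).2) (hpos j).1
    (fun i => ?_) _).trans (le_of_eq ?_)
  · rw [inv_mul_eq_div, one_le_div (hpos i).1]
    exact hj i (Finset.mem_univ i)
  · congr 2
    refine Finset.sum_congr rfl fun i _ => ?_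
    have h3 := (hpos i).1.ne'
    have h4 := (hpos i).2.ne'
    field_simp
    ring

end Bounds

lemma isOracle_weighted [IsProbabilityMeasure μ] {S : Source μ d q} {V : Node d q} {lam : ℕ → ℕ}
    {E : Expert d}
    (hE : ∀ (lam n : ℕ) (z : Fin n → Fin d → ℝ) (x : Fin n → ℝ), scaledResid E lam z x =
      fun i => √(weight E lam z x i) * wlsResid z (weight E lam z x) x i)
    (hlam : Tendsto lam atTop atTop) (hlam' : Tendsto (fun n : ℕ => (lam n : ℝ) / n) atTop (𝓝 0))
    (hZ : DesignAssumptions S) (hV : NodeAssumptions S V E lam) :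
    ∃ s K H, IsOracle S V E lam s K H := by
  obtain ⟨c, C, hc, hcC, h⟩ := hV.exists_varBounds
  obtain ⟨K, -, L, hK⟩ := exists_orthogonalCoords_standardized d hc hcC
  obtain ⟨K', hK'0, L', hK'⟩ := exists_lintegral_standardized_sub_sq_le d hc hcC
  have horth : ∀ᶠ n in atTop, ∀ᵐ ω ∂μ,
      OrthogonalCoords (stdNormal (Fin n)) K (fun g i =>
        √((V.errSmooth E (lam n) n (S.Z n ω, g) i)⁻¹) * (V.sd n (S.Z n ω) i * g i)) ∧
      OrthogonalCoords (stdNormal (Fin n)) K (fun g i =>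
        (V.errSmooth E (lam n) n (S.Z n ω, g) i)⁻¹ * (V.sd n (S.Z n ω) i * g i)) := by
    filter_upwards [eventually_window_length hlam hlam' L] with n hn
    filter_upwards [h n] with ω hω
    exact hK (lam n) hn.1 n hn.2 E (S.Z n ω) (V.sd n (S.Z n ω))
      (fun j => by rw [V.sd_sq]; exact (hω j).1) (fun j => by rw [V.sd_sq]; exact (hω j).2)
  have hmeas : ∀ n i, Measurable fun p : (Fin n → Fin d → ℝ) × (Fin n → ℝ) =>
      √((V.errSmooth E (lam n) n p i)⁻¹) * (V.sd n p.1 i * p.2 i) := fun n i =>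
    (V.measurable_errSmooth E (lam n) n i).inv.sqrt.mul
      ((V.measurable_sd i measurable_fst).mul (by fun_prop))
  refine ⟨1, K, fun n p i => √((V.errSmooth E (lam n) n p i)⁻¹) * (V.sd n p.1 i * p.2 i),
    one_pos, hmeas, ?_, ?_, ?_⟩
  · filter_upwards [horth] with n hn
    filter_upwards [hn] with ω hω using hω.1
  · simp only [hE, one_mul]
    refine h.slow_sum_sq_scaledResid_sub hc hZ hlam hlam' E (K := K) ?_
    filter_upwards [horth] with n hn
    filter_upwards [hn] with ω hω using hω.2
  · refine negligible_of_condLIntegral_le (ζ := fun n ω => S.Z n ω)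
      (η := fun n ω => S.stdErr V n ω) (ν := fun n => stdNormal (Fin n))
      (Eventually.of_forall fun n => h.hasProdLaw hc n)
      (F := fun n p => (n : ℝ)⁻¹ * ∑ i, (√((V.errSmooth E (lam n) n p i)⁻¹) *
        (V.sd n p.1 i * p.2 i) - p.2 i) ^ 2)
      (b := fun n z => K' * √((lam n : ℝ)⁻¹ + V.smoothingBias E (lam n) n z))
      (Eventually.of_forall fun n => ?_) (fun n p => ?_) (Eventually.of_forall fun n => ?_) ?_ ?_
    · refine (Finset.measurable_sum _ fun i _ => ?_).const_mul _
      exact ((hmeas n i).sub (by fun_prop)).pow_const 2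
    · exact mul_nonneg (by positivity) (Finset.sum_nonneg fun _ _ => sq_nonneg _)
    · have hm : ∀ i, Measurable fun z : Fin n → Fin d → ℝ => V.errVar n i (z i) := fun i => by
        simp_rw [← V.sd_sq]
        exact (V.measurable_sd i measurable_id).pow_const 2
      refine ((Measurable.add measurable_const ?_).sqrt).const_mul _
      refine (Finset.measurable_sum _ fun i _ => ?_).const_mul _
      exact (((measurable_sum_window E (lam n) measurable_id hm i).const_mul _).sub (hm i)).abs
    · filter_upwards [eventually_window_length hlam hlam' L'] with n hn
      filter_upwards [h n] with ω hω
      have h1 : V.smoothingBias E (lam n) n (S.Z n ω) =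
          meanBias E (lam n) (S.Z n ω) (V.sd n (S.Z n ω)) := by
        simp only [Node.smoothingBias, meanBias, V.sd_sq]
      rw [h1]
      exact hK' (lam n) hn.1 n hn.2 E (S.Z n ω) (V.sd n (S.Z n ω)) (V.sd_nonneg n _)
        (fun j => by rw [V.sd_sq]; exact (hω j).1) (fun j => by rw [V.sd_sq]; exact (hω j).2)
    · have h1 := negligible_iff_tendstoInMeasure.2 hV.smoothing
      simp only [sub_zero] at h1
      exact ((Negligible.of_tendsto ((tendsto_inv_atTop_zero.comp
        tendsto_natCast_atTop_atTop).comp hlam)).add h1).sqrt.const_mul K'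

lemma exists_isOracle [IsProbabilityMeasure μ] {S : Source μ d q} {V : Node d q} {lam : ℕ → ℕ}
    {E : Expert d} (hlam : Tendsto lam atTop atTop)
    (hlam' : Tendsto (fun n : ℕ => (lam n : ℝ) / n) atTop (𝓝 0))
    (hZ : DesignAssumptions S) (hV : NodeAssumptions S V E lam) :
    ∃ s K H, IsOracle S V E lam s K H := by
  match E, hV with
  | .homoskedastic, hV => exact isOracle_homoskedastic hZ hV
  | .samplingIndex, hV => exact isOracle_weighted (fun _ _ _ _ => rfl) hlam hlam' hZ hV
  | .predictor m, hV => exact isOracle_weighted (fun _ _ _ _ => rfl) hlam hlam' hZ hV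

end WeightedOracle

/-! ### Conditional independence and the conditional correlation -/

section NullHypothesis

section General

variable {Ω A B C : Type*} [MeasurableSpace Ω] [MeasurableSpace A] [MeasurableSpace B]
  [MeasurableSpace C] {μ : Measure Ω} {ζ : Ω → A} {η : Ω → B} {ν : Measure B}
  [IsProbabilityMeasure ν]

/-- The law of `f (z, η)`, if `η` has the law `ν`, as a kernel in `z`. -/
def sectionKernel (ν : Measure B) (f : A × B → C) : Kernel A C :=
  (Kernel.id ×ₖ Kernel.const A ν).map f

lemma sectionKernel_apply {f : A × B → C} (hf : Measurable f) (z : A) :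
    sectionKernel ν f z = ν.map fun y => f (z, y) := by
  rw [sectionKernel, Kernel.map_apply _ hf, Kernel.prod_apply, Kernel.id_apply, Kernel.const_apply,
    Measure.dirac_prod, Measure.map_map hf measurable_prodMk_left]
  rfl

lemma isMarkovKernel_sectionKernel {f : A × B → C} (hf : Measurable f) :
    IsMarkovKernel (sectionKernel ν f) :=
  Kernel.IsMarkovKernel.map _ hf

variable [IsProbabilityMeasure μ]

lemma HasProdLaw.condDistrib_eq [StandardBorelSpace C] [Nonempty C] (h : HasProdLaw ζ η ν μ)
    {f : A × B → C} (hf : Measurable f) :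
    condDistrib (fun ω => f (ζ ω, η ω)) ζ μ =ᵐ[μ.map ζ] sectionKernel ν f := by
  have := isMarkovKernel_sectionKernel (ν := ν) hf
  have hζ := h.measurable_fst
  have hη := h.measurable_snd
  have hm : Measurable fun ω => (ζ ω, f (ζ ω, η ω)) := by fun_prop
  have := Measure.isProbabilityMeasure_map (μ := μ) hζ.aemeasurable
  refine condDistrib_ae_eq_of_measure_eq_compProd _ (by fun_prop) ?_
  ext s hs
  rw [Measure.compProd_apply hs, lintegral_map (Kernel.measurable_kernel_prodMk_left hs) hζ,
    ← lintegral_indicator_one hs, lintegral_map (measurable_one.indicator hs) hm,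
    h.lintegral_eq (F := fun p => s.indicator 1 (p.1, f p))
      ((measurable_one.indicator hs).comp (_root_.measurable_fst.prodMk hf))]
  refine lintegral_congr fun ω => ?_
  have hs' : MeasurableSet (Prod.mk (ζ ω) ⁻¹' s) := measurable_prodMk_left hs
  have hfω : Measurable fun y => f (ζ ω, y) := hf.comp measurable_prodMk_left
  rw [sectionKernel_apply hf, Measure.map_apply hfω hs', ← lintegral_indicator_one (hfω hs')]
  rfl

lemma HasProdLaw.ae_indepFun [StandardBorelSpace Ω] (h : HasProdLaw ζ η ν μ) {f g : A × B → ℝ}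
    (hf : Measurable f) (hg : Measurable g)
    (hfg : CondIndepFun (MeasurableSpace.comap ζ inferInstance) h.measurable_fst.comap_le
      (fun ω => f (ζ ω, η ω)) (fun ω => g (ζ ω, η ω)) μ) :
    ∀ᵐ ω ∂μ, IndepFun (fun y => f (ζ ω, y)) (fun y => g (ζ ω, y)) ν := by
  have hζ := h.measurable_fst
  have hη := h.measurable_snd
  have h1 := (condIndepFun_iff_map_prod_eq_prod_condDistrib_prod_condDistrib
    (by fun_prop) (by fun_prop) hζ).1 hfg
  rw [← Measure.compProd_eq_comp_prod] at h1
  have h2 := condDistrib_ae_eq_of_measure_eq_compProd ζ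
    (Y := fun ω => (f (ζ ω, η ω), g (ζ ω, η ω))) (by fun_prop) h1
  have h3 := ((h.condDistrib_eq (hf.prodMk hg)).symm.trans h2)
  have h4 : ∀ᵐ z ∂μ.map ζ, IndepFun (fun y => f (z, y)) (fun y => g (z, y)) ν := by
    filter_upwards [h3, h.condDistrib_eq hf, h.condDistrib_eq hg] with z hz hzf hzg
    have hfz : Measurable fun y => f (z, y) := hf.comp measurable_prodMk_left
    have hgz : Measurable fun y => g (z, y) := hg.comp measurable_prodMk_left
    rw [indepFun_iff_map_prod_eq_prod_map_map hfz.aemeasurable hgz.aemeasurable]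
    rw [sectionKernel_apply (hf.prodMk hg), Kernel.prod_apply, hzf, hzg, sectionKernel_apply hf,
      sectionKernel_apply hg] at hz
    exact hz
  exact ae_of_ae_map hζ.aemeasurable h4

end General

lemma covariance_linear_stdNormal {ι : Type*} [Fintype ι] [DecidableEq ι] (a b : ι → ℝ)
    (x y : ℝ) : covariance (fun g : ι → ℝ => x + ∑ i, a i * g i)
      (fun g => y + ∑ i, b i * g i) (stdNormal ι) = ∑ i, a i * b i := by
  have hm : ∀ i, MemLp (fun g : ι → ℝ => g i) 2 (stdNormal ι) := fun i =>
    (memLp_two_iff_integrable_sq (measurable_pi_apply i).aestronglyMeasurable).2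
      (integrable_pow_stdNormal 2 i)
  have hc : ∀ i j, covariance (fun g : ι → ℝ => g i) (fun g => g j) (stdNormal ι) =
      if i = j then 1 else 0 := by
    intro i j
    have h0 : ∀ i, ∫ g, g i ∂stdNormal ι = 0 := fun i =>
      integral_eq_zero_of_odd i (measurable_pi_apply i) (fun g => by simp)
    rw [covariance_eq_sub (hm i) (hm j), h0, h0, zero_mul, sub_zero]
    split_ifs with hij
    · subst hij
      simp only [Pi.mul_apply, ← sq]
      exact integral_sq_stdNormal i
    · refine integral_eq_zero_of_odd i (by fun_prop) fun g => ?_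
      simp [Ne.symm hij]
  have hma : ∀ (a : ι → ℝ) i, MemLp (fun g : ι → ℝ => a i * g i) 2 (stdNormal ι) := fun a i =>
    (hm i).const_mul (a i)
  rw [covariance_const_add_left ((memLp_finsetSum _ fun i _ => hma a i).integrable (by norm_num)),
    covariance_const_add_right ((memLp_finsetSum _ fun i _ => hma b i).integrable (by norm_num)),
    covariance_fun_sum_fun_sum (hma a) (hma b)]
  simp [covariance_const_mul_left, covariance_const_mul_right, hc, mul_comm]

variable {Ω : Type*} [MeasurableSpace Ω] {μ : Measure Ω} [IsProbabilityMeasure μ] {d q : ℕ}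

lemma Source.hasProdLaw_sample (S : Source μ d q) (n : ℕ) (i : Fin n) :
    HasProdLaw (fun ω => S.Z n ω i) (fun ω (p : Fin n × Fin q) => S.N n ω p.1 p.2)
      (stdNormal (Fin n × Fin q)) μ := by
  have h := S.hasProdLaw_noise n
  have hZ := h.measurable_fst
  have hN := h.measurable_snd
  have := Measure.isProbabilityMeasure_map (μ := μ) hZ.aemeasurable
  refine ⟨by fun_prop, hN, ?_⟩
  have h1 := congrArg (Measure.map (Prod.map (fun z : Fin n → Fin d → ℝ => z i)
    (id : (Fin n × Fin q → ℝ) → _))) h.map_eq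
  rw [Measure.map_map (by fun_prop) (hZ.prodMk hN),
    ← Measure.map_prod_map _ _ (by fun_prop) measurable_id, Measure.map_id,
    Measure.map_map (by fun_prop) (by fun_prop)] at h1
  exact h1

lemma CondIndepNodes.condCorr_eq_zero [StandardBorelSpace Ω] {S : Source μ d q} {V W : Node d q}
    (h : CondIndepNodes S V W) (n : ℕ) : ∀ᵐ ω ∂μ, ∀ i, condCorr V W n i (S.Z n ω i) = 0 := by
  rw [ae_all_iff]
  intro i
  have hm : ∀ V : Node d q, Measurable fun p : (Fin d → ℝ) × (Fin n × Fin q → ℝ) =>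
      ∑ k, p.1 k * V.coef k + ∑ l, V.load n i l p.1 * p.2 (i, l) := fun V => by fun_prop
  filter_upwards [(S.hasProdLaw_sample n i).ae_indepFun (hm V) (hm W) (h n i)] with ω hω
  have hlin : ∀ V : Node d q, (fun N : Fin n × Fin q → ℝ => ∑ k, S.Z n ω i k * V.coef k +
      ∑ l, V.load n i l (S.Z n ω i) * N (i, l)) = fun N => ∑ k, S.Z n ω i k * V.coef k +
      ∑ p : Fin n × Fin q, (if i = p.1 then V.load n i p.2 (S.Z n ω i) else 0) * N p := by
    intro V
    ext N
    rw [Fintype.sum_prod_type, Finset.sum_eq_single i]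
    · simp
    · intro j _ hj
      simp [hj.symm]
    · simp
  simp only [hlin] at hω
  have hmem : ∀ (x : ℝ) (a : Fin n × Fin q → ℝ), MemLp (fun N : Fin n × Fin q → ℝ =>
      x + ∑ p, a p * N p) 2 (stdNormal (Fin n × Fin q)) := fun x a =>
    (memLp_const x).add (memLp_finsetSum _ fun p _ =>
      ((memLp_two_iff_integrable_sq (measurable_pi_apply p).aestronglyMeasurable).2
        (integrable_pow_stdNormal 2 p)).const_mul (a p))
  have h1 := hω.covariance_eq_zero (hmem _ _) (hmem _ _)
  rw [covariance_linear_stdNormal, Fintype.sum_prod_type, Finset.sum_eq_single i] at h1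
  · simp only [if_true] at h1
    rw [condCorr, h1, zero_div]
  · intro j _ hj
    simp [hj.symm]
  · simp

end NullHypothesis

/-! ### Consistency of the estimated partial correlation -/

section LawOfLargeNumbers

section Rows

variable {J ι : Type*} [Fintype J] [DecidableEq ι]

lemma integrable_pow_gaussianReal (p : ℕ) : Integrable (fun x => x ^ p) (gaussianReal 0 1) := by
  have h := (memLp_id_gaussianReal (μ := 0) (v := 1) p).integrable_norm_pow'
  refine h.mono' (Measurable.aestronglyMeasurable (by fun_prop)) (ae_of_all _ fun x => ?_)
  simp

lemma integrable_pow_linear {v : J → ℝ} (hv : ∑ p, v p ^ 2 = 1) (k : ℕ) :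
    Integrable (fun N : J → ℝ => (∑ p, v p * N p) ^ k) (stdNormal J) :=
  (measurePreserving_unit v hv).integrable_comp_of_integrable (integrable_pow_gaussianReal k)

lemma integral_pow_linear {v : J → ℝ} (hv : ∑ p, v p ^ 2 = 1) (k : ℕ) :
    ∫ N, (∑ p, v p * N p) ^ k ∂stdNormal J = ∫ x, x ^ k ∂gaussianReal 0 1 := by
  rw [← (measurePreserving_unit v hv).map_eq,
    integral_map (measurePreserving_unit v hv).measurable.aemeasurable
      (Measurable.aestronglyMeasurable (by fun_prop))]

/-- Products of two linear forms in the rows of an array of standard Gaussian variables. -/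
lemma orthogonalCoords_mul_linear [DecidableEq J] (row : J → ι) {v w : ι → J → ℝ}
    (hv : ∀ i, ∑ p, v i p ^ 2 = 1) (hw : ∀ i, ∑ p, w i p ^ 2 = 1)
    (hv0 : ∀ i p, row p ≠ i → v i p = 0) (hw0 : ∀ i p, row p ≠ i → w i p = 0) :
    OrthogonalCoords (stdNormal J) (2 * ∫ x, x ^ 4 ∂gaussianReal 0 1 + 2) fun N i =>
      (∑ p, v i p * N p) * (∑ p, w i p * N p) - ∑ p, v i p * w i p := by
  have hcs : ∀ i, (∑ p, v i p * w i p) ^ 2 ≤ 1 := fun i => by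
    have := Finset.sum_mul_sq_le_sq_mul_sq Finset.univ (v i) (w i)
    rwa [hv, hw, one_mul] at this
  have hbound : ∀ i (N : J → ℝ), ((∑ p, v i p * N p) * (∑ p, w i p * N p) -
      ∑ p, v i p * w i p) ^ 2 ≤ (∑ p, v i p * N p) ^ 4 + (∑ p, w i p * N p) ^ 4 + 2 := by
    intro i N
    generalize ∑ p, v i p * N p = x
    generalize ∑ p, w i p * N p = y
    have := hcs i
    generalize ∑ p, v i p * w i p = r at *
    nlinarith [sq_nonneg (x * y + r), sq_nonneg (x ^ 2 - y ^ 2)]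
  have hdom : ∀ i, Integrable (fun N : J → ℝ => (∑ p, v i p * N p) ^ 4 + (∑ p, w i p * N p) ^ 4 + 2)
      (stdNormal J) := fun i =>
    ((integrable_pow_linear (hv i) 4).add (integrable_pow_linear (hw i) 4)).add
      (integrable_const _)
  have hint : ∀ i, Integrable (fun N : J → ℝ => ((∑ p, v i p * N p) * (∑ p, w i p * N p) -
      ∑ p, v i p * w i p) ^ 2) (stdNormal J) := fun i =>
    (hdom i).mono' (Measurable.aestronglyMeasurable (by fun_prop)) (ae_of_all _ fun N => by
      rw [Real.norm_eq_abs, abs_of_nonneg (sq_nonneg _)]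
      exact hbound i N)
  have hmem : ∀ i, MemLp (fun N : J → ℝ => (∑ p, v i p * N p) * (∑ p, w i p * N p) -
      ∑ p, v i p * w i p) 2 (stdNormal J) := fun i =>
    (memLp_two_iff_integrable_sq (Measurable.aestronglyMeasurable (by fun_prop))).2 (hint i)
  have hmemlin : ∀ {v : J → ℝ}, ∑ p, v p ^ 2 = 1 →
      MemLp (fun N : J → ℝ => ∑ p, v p * N p) 2 (stdNormal J) := fun hv =>
    (memLp_two_iff_integrable_sq (Measurable.aestronglyMeasurable (by fun_prop))).2
      (integrable_pow_linear hv 2)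
  have hmean : ∀ i, ∫ N, ((∑ p, v i p * N p) * (∑ p, w i p * N p) - ∑ p, v i p * w i p)
      ∂stdNormal J = 0 := by
    intro i
    have h1 : ∀ {v : J → ℝ}, ∑ p, v p ^ 2 = 1 → ∫ N, ∑ p, v p * N p ∂stdNormal J = 0 := by
      intro v hv
      have := integral_pow_linear hv 1
      simpa using this
    have h2 := covariance_linear_stdNormal (v i) (w i) 0 0
    simp only [zero_add] at h2
    rw [covariance_eq_sub (hmemlin (hv i)) (hmemlin (hw i)), h1 (hv i), zero_mul, sub_zero] at h2
    have h3 : Integrable (fun N : J → ℝ => (∑ p, v i p * N p) * (∑ p, w i p * N p))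
        (stdNormal J) := (hmemlin (hv i)).integrable_mul (hmemlin (hw i))
    simp only [Pi.mul_apply] at h2
    rw [integral_sub h3 (integrable_const _), h2]
    simp
  refine ⟨hmem, fun i j hij => ?_, fun i => ?_⟩
  · have hiI : iIndepFun (fun (p : J) (N : J → ℝ) => N p) (stdNormal J) :=
      iIndepFun_pi (μ := fun _ : J => gaussianReal 0 1) (X := fun _ x => x) (fun _ => by fun_prop)
    have hdisj : Disjoint (Finset.univ.filter fun p => row p = i)
        (Finset.univ.filter fun p => row p = j) := by
      rw [Finset.disjoint_filter]
      intro p _ h1 h2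
      exact hij (h1.symm.trans h2)
    have hind := hiI.indepFun_finset _ _ hdisj (fun p => measurable_pi_apply p)
    have hsum : ∀ (i : ι) (v : J → ℝ), (∀ p, row p ≠ i → v p = 0) → ∀ N : J → ℝ,
        ∑ p, v p * N p = ∑ p : (Finset.univ.filter fun p => row p = i), v p * N p := by
      intro i v hv N
      rw [Finset.sum_coe_sort _ (fun p => v p * N p), Finset.sum_filter]
      refine Finset.sum_congr rfl fun p _ => ?_
      split_ifs with h
      · rfl
      · rw [hv p h, zero_mul]
    have hind2 := hind.comp
      (φ := fun y => (∑ p, v i p.1 * y p) * (∑ p, w i p.1 * y p) - ∑ p, v i p * w i p)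
      (ψ := fun y => (∑ p, v j p.1 * y p) * (∑ p, w j p.1 * y p) - ∑ p, v j p * w j p)
      (by fun_prop) (by fun_prop)
    have hind3 : IndepFun (fun N : J → ℝ => (∑ p, v i p * N p) * (∑ p, w i p * N p) -
        ∑ p, v i p * w i p) (fun N : J → ℝ => (∑ p, v j p * N p) * (∑ p, w j p * N p) -
        ∑ p, v j p * w j p) (stdNormal J) := by
      convert hind2 using 1
      · ext N
        simp only [Function.comp]
        rw [hsum i _ (hv0 i), hsum i _ (hw0 i)]
      · ext N
        simp only [Function.comp]
        rw [hsum j _ (hv0 j), hsum j _ (hw0 j)]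
    rw [hind3.integral_fun_mul_eq_mul_integral (hmem i).aestronglyMeasurable
      (hmem j).aestronglyMeasurable, hmean, zero_mul]
  · refine (integral_mono (hint i) (hdom i) (hbound i)).trans (le_of_eq ?_)
    have h1 : Integrable (fun N : J → ℝ => (∑ p, v i p * N p) ^ 4 + (∑ p, w i p * N p) ^ 4)
        (stdNormal J) := (integrable_pow_linear (hv i) 4).add (integrable_pow_linear (hw i) 4)
    rw [integral_add h1 (integrable_const _), integral_add (integrable_pow_linear (hv i) 4)
      (integrable_pow_linear (hw i) 4), integral_pow_linear (hv i), integral_pow_linear (hw i)]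
    simp
    ring

end Rows

variable {Ω : Type*} [MeasurableSpace Ω] {μ : Measure Ω} [IsProbabilityMeasure μ] {d q : ℕ}

lemma Source.VarBounds.sum_unitLoad_sq {V : Node d q} {n : ℕ} {z : Fin n → Fin d → ℝ}
    (h : ∀ i, 0 < V.errVar n i (z i)) (i : Fin n) : ∑ p, V.unitLoad n z i p ^ 2 = 1 := by
  simp only [sq]
  rw [V.sum_unitLoad_mul_unitLoad, if_pos rfl, V.condCorr_self n i (h i)]

lemma Node.measurable_condCorr (V W : Node d q) (n : ℕ) (i : Fin n) :
    Measurable fun z : Fin d → ℝ => condCorr V W n i z := by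
  unfold condCorr Node.errVar
  have := V.measurable_load n i
  have := W.measurable_load n i
  fun_prop

/-- The averages of the products of the standardized errors of two nodes are asymptotically equal
to the averages of their conditional correlations. -/
lemma negligible_mean_mul_stdErr {S : Source μ d q} {V W : Node d q} {c C c' C' : ℝ}
    (hV : S.VarBounds V c C) (hc : 0 < c) (hW : S.VarBounds W c' C') (hc' : 0 < c') :
    Negligible μ fun n ω => (n : ℝ)⁻¹ * ∑ i, S.stdErr V n ω i * S.stdErr W n ω i -
      (n : ℝ)⁻¹ * ∑ i, condCorr V W n i (S.Z n ω i) := by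
  set K := 2 * ∫ x, x ^ 4 ∂gaussianReal 0 1 + 2 with hK
  have hmV := fun n => V.measurable_stdErr n
  have hmW := fun n => W.measurable_stdErr n
  have hsq : Negligible μ fun n ω => ((n : ℝ)⁻¹ * ∑ i, S.stdErr V n ω i * S.stdErr W n ω i -
      (n : ℝ)⁻¹ * ∑ i, condCorr V W n i (S.Z n ω i)) ^ 2 := by
    refine negligible_of_condLIntegral_le (ζ := fun n ω => S.Z n ω)
      (η := fun n ω (p : Fin n × Fin q) => S.N n ω p.1 p.2)
      (ν := fun n => stdNormal (Fin n × Fin q))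
      (Eventually.of_forall fun n => S.hasProdLaw_noise n)
      (F := fun n p => ((n : ℝ)⁻¹ * ∑ i, V.stdErr n p.1 p.2 i * W.stdErr n p.1 p.2 i -
        (n : ℝ)⁻¹ * ∑ i, condCorr V W n i (p.1 i)) ^ 2)
      (b := fun n _ => K * (n : ℝ)⁻¹) (Eventually.of_forall fun n => ?_)
      (fun n p => sq_nonneg _) (Eventually.of_forall fun n => measurable_const) ?_ ?_
    · have h1 : ∀ i, Measurable fun p : (Fin n → Fin d → ℝ) × (Fin n × Fin q → ℝ) =>
          V.stdErr n p.1 p.2 i := fun i => (measurable_pi_apply i).comp (hmV n)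
      have h2 : ∀ i, Measurable fun p : (Fin n → Fin d → ℝ) × (Fin n × Fin q → ℝ) =>
          W.stdErr n p.1 p.2 i := fun i => (measurable_pi_apply i).comp (hmW n)
      have h3 : ∀ i, Measurable fun p : (Fin n → Fin d → ℝ) × (Fin n × Fin q → ℝ) =>
          condCorr V W n i (p.1 i) := fun i => (V.measurable_condCorr W n i).comp (by fun_prop)
      fun_prop
    · filter_upwards [eventually_gt_atTop 0] with n hn
      filter_upwards [hV n, hW n] with ω h1 h2
      have h := (orthogonalCoords_mul_linear (Prod.fst : Fin n × Fin q → Fin n)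
        (fun i => Source.VarBounds.sum_unitLoad_sq (fun i => hc.trans_le (h1 i).1) i)
        (fun i => Source.VarBounds.sum_unitLoad_sq (fun i => hc'.trans_le (h2 i).1) i)
        (fun i p hp => if_neg (Ne.symm hp)) (fun i p hp => if_neg (Ne.symm hp))).lintegral_sq_le
        fun _ => (n : ℝ)⁻¹
      refine le_trans (le_of_eq ?_) (h.trans (ENNReal.ofReal_le_ofReal (le_of_eq ?_)))
      · refine lintegral_congr fun N => ?_
        congr 2
        simp only [Node.sum_unitLoad_mul_unitLoad, if_true, ← Node.stdErr_eq]
        rw [← mul_sub, ← Finset.sum_sub_distrib, Finset.mul_sum]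
      · have : (n : ℝ) ≠ 0 := by exact_mod_cast hn.ne'
        simp only [Finset.sum_const, Finset.card_univ, Fintype.card_fin, nsmul_eq_mul]
        rw [← hK]
        field_simp
    · exact (Negligible.of_tendsto (tendsto_inv_atTop_zero.comp
        tendsto_natCast_atTop_atTop)).const_mul K
  refine hsq.sqrt.of_abs_le (Eventually.of_forall fun n => ae_of_all _ fun ω => ?_)
  rw [Real.sqrt_sq_eq_abs, abs_abs]

end LawOfLargeNumbers

section Consistency

lemma corr_const_mul {n : ℕ} {s t : ℝ} (hs : 0 < s) (ht : 0 < t) (r x : Fin n → ℝ) :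
    corr (fun i => s * r i) (fun i => t * x i) = corr r x := by
  have h1 : ∀ {s : ℝ}, 0 < s → ∀ r : Fin n → ℝ, √((n : ℝ)⁻¹ * ∑ i, (s * r i) ^ 2) =
      s * √((n : ℝ)⁻¹ * ∑ i, r i ^ 2) := by
    intro s hs r
    simp only [mul_pow, ← Finset.mul_sum]
    rw [mul_left_comm, Real.sqrt_mul (sq_nonneg s), Real.sqrt_sq hs.le]
  have h2 : ∑ i, s * r i * (t * x i) = s * t * ∑ i, r i * x i := by
    rw [Finset.mul_sum]
    exact Finset.sum_congr rfl fun i _ => by ring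
  rw [corr, h1 hs, h1 ht, h2, mul_left_comm (n : ℝ)⁻¹ (s * t),
    mul_mul_mul_comm s √((n : ℝ)⁻¹ * ∑ i, r i ^ 2),
    mul_div_mul_left _ _ (mul_pos hs ht).ne']
  rfl

lemma abs_mean_mul_le {n : ℕ} (x y : Fin n → ℝ) :
    |(n : ℝ)⁻¹ * ∑ i, x i * y i| ≤ √((n : ℝ)⁻¹ * ∑ i, x i ^ 2) * √((n : ℝ)⁻¹ * ∑ i, y i ^ 2) := by
  have hn : (0 : ℝ) ≤ (n : ℝ)⁻¹ := by positivity
  rw [← Real.sqrt_mul (mul_nonneg hn (Finset.sum_nonneg fun _ _ => sq_nonneg _))]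
  refine Real.abs_le_sqrt ?_
  rw [mul_pow, mul_mul_mul_comm, ← sq]
  exact mul_le_mul_of_nonneg_left (Finset.sum_mul_sq_le_sq_mul_sq _ _ _) (sq_nonneg _)

variable {Ω : Type*} [MeasurableSpace Ω] {μ : Measure Ω}

lemma Negligible.mean_mul {x y : ∀ n : ℕ, Ω → Fin n → ℝ} {c : ℝ}
    (hx : Negligible μ fun n ω => (n : ℝ)⁻¹ * ∑ i, x n ω i ^ 2)
    (hy : Negligible μ fun n ω => (n : ℝ)⁻¹ * ∑ i, y n ω i ^ 2 - c) :
    Negligible μ fun n ω => (n : ℝ)⁻¹ * ∑ i, x n ω i * y n ω i := by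
  have h := Negligible.comp₂ (F := fun a b => √a * √b) (a := 0) (b := c) (μ := μ)
    (by fun_prop) (by simpa using hx) hy
  simp only [Real.sqrt_zero, zero_mul, sub_zero] at h
  exact h.of_abs_le (Eventually.of_forall fun n => ae_of_all _ fun ω =>
    (abs_mean_mul_le _ _).trans (le_abs_self _))

/-- Averages of products do not change asymptotically if the factors are replaced by factors that
are close in mean square. -/
lemma Negligible.mean_mul_sub {x y g h : ∀ n : ℕ, Ω → Fin n → ℝ} {c c' : ℝ}
    {m : ℕ → Ω → ℝ}
    (hx : Negligible μ fun n ω => (n : ℝ)⁻¹ * ∑ i, (x n ω i - g n ω i) ^ 2)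
    (hy : Negligible μ fun n ω => (n : ℝ)⁻¹ * ∑ i, (y n ω i - h n ω i) ^ 2)
    (hg : Negligible μ fun n ω => (n : ℝ)⁻¹ * ∑ i, g n ω i ^ 2 - c)
    (hh : Negligible μ fun n ω => (n : ℝ)⁻¹ * ∑ i, h n ω i ^ 2 - c')
    (hgh : Negligible μ fun n ω => (n : ℝ)⁻¹ * ∑ i, g n ω i * h n ω i - m n ω) :
    Negligible μ fun n ω => (n : ℝ)⁻¹ * ∑ i, x n ω i * y n ω i - m n ω := by
  have h1 := hx.mean_mul (y := fun n ω i => y n ω i - h n ω i) (c := 0) (by simpa using hy)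
  refine ((h1.add (hx.mean_mul hh)).add ((hy.mean_mul hg).add hgh)).of_abs_le
    (Eventually.of_forall fun n => ae_of_all _ fun ω => le_of_eq ?_)
  congr 1
  simp only [← add_sub_assoc, ← mul_add, ← Finset.sum_add_distrib]
  congr 3
  ext i
  ring

variable {d q : ℕ} {S : Source μ d q} {V W : Node d q}
  {E F : Expert d} {lam : ℕ → ℕ} {s t K L : ℝ}
  {H H' : ∀ n, (Fin n → Fin d → ℝ) × (Fin n → ℝ) → Fin n → ℝ}

/-- The rescaled residuals that are compared with the standardized errors. -/
def Node.rescaled (V : Node d q) (E : Expert d) (lam : ℕ) (s : ℝ) (n : ℕ)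
    (p : (Fin n → Fin d → ℝ) × (Fin n → ℝ)) (i : Fin n) : ℝ :=
  s * scaledResid E lam p.1 (V.ofStdErr n p.1 p.2) i

lemma Node.measurable_rescaled (V : Node d q) (E : Expert d) (lam : ℕ) (s : ℝ) (n : ℕ) (i : Fin n) :
    Measurable fun p => V.rescaled E lam s n p i :=
  (measurable_scaledResid measurable_fst
    (fun j => V.measurable_ofStdErr j measurable_fst measurable_snd) E lam i).const_mul s

lemma IsOracle.slow_rescaled (h : IsOracle S V E lam s K H) : Slow μ fun n ω _ =>
    ∑ i, (V.rescaled E (lam n) s n (S.zg V n ω) i - H n (S.zg V n ω) i) ^ 2 := h.slow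

lemma IsOracle.negligible_rescaled_sub [IsProbabilityMeasure μ] (h : IsOracle S V E lam s K H) :
    Negligible μ fun n ω => (n : ℝ)⁻¹ *
      ∑ i, (V.rescaled E (lam n) s n (S.zg V n ω) i - S.stdErr V n ω i) ^ 2 := by
  have h1 := h.slow_rescaled.negligible one_pos
  simp only [Real.rpow_one] at h1
  refine ((h1.const_mul 2).add (h.negligible.const_mul 2)).of_abs_le
    (Eventually.of_forall fun n => ae_of_all _ fun ω => ?_)
  have hn : (0 : ℝ) ≤ (n : ℝ)⁻¹ := by positivity
  rw [abs_of_nonneg (mul_nonneg hn (Finset.sum_nonneg fun _ _ => sq_nonneg _))]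
  refine le_trans ?_ (le_abs_self _)
  rw [mul_left_comm 2 (n : ℝ)⁻¹, mul_left_comm 2 (n : ℝ)⁻¹, ← mul_add, Finset.mul_sum _ _ 2,
    Finset.mul_sum _ _ 2, ← Finset.sum_add_distrib]
  refine mul_le_mul_of_nonneg_left (Finset.sum_le_sum fun i _ => ?_) hn
  change _ ≤ 2 * (V.rescaled E (lam n) s n (S.zg V n ω) i - H n (S.zg V n ω) i) ^ 2 + _
  nlinarith [sq_nonneg (V.rescaled E (lam n) s n (S.zg V n ω) i - H n (S.zg V n ω) i -
    (H n (S.zg V n ω) i - S.stdErr V n ω i))]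

lemma Source.VarBounds.negligible_mean_sq_stdErr [IsProbabilityMeasure μ] {c C : ℝ}
    (h : S.VarBounds V c C) (hc : 0 < c) :
    Negligible μ fun n ω => (n : ℝ)⁻¹ * ∑ i, S.stdErr V n ω i ^ 2 - 1 := by
  refine (negligible_mean_mul_stdErr h hc h hc).of_abs_le ?_
  filter_upwards [eventually_gt_atTop 0] with n hn
  filter_upwards [h n] with ω hω
  have hn' : (n : ℝ) ≠ 0 := by exact_mod_cast hn.ne'
  refine le_of_eq ?_
  simp only [sq, V.condCorr_self n _ (hc.trans_le (hω _).1), Finset.sum_const, Finset.card_univ,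
    Fintype.card_fin, nsmul_eq_mul, mul_one]
  rw [inv_mul_cancel₀ hn']

lemma IsOracle.negligible_mean_sq_rescaled [IsProbabilityMeasure μ]
    (h : IsOracle S V E lam s K H) {c C : ℝ} (hV : S.VarBounds V c C) (hc : 0 < c) :
    Negligible μ fun n ω => (n : ℝ)⁻¹ * ∑ i, V.rescaled E (lam n) s n (S.zg V n ω) i ^ 2 - 1 := by
  have h1 := hV.negligible_mean_sq_stdErr hc
  have h2 := Negligible.mean_mul_sub (m := fun _ _ => 1) h.negligible_rescaled_sub
    h.negligible_rescaled_sub h1 h1 (by simpa only [sq] using h1)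
  simpa only [sq] using h2

lemma IsOracle.parCorr_eq (h : IsOracle S V E lam s K H) (h' : IsOracle S W F lam t L H')
    {c C c' C' : ℝ} (hV : S.VarBounds V c C) (hc : 0 < c) (hW : S.VarBounds W c' C') (hc' : 0 < c')
    (n : ℕ) : ∀ᵐ ω ∂μ, parCorr E F (lam n) (S.Z n ω) (S.obs V n ω) (S.obs W n ω) =
      corr (V.rescaled E (lam n) s n (S.zg V n ω)) (W.rescaled F (lam n) t n (S.zg W n ω)) := by
  filter_upwards [hV n, hW n] with ω h1 h2
  rw [S.obs_eq_ofStdErr V fun i => hc.trans_le (h1 i).1,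
    S.obs_eq_ofStdErr W fun i => hc'.trans_le (h2 i).1, parCorr]
  exact (corr_const_mul h.pos h'.pos _ _).symm

/-- The estimated partial correlation is consistent. -/
lemma IsOracle.negligible_parCorr_sub [IsProbabilityMeasure μ] (h : IsOracle S V E lam s K H)
    (h' : IsOracle S W F lam t L H') {c C c' C' : ℝ} (hV : S.VarBounds V c C) (hc : 0 < c)
    (hW : S.VarBounds W c' C') (hc' : 0 < c') {ρ : ℝ} (hρ : IsPartialCorr S V W ρ) :
    Negligible μ fun n ω =>
      parCorr E F (lam n) (S.Z n ω) (S.obs V n ω) (S.obs W n ω) - ρ := by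
  have hnum : Negligible μ fun n ω => (n : ℝ)⁻¹ * ∑ i,
      V.rescaled E (lam n) s n (S.zg V n ω) i * W.rescaled F (lam n) t n (S.zg W n ω) i - ρ := by
    refine Negligible.mean_mul_sub (m := fun _ _ => ρ) h.negligible_rescaled_sub
      h'.negligible_rescaled_sub (hV.negligible_mean_sq_stdErr hc)
      (hW.negligible_mean_sq_stdErr hc') ?_
    simpa using (negligible_mean_mul_stdErr hV hc hW hc').add (negligible_iff_tendstoInMeasure.2 hρ)
  have hden := Negligible.comp₂ (F := fun a b => √a * √b) (a := 1) (b := 1) (μ := μ)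
    (by fun_prop) (h.negligible_mean_sq_rescaled hV hc) (h'.negligible_mean_sq_rescaled hW hc')
  simp only [Real.sqrt_one, mul_one] at hden
  have hquot := Negligible.comp₂ (F := fun a b => a / b) (a := ρ) (b := 1) (μ := μ)
    (ContinuousAt.div₀ continuousAt_fst continuousAt_snd one_ne_zero) hnum hden
  refine hquot.of_abs_le (Eventually.of_forall fun n => ?_)
  filter_upwards [h.parCorr_eq h' hV hc hW hc' n] with ω hω
  rw [hω, div_one]
  rfl

end Consistency

/-! ### Size and power of the test -/

section Test

variable {Ω : Type*} [MeasurableSpace Ω] {μ : Measure Ω} [IsProbabilityMeasure μ]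

/-- Linear combinations of conditionally orthogonal random variables with random coefficients. -/
lemma negligible_sum_mul_orthogonal {A B : ℕ → Type*} [∀ n, MeasurableSpace (A n)]
    [∀ n, MeasurableSpace (B n)] {ζ : ∀ n, Ω → A n} {η : ∀ n, Ω → B n} {ν : ∀ n, Measure (B n)}
    [∀ n, IsProbabilityMeasure (ν n)] (h : ∀ᶠ n in atTop, HasProdLaw (ζ n) (η n) (ν n) μ)
    {a : ∀ n, A n → Fin n → ℝ} (ha : ∀ n i, Measurable fun z => a n z i)
    {H : ∀ n, A n × B n → Fin n → ℝ} (hH : ∀ n i, Measurable fun p => H n p i) {K : ℝ}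
    (hK : ∀ᶠ n in atTop, ∀ᵐ ω ∂μ, OrthogonalCoords (ν n) K fun y => H n (ζ n ω, y))
    (hlim : Negligible μ fun n ω => (n : ℝ)⁻¹ * ∑ i, a n (ζ n ω) i ^ 2) :
    Negligible μ fun n ω => (√n)⁻¹ * ∑ i, a n (ζ n ω) i * H n (ζ n ω, η n ω) i := by
  have hsq : Negligible μ fun n ω =>
      ((√n)⁻¹ * ∑ i, a n (ζ n ω) i * H n (ζ n ω, η n ω) i) ^ 2 := by
    refine negligible_of_condLIntegral_le h
      (F := fun n p => ((√n)⁻¹ * ∑ i, a n p.1 i * H n p i) ^ 2)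
      (b := fun n z => K * ((n : ℝ)⁻¹ * ∑ i, a n z i ^ 2)) (Eventually.of_forall fun n => ?_)
      (fun n p => sq_nonneg _) (Eventually.of_forall fun n => ?_) ?_ (hlim.const_mul K)
    · have h1 : ∀ i, Measurable fun p : A n × B n => a n p.1 i := fun i =>
        (ha n i).comp measurable_fst
      have h2 := hH n
      fun_prop
    · have h1 := ha n
      fun_prop
    · filter_upwards [hK] with n hn
      filter_upwards [hn] with ω hω
      refine le_trans (le_of_eq ?_) ((hω.lintegral_sq_le fun i => (√n)⁻¹ * a n (ζ n ω) i).trans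
        (ENNReal.ofReal_le_ofReal (le_of_eq ?_)))
      · simp only [Finset.mul_sum, mul_assoc]
      · simp only [mul_pow, inv_pow, Real.sq_sqrt (Nat.cast_nonneg n), Finset.mul_sum]
  refine hsq.sqrt.of_abs_le (Eventually.of_forall fun n => ae_of_all _ fun ω => ?_)
  rw [Real.sqrt_sq_eq_abs, abs_abs]

/-- The direction of a vector, or the direction of the first axis if the vector vanishes. -/
def direction {n : ℕ} (r : Fin n → ℝ) (i : Fin n) : ℝ :=
  if ∑ j, r j ^ 2 = 0 then (if (i : ℕ) = 0 then 1 else 0) else r i / √(∑ j, r j ^ 2)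

lemma sum_direction_sq {n : ℕ} (hn : 0 < n) (r : Fin n → ℝ) : ∑ i, direction r i ^ 2 = 1 := by
  unfold direction
  split_ifs with h
  · rw [Finset.sum_eq_single ⟨0, hn⟩]
    · simp
    · intro i _ hi
      have : (i : ℕ) ≠ 0 := fun h => hi (Fin.ext h)
      simp [this]
    · simp
  · have h0 : 0 ≤ ∑ j, r j ^ 2 := Finset.sum_nonneg fun _ _ => sq_nonneg _
    simp only [div_pow, Real.sq_sqrt h0, ← Finset.sum_div]
    exact div_self h

lemma measurable_direction {α : Type*} [MeasurableSpace α] {n : ℕ} {r : α → Fin n → ℝ}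
    (hr : ∀ i, Measurable fun x => r x i) (i : Fin n) : Measurable fun x => direction (r x) i := by
  have h : Measurable fun x => ∑ j, r x j ^ 2 := by fun_prop
  exact Measurable.ite (h (measurableSet_singleton 0)) measurable_const ((hr i).div h.sqrt)

lemma measurePreserving_sum_direction {A : Type*} [MeasurableSpace A] {n : ℕ} (hn : 0 < n)
    {ζ : Ω → A} {η : Ω → Fin n → ℝ} (h : HasProdLaw ζ η (stdNormal (Fin n)) μ) {r : A → Fin n → ℝ}
    (hr : ∀ i, Measurable fun z => r z i) :
    MeasurePreserving (fun ω => ∑ i, direction (r (ζ ω)) i * η ω i) μ (gaussianReal 0 1) := by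
  have h1 := h.transform (T := fun z y => ∑ i, direction (r z) i * y i) (ν' := gaussianReal 0 1)
    (by
      have : ∀ i, Measurable fun p : A × (Fin n → ℝ) => direction (r p.1) i := fun i =>
        (measurable_direction hr i).comp _root_.measurable_fst
      fun_prop)
    (ae_of_all _ fun ω => (measurePreserving_unit _ (sum_direction_sq hn _)).map_eq)
  have h2 := congrArg (Measure.map Prod.snd) h1.map_eq
  have := Measure.isProbabilityMeasure_map (μ := μ) h.measurable_fst.aemeasurable
  rw [Measure.map_map _root_.measurable_snd (h1.measurable_fst.prodMk h1.measurable_snd),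
    Measure.map_snd_prod, measure_univ, one_smul] at h2
  exact ⟨h1.measurable_snd, h2⟩

variable {d q : ℕ} {S : Source μ d q} {V W : Node d q} {E F : Expert d} {lam : ℕ → ℕ}
  {s t K L : ℝ} {H H' : ∀ n, (Fin n → Fin d → ℝ) × (Fin n → ℝ) → Fin n → ℝ}

/-- Under the null hypothesis, the rescaled residuals of the second node may be replaced by its
standardized errors. -/
lemma IsOracle.negligible_sum_mul_sub (h : IsOracle S V E lam s K H)
    (h' : IsOracle S W F lam t L H')
    (hlaw : ∀ n, HasProdLaw (S.Z n) (fun ω => (S.stdErr V n ω, S.stdErr W n ω))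
      ((stdNormal (Fin n)).prod (stdNormal (Fin n))) μ) :
    Negligible μ fun n ω => (√n)⁻¹ * ∑ i, V.rescaled E (lam n) s n (S.zg V n ω) i *
      (W.rescaled F (lam n) t n (S.zg W n ω) i - S.stdErr W n ω i) := by
  have hR := fun n i => V.measurable_rescaled E (lam n) s n i
  have hQ := fun n i => W.measurable_rescaled F (lam n) t n i
  have hU : Negligible μ fun n ω => (n : ℝ)⁻¹ * ∑ i,
      (V.rescaled E (lam n) s n (S.zg V n ω) i - H n (S.zg V n ω) i) ^ 2 := by
    simpa only [Real.rpow_one] using h.slow_rescaled.negligible one_pos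
  have ha := negligible_sum_mul_orthogonal
    (ζ := fun n => S.zg W n) (η := fun n => S.stdErr V n) (ν := fun n => stdNormal (Fin n))
    (Eventually.of_forall fun n => (hlaw n).swap.of_prod)
    (a := fun n z i => W.rescaled F (lam n) t n z i - z.2 i) (fun n i => by
      have := hQ n
      fun_prop)
    (H := fun n p => H n (p.1.1, p.2)) (fun n i => (h.measurable n i).comp (by fun_prop))
    h.orthogonal h'.negligible_rescaled_sub
  have hb := negligible_sum_mul_orthogonal
    (ζ := fun n => S.zg V n) (η := fun n => S.stdErr W n) (ν := fun n => stdNormal (Fin n))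
    (Eventually.of_forall fun n => (hlaw n).of_prod)
    (a := fun n z i => V.rescaled E (lam n) s n z i - H n z i)
    (fun n i => (hR n i).sub (h.measurable n i))
    (H := fun n p => H' n (p.1.1, p.2)) (fun n i => (h'.measurable n i).comp (by fun_prop))
    h'.orthogonal hU
  have hc := negligible_sum_mul_orthogonal
    (ζ := fun n => S.zg V n) (η := fun n => S.stdErr W n) (ν := fun n => stdNormal (Fin n))
    (Eventually.of_forall fun n => (hlaw n).of_prod)
    (a := fun n z i => V.rescaled E (lam n) s n z i - H n z i)
    (fun n i => (hR n i).sub (h.measurable n i))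
    (H := fun n p => p.2) (fun n i => by fun_prop)
    (Eventually.of_forall fun n => ae_of_all _ fun ω => orthogonalCoords_id n) hU
  have hd : Negligible μ fun n ω => (√n)⁻¹ * ∑ i,
      (V.rescaled E (lam n) s n (S.zg V n ω) i - H n (S.zg V n ω) i) *
        (W.rescaled F (lam n) t n (S.zg W n ω) i - H' n (S.zg W n ω) i) := by
    have h1 := (h.slow_rescaled.mul h'.slow_rescaled).negligible one_pos
    simp only [Real.rpow_one] at h1
    refine h1.sqrt.of_abs_le (Eventually.of_forall fun n => ae_of_all _ fun ω => ?_)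
    refine le_trans (Real.abs_le_sqrt ?_) (le_abs_self _)
    rw [mul_pow, inv_pow, Real.sq_sqrt (Nat.cast_nonneg n)]
    exact mul_le_mul_of_nonneg_left (Finset.sum_mul_sq_le_sq_mul_sq _ _ _) (by positivity)
  refine ((ha.add (hb.add (hc.const_mul (-1)))).add hd).of_abs_le
    (Eventually.of_forall fun n => ae_of_all _ fun ω => le_of_eq ?_)
  congr 1
  rw [mul_left_comm (-1), Finset.mul_sum _ _ (-1), ← mul_add, ← mul_add, ← mul_add,
    ← Finset.sum_add_distrib, ← Finset.sum_add_distrib, ← Finset.sum_add_distrib]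
  congr 2
  ext i
  ring

end Test

section Asymptotics

/-- If the test rejects, then the linear form of `h` in the direction of `r` is large, provided
that `r` and `x` have mean squares close to one and `x` is close to `h`. -/
lemma lt_abs_sum_direction_of_lt {n : ℕ} (hn : 0 < n) {r x h : Fin n → ℝ} {T x₂ : ℝ}
    (hT : x₂ ≤ T) (hu : 0 < (n : ℝ)⁻¹ * ∑ i, r i ^ 2) (hv : 0 < (n : ℝ)⁻¹ * ∑ i, x i ^ 2)
    (hrej : T * √(1 - corr r x ^ 2) < |corr r x| * √((n : ℝ) - 2)) :
    x₂ * √(1 - corr r x ^ 2) * √((n : ℝ)⁻¹ * ∑ i, x i ^ 2) -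
      |(√n)⁻¹ * ∑ i, r i * (x i - h i)| / √((n : ℝ)⁻¹ * ∑ i, r i ^ 2) <
      |∑ i, direction r i * h i| := by
  have hn' : (0 : ℝ) < n := by exact_mod_cast hn
  have hsn : 0 < √(n : ℝ) := Real.sqrt_pos.2 hn'
  have hsum : 0 < ∑ i, r i ^ 2 := by
    rcases (mul_pos_iff_of_pos_left (inv_pos.2 hn')).1 hu with h
    exact h
  have hsu := Real.sqrt_pos.2 hu
  have hsv := Real.sqrt_pos.2 hv
  have hroot : √(∑ i, r i ^ 2) = √n * √((n : ℝ)⁻¹ * ∑ i, r i ^ 2) := by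
    rw [← Real.sqrt_mul hn'.le, mul_inv_cancel_left₀ hn'.ne']
  have hdir : ∑ i, direction r i * h i =
      (∑ i, r i * h i) / (√n * √((n : ℝ)⁻¹ * ∑ i, r i ^ 2)) := by
    rw [← hroot, Finset.sum_div]
    refine Finset.sum_congr rfl fun i _ => ?_
    rw [direction, if_neg hsum.ne']
    ring
  have hsplit : ∑ i, r i * x i = ∑ i, r i * h i + ∑ i, r i * (x i - h i) := by
    rw [← Finset.sum_add_distrib]
    exact Finset.sum_congr rfl fun i _ => by ring
  have hcorr : corr r x * √n * √((n : ℝ)⁻¹ * ∑ i, x i ^ 2) = ∑ i, direction r i * h i +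
      ((√n)⁻¹ * ∑ i, r i * (x i - h i)) / √((n : ℝ)⁻¹ * ∑ i, r i ^ 2) := by
    rw [hdir, corr, hsplit]
    have hsq : (n : ℝ)⁻¹ = (√n)⁻¹ * (√n)⁻¹ := by
      rw [← mul_inv, Real.mul_self_sqrt hn'.le]
    generalize √((n : ℝ)⁻¹ * ∑ i, r i ^ 2) = u at *
    generalize √((n : ℝ)⁻¹ * ∑ i, x i ^ 2) = v at *
    rw [hsq]
    field_simp
  have h1 : x₂ * √(1 - corr r x ^ 2) < |corr r x| * √n :=
    calc x₂ * √(1 - corr r x ^ 2) ≤ T * √(1 - corr r x ^ 2) :=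
          mul_le_mul_of_nonneg_right hT (Real.sqrt_nonneg _)
      _ < |corr r x| * √((n : ℝ) - 2) := hrej
      _ ≤ |corr r x| * √n :=
          mul_le_mul_of_nonneg_left (Real.sqrt_le_sqrt (by linarith)) (abs_nonneg _)
  have h2 := mul_lt_mul_of_pos_right h1 hsv
  have h3 : |corr r x| * √n * √((n : ℝ)⁻¹ * ∑ i, x i ^ 2) ≤ |∑ i, direction r i * h i| +
      |(√n)⁻¹ * ∑ i, r i * (x i - h i)| / √((n : ℝ)⁻¹ * ∑ i, r i ^ 2) := by
    have := congrArg abs hcorr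
    rw [abs_mul, abs_mul, abs_of_pos hsn, abs_of_pos hsv] at this
    rw [this]
    refine (abs_add_le _ _).trans (le_of_eq ?_)
    rw [abs_div, abs_of_pos hsu]
  linarith

variable {Ω : Type*} [MeasurableSpace Ω] {μ : Measure Ω} [IsProbabilityMeasure μ]
  {d q : ℕ} {S : Source μ d q} {V W : Node d q} {E F : Expert d} {lam : ℕ → ℕ}
  {s t K L c C c' C' : ℝ} {H H' : ∀ n, (Fin n → Fin d → ℝ) × (Fin n → ℝ) → Fin n → ℝ}

lemma isPartialCorr_zero (h : ∀ n, ∀ᵐ ω ∂μ, ∀ i, condCorr V W n i (S.Z n ω i) = 0) :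
    IsPartialCorr S V W 0 := by
  refine negligible_iff_tendstoInMeasure.1 ?_
  refine (Negligible.of_tendsto (tendsto_const_nhds (x := (0 : ℝ)))).of_abs_le
    (Eventually.of_forall fun n => ?_)
  filter_upwards [h n] with ω hω
  simp [hω]

/-- If the conditional correlations vanish, then the level of the test is asymptotically bounded
by the mass of the normal distribution outside of every interval that is smaller than the
asymptotic acceptance region. -/
lemma IsOracle.exists_rejectProb_le (h : IsOracle S V E lam s K H) (h' : IsOracle S W F lam t L H')
    (hV : S.VarBounds V c C) (hc : 0 < c) (hW : S.VarBounds W c' C') (hc' : 0 < c')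
    (hnull : ∀ n, ∀ᵐ ω ∂μ, ∀ i, condCorr V W n i (S.Z n ω i) = 0) {a x₁ x₂ : ℝ} (hx : x₁ < x₂)
    (hT : ∀ᶠ n : ℕ in atTop, x₂ ≤ tQuantile (1 - a / 2) ((n : ℝ) - 2 - d)) :
    ∃ δ : ℕ → ENNReal, Tendsto δ atTop (𝓝 0) ∧ ∀ᶠ n in atTop,
      μ {ω | Rejects E F (lam n) a (S.Z n ω) (S.obs V n ω) (S.obs W n ω)} ≤
        gaussianReal 0 1 {y | x₁ < |y|} + δ n := by
  have hlaw : ∀ n, HasProdLaw (S.Z n) (fun ω => (S.stdErr V n ω, S.stdErr W n ω))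
      ((stdNormal (Fin n)).prod (stdNormal (Fin n))) μ := fun n => by
    refine S.hasProdLaw_stdErr_pair V W n ?_ ?_ (hnull n)
    · filter_upwards [hV n] with ω hω i using hc.trans_le (hω i).1
    · filter_upwards [hW n] with ω hω i using hc'.trans_le (hω i).1
  have hρ := h.negligible_parCorr_sub h' hV hc hW hc' (isPartialCorr_zero hnull)
  have hu := h.negligible_mean_sq_rescaled hV hc
  have hv := h'.negligible_mean_sq_rescaled hW hc'
  have hr := h.negligible_sum_mul_sub h' hlaw
  have h1 := Negligible.comp₂ (F := fun ρ v => x₂ * √(1 - ρ ^ 2) * √v) (a := 0) (b := 1) (μ := μ)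
    (by fun_prop) hρ hv
  have h2 := Negligible.comp₂ (F := fun r u => |r| / √u) (a := 0) (b := 1) (μ := μ)
    (ContinuousAt.div₀ (by fun_prop) (by fun_prop) (by simp)) (by simpa using hr) hu
  have h3 := h1.add (h2.const_mul (-1))
  simp only [ne_eq, OfNat.ofNat_ne_zero, not_false_eq_true, zero_pow, sub_zero, Real.sqrt_one,
    mul_one, abs_zero, div_one] at h3
  have hδ := (h3 (x₂ - x₁) (by linarith)).add ((hu (1 / 2) (by norm_num)).add
    (hv (1 / 2) (by norm_num)))
  simp only [add_zero] at hδ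
  refine ⟨_, hδ, ?_⟩
  filter_upwards [hT, eventually_gt_atTop 0] with n hTn hn
  have hξ := measurePreserving_sum_direction hn (hlaw n).of_prod (r := V.rescaled E (lam n) s n)
    (fun i => V.measurable_rescaled E (lam n) s n i)
  have hlt : MeasurableSet {y : ℝ | x₁ < |y|} := measurableSet_lt measurable_const measurable_id.abs
  rw [← hξ.measure_preimage hlt.nullMeasurableSet]
  refine le_trans ?_ ((measure_union_le _ _).trans (add_le_add_right ((measure_union_le _ _).trans
    (add_le_add_right (measure_union_le _ _) _)) _))
  refine measure_mono_ae ?_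
  filter_upwards [h.parCorr_eq h' hV hc hW hc' n] with ω hω hrej
  by_contra hcon
  have hcon' : ¬ (_ ∨ _ ∨ _ ∨ _) := hcon
  push Not at hcon'
  obtain ⟨h4, h5, h6, h7⟩ := hcon'
  simp only [Set.mem_ofPred_eq, Set.mem_preimage, not_lt, not_le] at h4 h5 h6 h7
  rw [abs_lt] at h5 h6 h7
  have h8 : tQuantile (1 - a / 2) ((n : ℝ) - 2 - d) * _ < _ := hrej
  rw [hω] at h8 h5
  have h9 := lt_abs_sum_direction_of_lt hn (h := S.stdErr W n ω) hTn (by linarith) (by linarith) h8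
  linarith

/-- The level of the test is asymptotically respected. -/
lemma IsOracle.limsup_rejectProb_le (h : IsOracle S V E lam s K H) (h' : IsOracle S W F lam t L H')
    (hV : S.VarBounds V c C) (hc : 0 < c) (hW : S.VarBounds W c' C') (hc' : 0 < c')
    (hnull : ∀ n, ∀ᵐ ω ∂μ, ∀ i, condCorr V W n i (S.Z n ω i) = 0) {a : ℝ} (ha0 : 0 < a)
    (ha1 : a < 1) : limsup (rejectProb S V W E F lam a) atTop ≤ a := by
  refine le_of_forall_pos_le_add fun ε hε => ?_
  obtain ⟨x₁, x₂, hx0, hx, hx₂, hx₁⟩ := exists_normal_thresholds ha0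
    (show a < a + ε / 2 by linarith) ha1
  obtain ⟨δ, hδ, hle⟩ := h.exists_rejectProb_le h' hV hc hW hc' hnull hx
    ((tendsto_degreesOfFreedom d).eventually
      (eventually_le_tQuantile (p := 1 - a / 2) (by linarith) hx₂))
  refine limsup_le_of_le
    (isBoundedUnder_of ⟨0, fun n => measureReal_nonneg⟩).isCoboundedUnder_le ?_
  have hε' : (0 : ENNReal) < ENNReal.ofReal (ε / 2) := ENNReal.ofReal_pos.2 (by linarith)
  filter_upwards [hle, hδ.eventually_lt_const hε'] with n hn hδn
  refine ENNReal.toReal_le_of_le_ofReal (by linarith) ?_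
  refine hn.trans ((add_le_add hx₁ hδn.le).trans (le_of_eq ?_))
  rw [← ENNReal.ofReal_add (by linarith) (by linarith)]
  congr 1
  ring

lemma tendsto_measureReal_one {A : ℕ → Set Ω}
    (h : Tendsto (fun n => μ (A n)ᶜ) atTop (𝓝 0)) :
    Tendsto (fun n => μ.real (A n)) atTop (𝓝 1) := by
  have h1 : Tendsto (fun n => 1 - μ.real (A n)ᶜ) atTop (𝓝 1) := by
    have := (ENNReal.tendsto_toReal ENNReal.zero_ne_top).comp h
    simpa [Measure.real] using (tendsto_const_nhds (x := (1 : ℝ))).sub this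
  refine tendsto_of_tendsto_of_tendsto_of_le_of_le h1 tendsto_const_nhds (fun n => ?_)
    (fun n => measureReal_le_one)
  have := measureReal_union_le (μ := μ) (A n) (A n)ᶜ
  rw [Set.union_compl_self, probReal_univ] at this
  linarith

/-- The power of the test tends to one if the estimated partial correlation has a nonzero limit. -/
lemma tendsto_rejectProb_one {ρ : ℝ} (hρ : ρ ≠ 0)
    (h : Negligible μ fun n ω =>
      parCorr E F (lam n) (S.Z n ω) (S.obs V n ω) (S.obs W n ω) - ρ) {a : ℝ} (ha0 : 0 < a)
    (ha1 : a < 1) : Tendsto (rejectProb S V W E F lam a) atTop (𝓝 1) := by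
  refine tendsto_measureReal_one ?_
  obtain ⟨M, hM⟩ := eventually_tQuantile_le (p := 1 - a / 2) (by linarith) (by linarith)
  have hρ' : 0 < |ρ| / 2 := by positivity
  have hroot : Tendsto (fun n : ℕ => |ρ| / 2 * √((n : ℝ) - 2)) atTop atTop := by
    refine Tendsto.const_mul_atTop hρ' (Real.tendsto_sqrt_atTop.comp ?_)
    simpa using tendsto_degreesOfFreedom 0
  refine tendsto_measure_zero_of_ae_imp (h (|ρ| / 2) hρ') ?_
  filter_upwards [(tendsto_degreesOfFreedom d).eventually hM, hroot.eventually_gt_atTop (max M 0)]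
    with n h1 h2
  refine ae_of_all _ fun ω hω => ?_
  by_contra hcon
  refine hω ?_
  simp only [Set.mem_ofPred_eq, not_le] at hcon ⊢
  rw [Rejects]
  generalize parCorr E F (lam n) (S.Z n ω) (S.obs V n ω) (S.obs W n ω) = r at *
  have h3 : |ρ| / 2 ≤ |r| := by
    have := abs_sub_abs_le_abs_sub ρ r
    rw [abs_sub_comm] at this
    linarith
  have h4 : √(1 - r ^ 2) ≤ 1 := by
    rw [Real.sqrt_le_one]
    nlinarith [sq_nonneg r]
  calc tQuantile (1 - a / 2) ((n : ℝ) - 2 - d) * √(1 - r ^ 2)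
      ≤ max M 0 * √(1 - r ^ 2) :=
        mul_le_mul_of_nonneg_right (h1.trans (le_max_left _ _)) (Real.sqrt_nonneg _)
    _ ≤ max M 0 := mul_le_of_le_one_right (le_max_right _ _) h4
    _ < |ρ| / 2 * √((n : ℝ) - 2) := h2
    _ ≤ |r| * √((n : ℝ) - 2) := mul_le_mul_of_nonneg_right h3 (Real.sqrt_nonneg _)

end Asymptotics

end ParCorrWLS

end

theorem theorem1 {Ω : Type*} [MeasurableSpace Ω] [StandardBorelSpace Ω]
    (μ : MeasureTheory.Measure Ω) [MeasureTheory.IsProbabilityMeasure μ] (d q : ℕ)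
    (S : ParCorrWLS.Source μ d q) (X Y : ParCorrWLS.Node d q)
    (EX EY : ParCorrWLS.Expert d) (lam : ℕ → ℕ) (ρ : ℝ)
    (hlam : Filter.Tendsto lam Filter.atTop Filter.atTop)
    (hlam' : Filter.Tendsto (fun n : ℕ => (lam n : ℝ) / n) Filter.atTop (nhds 0))
    (hZ : ParCorrWLS.DesignAssumptions S)
    (hX : ParCorrWLS.NodeAssumptions S X EX lam)
    (hY : ParCorrWLS.NodeAssumptions S Y EY lam)
    (hρ : ParCorrWLS.IsPartialCorr S X Y ρ) :
    -- the estimated partial correlation is consistent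
    MeasureTheory.TendstoInMeasure μ
      (fun n ω => ParCorrWLS.parCorr EX EY (lam n) (S.Z n ω) (S.obs X n ω) (S.obs Y n ω))
      Filter.atTop (fun _ => ρ) ∧
    -- the test of every level is asymptotically of that level, and its power tends to one
    ∀ a : ℝ, 0 < a → a < 1 →
      (ParCorrWLS.CondIndepNodes S X Y →
        Filter.limsup (ParCorrWLS.rejectProb S X Y EX EY lam a) Filter.atTop ≤ a) ∧
      (ρ ≠ 0 →
        Filter.Tendsto (ParCorrWLS.rejectProb S X Y EX EY lam a) Filter.atTop (nhds 1)) := by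
  obtain ⟨s, K, H, h⟩ := ParCorrWLS.exists_isOracle hlam hlam' hZ hX
  obtain ⟨t, L, H', h'⟩ := ParCorrWLS.exists_isOracle hlam hlam' hZ hY
  obtain ⟨c, C, hc, -, hXb⟩ := hX.exists_varBounds
  obtain ⟨c', C', hc', -, hYb⟩ := hY.exists_varBounds
  have hlim := h.negligible_parCorr_sub h' hXb hc hYb hc' hρ
  exact ⟨ParCorrWLS.negligible_iff_tendstoInMeasure.1 hlim, fun a ha0 ha1 =>
    ⟨fun hnull => h.limsup_rejectProb_le h' hXb hc hYb hc' (fun n => hnull.condCorr_eq_zero n)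
      ha0 ha1, fun hne => ParCorrWLS.tendsto_rejectProb_one hne hlim ha0 ha1⟩⟩
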